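/- Let $M_1,M_2$ be compact connected smooth manifolds of dimensions $2n_1+1$, $2n_2+1$, with Sasakian structures $\mathcal S_i=(\xi_{M_i},\eta_{M_i},\Phi_i,g_i)$ that are quasi-regular: the Reeb field $\xi_{M_i}$ generates an effective (automatically locally free) circle action $\mathcal A_i$ of $S^1=\mathbb R/\mathbb Z$ on $M_i$, with the same period $\tau>0$ for $i=1,2$. Let $\mathfrak t_i$ be the Lie algebra of a maximal torus in the automorphism group of $\mathcal S_i$, and let $\mathfrak t^+(M_i)=\{v\in\mathfrak t_i:\eta_{M_i}(v)>0 \text{ everywhere on } M_i\}$ be the Sasaki cone. Let $l_1,l_2$ be relatively prime positive integers and let $M_{\mathbf l}=M_1\star_{\mathbf l}M_2$ be the $\mathbf l$-join, i.e. the quotient of $M_1\times M_2$ by the circle action $\theta\cdot(x,y)=(\mathcal A_1(l_2\theta,x),\mathcal A_2(-l_1\theta,y))$, which is generated by a multiple of $L_{\mathbf l}=\frac1{2l_1}\xi_{M_1}-\frac1{2l_2}\xi_{M_2}$. (In general $M_{\mathbf l}$ is an orbifold.) It has the contact form induced by $l_1\eta_{M_1}+l_2\eta_{M_2}$, and its Sasaki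 cone $\mathfrak t^+(M_{\mathbf l})$ consists of the elements of $(\mathfrak t_1\oplus\mathfrak t_2)/\mathbb R L_{\mathbf l}$ on which this form is everywhere positive. The $M_1$-subcone is the image of the map $\mathfrak t^+(M_1)\to\mathfrak t^+(M_{\mathbf l})$, $w\mapsto[(w/l_1,0)]$, which takes $\xi_{M_1}$ to the Reeb field $\xi_{\mathbf l}=\frac1{2l_1}\xi_{M_1}+\frac1{2l_2}\xi_{M_2}$; the $M_2$-subcone is the image of $\mathfrak t^+(M_2)$ under $w\mapsto[(0,w/l_2)]$. Let $\{i,j\}=\{1,2\}$, let $\xi_i\in\mathfrak t^+(M_i)$, and suppose that its image in the $M_i$-subcone of $\mathfrak t^+(M_{\mathbf l})$ is quasi-regular, i.e. that its flow on $M_{\mathbf l}$ is periodic. Then the flow of $\xi_i$ on $M_i$ is periodic as well. Let $N_{\xi_i}$ be the quotient orbifold of $M_i$ by this flow, and let $N_j=M_j/\mathcal A_j$. There is an integer $m\ge1$ such that the map from the quotient of $M_{\mathbf l}$ by the circle action generated by the image of $\xi_i$ to $N_j$ that is induced by the projection $M_1\times M_2\to M_j$ is an orbibundle with generic fibre $F=N_{\xi_i}/\mathbb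 Z_m$. Here $\mathbb Z_m\subset S^1$ is the cyclic subgroup of order $m$, acting on $N_{\xi_i}$ through the Reeb circle action $\mathcal A_i$. All quotients are taken as smooth effective orbifolds. "Orbibundle with generic fibre $F$" means that every point of the base lies in the image of an orbifold chart $U\to U/\Gamma$ of the base for which there are an action of $\Gamma$ on $F$ by orbifold diffeomorphisms and an isomorphism, over $U/\Gamma$, of the preimage of $U/\Gamma$ with the orbifold $(U\times F)/\Gamma$, with $\Gamma$ acting diagonally. -/

import Mathlib

open Set Topology
open scoped Manifold ContDiff

noncomputable section

/-! ## Sasakian manifolds -/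

section Sasakian

variable {n : ℕ} {M : Type*} [TopologicalSpace M]
  [ChartedSpace (EuclideanSpace ℝ (Fin n)) M]

/-- A (not necessarily continuous) vector field on an `n`-manifold. -/
abbrev VField (n : ℕ) (M : Type*) [TopologicalSpace M]
    [ChartedSpace (EuclideanSpace ℝ (Fin n)) M] : Type _ :=
  ∀ x : M, TangentSpace (𝓡 n) x

/-- The vector field `X` is smooth. -/
def SmoothVField [IsManifold (𝓡 n) ∞ M] (X : VField n M) : Prop :=
  ContMDiff (𝓡 n) (𝓡 n).tangent ∞ (fun x => (⟨x, X x⟩ : TangentBundle (𝓡 n) M))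

/-- The derivative `X(f)` of a function along a vector field. -/
def VField.deriv (X : VField n M) (f : M → ℝ) (x : M) : ℝ :=
  mfderiv (𝓡 n) 𝓘(ℝ, ℝ) f x (X x)

/-- The exterior derivative of a one-form, evaluated on two smooth vector fields:
`dη(X, Y) = X(η(Y)) - Y(η(X)) - η([X, Y])`. -/
def dOneForm (η : ∀ x : M, TangentSpace (𝓡 n) x →L[ℝ] ℝ) (X Y : VField n M) (x : M) : ℝ :=
  X.deriv (fun y => η y (Y y)) x - Y.deriv (fun y => η y (X y)) x
    - η x (VectorField.mlieBracket (𝓡 n) X Y x)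

end Sasakian

/-- A Sasakian structure `(ξ, η, Φ, g)` on a manifold of dimension `2n + 1`: a contact metric
structure, with `g = dη ∘ (1 × Φ) + η ⊗ η` a Riemannian metric, such that the Reeb field `ξ` is
Killing and the almost CR structure `(ker η, Φ)` is integrable. (That `η` is a contact form
follows from the positivity of `g`.) -/
structure SasakianStructure (n : ℕ) (M : Type*) [TopologicalSpace M]
    [ChartedSpace (EuclideanSpace ℝ (Fin (2 * n + 1))) M]
    [IsManifold (𝓡 (2 * n + 1)) ∞ M] where
  /-- the Reeb vector field -/
  ξ : VField (2 * n + 1) M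
  /-- the contact form -/
  η : ∀ x : M, TangentSpace (𝓡 (2 * n + 1)) x →L[ℝ] ℝ
  /-- the endomorphism field -/
  Φ : ∀ x : M, TangentSpace (𝓡 (2 * n + 1)) x →L[ℝ] TangentSpace (𝓡 (2 * n + 1)) x
  /-- the metric -/
  g : ∀ x : M, TangentSpace (𝓡 (2 * n + 1)) x →L[ℝ] TangentSpace (𝓡 (2 * n + 1)) x →L[ℝ] ℝ
  smooth_ξ : SmoothVField ξ
  smooth_η : ∀ X, SmoothVField X →
    ContMDiff (𝓡 (2 * n + 1)) 𝓘(ℝ, ℝ) ∞ (fun x => η x (X x))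
  smooth_Φ : ∀ X, SmoothVField X → SmoothVField (fun x => Φ x (X x))
  η_ξ : ∀ x, η x (ξ x) = 1
  dη_ξ : ∀ X, SmoothVField X → ∀ x, dOneForm η ξ X x = 0
  Φ_ξ : ∀ x, Φ x (ξ x) = 0
  Φ_sq : ∀ x v, Φ x (Φ x v) = -v + η x v • ξ x
  g_symm : ∀ x v w, g x v w = g x w v
  g_pos : ∀ x v, v ≠ 0 → 0 < g x v v
  g_eq : ∀ X Y, SmoothVField X → SmoothVField Y → ∀ x,
    g x (X x) (Y x) = dOneForm η X (fun y => Φ y (Y y)) x + η x (X x) * η x (Y x)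
  killing : ∀ X Y, SmoothVField X → SmoothVField Y → ∀ x,
    ξ.deriv (fun y => g y (X y) (Y y)) x
      = g x (VectorField.mlieBracket (𝓡 (2 * n + 1)) ξ X x) (Y x)
        + g x (X x) (VectorField.mlieBracket (𝓡 (2 * n + 1)) ξ Y x)
  /-- for sections `X, Y` of `ker η`, the field `[ΦX, Y] + [X, ΦY]` is a section of `ker η`, and
  the Nijenhuis tensor vanishes on `X, Y` -/
  cr_mem : ∀ X Y, SmoothVField X → SmoothVField Y → (∀ x, η x (X x) = 0) →
    (∀ x, η x (Y x) = 0) → ∀ x,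
    η x (VectorField.mlieBracket (𝓡 (2 * n + 1)) (fun y => Φ y (X y)) Y x
      + VectorField.mlieBracket (𝓡 (2 * n + 1)) X (fun y => Φ y (Y y)) x) = 0
  cr_nijenhuis : ∀ X Y, SmoothVField X → SmoothVField Y → (∀ x, η x (X x) = 0) →
    (∀ x, η x (Y x) = 0) → ∀ x,
    VectorField.mlieBracket (𝓡 (2 * n + 1)) (fun y => Φ y (X y)) (fun y => Φ y (Y y)) x
        - VectorField.mlieBracket (𝓡 (2 * n + 1)) X Y x
      = Φ x (VectorField.mlieBracket (𝓡 (2 * n + 1)) (fun y => Φ y (X y)) Y x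
          + VectorField.mlieBracket (𝓡 (2 * n + 1)) X (fun y => Φ y (Y y)) x)

/-- The map `f` preserves all four tensors of the Sasakian structure. -/
structure SasakianStructure.IsPreservedBy {n : ℕ} {M : Type*} [TopologicalSpace M]
    [ChartedSpace (EuclideanSpace ℝ (Fin (2 * n + 1))) M]
    [IsManifold (𝓡 (2 * n + 1)) ∞ M] (S : SasakianStructure n M) (f : M → M) : Prop where
  map_ξ : ∀ x, mfderiv (𝓡 (2 * n + 1)) (𝓡 (2 * n + 1)) f x (S.ξ x) = S.ξ (f x)
  map_η : ∀ x v, S.η (f x) (mfderiv (𝓡 (2 * n + 1)) (𝓡 (2 * n + 1)) f x v) = S.η x v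
  map_Φ : ∀ x v, mfderiv (𝓡 (2 * n + 1)) (𝓡 (2 * n + 1)) f x (S.Φ x v)
    = S.Φ (f x) (mfderiv (𝓡 (2 * n + 1)) (𝓡 (2 * n + 1)) f x v)
  map_g : ∀ x v w, S.g (f x) (mfderiv (𝓡 (2 * n + 1)) (𝓡 (2 * n + 1)) f x v)
    (mfderiv (𝓡 (2 * n + 1)) (𝓡 (2 * n + 1)) f x w) = S.g x v w

/-! ## Torus actions and the Sasaki cone -/

/-- A smooth effective action of the torus `ℝᵏ / ℤᵏ` on a manifold, written as a smooth action of
`ℝᵏ` whose kernel is exactly `ℤᵏ`. The Lie algebra of the torus is `ℝᵏ`, with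
`exp v = v mod ℤᵏ`. For `k = 1` this is an effective circle action. -/
structure TorusAction (k : ℕ) (d : ℕ) (M : Type*) [TopologicalSpace M]
    [ChartedSpace (EuclideanSpace ℝ (Fin d)) M] where
  act : (Fin k → ℝ) → M → M
  smooth : ContMDiff (𝓘(ℝ, Fin k → ℝ).prod (𝓡 d)) (𝓡 d) ∞
    (fun p : (Fin k → ℝ) × M => act p.1 p.2)
  act_zero : ∀ x, act 0 x = x
  act_add : ∀ v w x, act (v + w) x = act v (act w x)
  ker : ∀ v, (∀ x, act v x = x) ↔ ∀ i, ∃ a : ℤ, v i = a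

namespace TorusAction

section Basic

variable {k d : ℕ} {M : Type*} [TopologicalSpace M] [ChartedSpace (EuclideanSpace ℝ (Fin d)) M]

/-- The vector field on `M` generated by an element `v` of the Lie algebra: the velocity at
`t = 0` of `t ↦ exp(t v) x`. (The tangent spaces at the equal points `exp(0) x` and `x` are
identified.) -/
def gen (T : TorusAction k d M) (v : Fin k → ℝ) : VField d M := fun x =>
  id (α := EuclideanSpace ℝ (Fin d))
    (mfderiv 𝓘(ℝ, ℝ) (𝓡 d) (fun t : ℝ => T.act (t • v) x) 0 (1 : ℝ))

/-- The one-parameter group of `v` is periodic, i.e. its flow is a circle action. -/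
def IsPeriodic (T : TorusAction k d M) (v : Fin k → ℝ) : Prop :=
  ∃ P : ℝ, 0 < P ∧ ∀ x, T.act (P • v) x = x

/-- Two points are equivalent if they lie on one orbit of the flow `t ↦ exp(t v)`. -/
def orbitSetoid (T : TorusAction k d M) (v : Fin k → ℝ) : Setoid M where
  r x y := ∃ t : ℝ, T.act (t • v) x = y
  iseqv :=
    { refl := fun x => ⟨0, by rw [zero_smul, T.act_zero]⟩
      symm := by
        rintro x y ⟨t, rfl⟩
        exact ⟨-t, by rw [← T.act_add, ← add_smul, neg_add_cancel, zero_smul, T.act_zero]⟩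
      trans := by
        rintro x y z ⟨t, rfl⟩ ⟨s, rfl⟩
        exact ⟨s + t, by rw [← T.act_add, ← add_smul]⟩ }

/-- The quotient of `M` by the flow `t ↦ exp(t v)`, with the quotient topology. -/
abbrev FlowQuotient (T : TorusAction k d M) (v : Fin k → ℝ) : Type _ :=
  Quotient (T.orbitSetoid v)

end Basic

section Circle

variable {d : ℕ} {M : Type*} [TopologicalSpace M] [ChartedSpace (EuclideanSpace ℝ (Fin d)) M]

/-- The action of `θ ∈ ℝ / ℤ` for a circle action. -/
def rot (A : TorusAction 1 d M) (θ : ℝ) : M → M := A.act (fun _ => θ)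

theorem rot_zero (A : TorusAction 1 d M) (x : M) : A.rot 0 x = x := A.act_zero x

theorem rot_rot (A : TorusAction 1 d M) (s t : ℝ) (x : M) :
    A.rot s (A.rot t x) = A.rot (s + t) x := (A.act_add _ _ x).symm

/-- The quotient of `M` by a circle action. -/
abbrev CircleQuotient (A : TorusAction 1 d M) : Type _ := A.FlowQuotient (fun _ => 1)

end Circle

section Sasaki

variable {k n : ℕ} {M : Type*} [TopologicalSpace M]
  [ChartedSpace (EuclideanSpace ℝ (Fin (2 * n + 1))) M] [IsManifold (𝓡 (2 * n + 1)) ∞ M]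

/-- The Reeb field of `S` generates the effective circle action `A`, with period `τ`: rotation
by `θ ∈ ℝ / ℤ` is the Reeb flow at time `τ θ`. (The action is locally free since `ξ` has no
zeros.) So `S` is quasi-regular. -/
def IsReebCircle (A : TorusAction 1 (2 * n + 1) M) (S : SasakianStructure n M) (τ : ℝ) : Prop :=
  0 < τ ∧ ∀ x, A.gen (fun _ => 1) x = τ • S.ξ x

/-- The torus acts by automorphisms of the Sasakian structure, and the subgroup of the
automorphism group that it defines lies in no larger torus. -/
def IsMaximalTorus (T : TorusAction k (2 * n + 1) M) (S : SasakianStructure n M) : Prop :=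
  (∀ v, S.IsPreservedBy (T.act v)) ∧
    ∀ (k' : ℕ) (T' : TorusAction k' (2 * n + 1) M), (∀ v, S.IsPreservedBy (T'.act v)) →
      range T.act ⊆ range T'.act → range T'.act ⊆ range T.act

/-- The unreduced Sasaki cone `{ξ ∈ 𝔱 | η(ξ) > 0 everywhere}`. -/
def sasakiCone (T : TorusAction k (2 * n + 1) M) (S : SasakianStructure n M) :
    Set (Fin k → ℝ) :=
  {v | ∀ x, 0 < S.η x (T.gen v x)}

end Sasaki

end TorusAction

/-! ## Effective orbifolds -/

/-- A `d`-dimensional orbifold chart (local uniformizing chart) on a topological space `X`: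
a connected open set `U` of `ℝᵈ`, a finite group `Γ` of diffeomorphisms of `U` (so `Γ` acts
effectively), and a map `φ : U → X` inducing a homeomorphism of `U / Γ` with an open subset
of `X`. -/
structure OrbChart (d : ℕ) (X : Type*) [TopologicalSpace X] where
  U : TopologicalSpace.Opens (EuclideanSpace ℝ (Fin d))
  connected : IsConnected (U : Set (EuclideanSpace ℝ (Fin d)))
  Γ : Subgroup (Equiv.Perm U)
  finite : Finite Γ
  smooth : ∀ γ ∈ Γ, ContMDiff (𝓡 d) (𝓡 d) ∞ (γ : U → U)
  φ : U → X
  continuous : Continuous φ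
  isOpenMap : IsOpenMap φ
  fibers : ∀ u u' : U, φ u = φ u' ↔ ∃ γ ∈ Γ, γ u = u'

/-- `f : P → X` and `g : Q → X` are locally related by diffeomorphisms: whenever
`f p = g q`, there is a diffeomorphism `λ` from a neighbourhood of `p` onto a neighbourhood of
`q` with `λ p = q` and `g ∘ λ = f`. -/
def LocallyDiffeomorphic {E H E' H' P Q X : Type*}
    [NormedAddCommGroup E] [NormedSpace ℝ E] [TopologicalSpace H] (I : ModelWithCorners ℝ E H)
    [NormedAddCommGroup E'] [NormedSpace ℝ E'] [TopologicalSpace H']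
    (J : ModelWithCorners ℝ E' H')
    [TopologicalSpace P] [ChartedSpace H P] [TopologicalSpace Q] [ChartedSpace H' Q]
    (f : P → X) (g : Q → X) : Prop :=
  ∀ p q, f p = g q → ∃ L : PartialDiffeomorph I J P Q ∞,
    p ∈ L.source ∧ L p = q ∧ ∀ w ∈ L.source, g (L w) = f w

/-- The charts in `𝒜` form an orbifold atlas: the space is Hausdorff and second countable, the
charts cover it, and any two of them are compatible. -/
structure IsOrbifoldAtlas {d : ℕ} {X : Type*} [TopologicalSpace X] (𝒜 : Set (OrbChart d X)) :
    Prop where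
  t2 : T2Space X
  secondCountable : SecondCountableTopology X
  covers : ∀ x, ∃ c ∈ 𝒜, x ∈ range c.φ
  compatible : ∀ c ∈ 𝒜, ∀ c' ∈ 𝒜, LocallyDiffeomorphic (𝓡 d) (𝓡 d) c.φ c'.φ

/-- The homeomorphism `f` is a diffeomorphism of orbifolds. -/
def IsOrbifoldDiffeo {d : ℕ} {X Y : Type*} [TopologicalSpace X] [TopologicalSpace Y]
    (𝒜 : Set (OrbChart d X)) (ℬ : Set (OrbChart d Y)) (f : X ≃ₜ Y) : Prop :=
  ∀ c ∈ 𝒜, ∀ c' ∈ ℬ, LocallyDiffeomorphic (𝓡 d) (𝓡 d) (fun u => f (c.φ u)) c'.φ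

/-- The orbifold charts on a quotient `q : M → X` of a manifold by a locally free action, where
`𝒱 x` is the tangent space of the orbit of `x`: those whose map `φ` lifts locally to a smooth
immersion into `M` transverse to the orbits and of complementary dimension. -/
def quotientCharts {E H M X : Type*} [NormedAddCommGroup E] [NormedSpace ℝ E]
    [TopologicalSpace H] (I : ModelWithCorners ℝ E H) [TopologicalSpace M] [ChartedSpace H M]
    [TopologicalSpace X] (q : M → X) (𝒱 : ∀ x : M, Submodule ℝ (TangentSpace I x)) (d : ℕ) :
    Set (OrbChart d X) :=
  {c | ∀ u : c.U, ∃ (A : Set c.U) (s : c.U → M), IsOpen A ∧ u ∈ A ∧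
    ContMDiffOn (𝓡 d) I ∞ s A ∧ (∀ w ∈ A, q (s w) = c.φ w) ∧
    Function.Injective (mfderiv (𝓡 d) I s u) ∧
    IsCompl (mfderiv (𝓡 d) I s u).range (𝒱 (s u))}

/-- The map `p : Z → B` is an orbibundle with generic fibre the orbifold `F`: it is a continuous
map of orbifolds, and every point of `B` lies in the image of a chart `(U, Γ, φ)` of `B` such
that, for some action `ρ` of `Γ` on `F` by orbifold diffeomorphisms, `p` over `φ(U) ≅ U / Γ` is
isomorphic to `(U × F) / Γ → U / Γ`, with `Γ` acting diagonally. The isomorphism is given by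
`Ψ : U × F → Z`, which induces an orbifold diffeomorphism of `(U × F) / Γ` with `p⁻¹(φ(U))`. -/
structure IsOrbibundle {dZ dB dF : ℕ} {Z B F : Type*} [TopologicalSpace Z] [TopologicalSpace B]
    [TopologicalSpace F] (𝒵 : Set (OrbChart dZ Z)) (ℬ : Set (OrbChart dB B))
    (ℱ : Set (OrbChart dF F)) (p : Z → B) : Prop where
  total : IsOrbifoldAtlas 𝒵
  base : IsOrbifoldAtlas ℬ
  fibre : IsOrbifoldAtlas ℱ
  continuous : Continuous p
  locally_trivial : ∀ b : B, ∃ c ∈ ℬ, b ∈ range c.φ ∧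
    ∃ (ρ : c.Γ →* (F ≃ₜ F)) (Ψ : c.U × F → Z),
      (∀ γ, IsOrbifoldDiffeo ℱ ℱ (ρ γ)) ∧
      Continuous Ψ ∧ IsOpenMap Ψ ∧ range Ψ = p ⁻¹' range c.φ ∧
      (∀ u f, p (Ψ (u, f)) = c.φ u) ∧
      (∀ u f u' f', Ψ (u, f) = Ψ (u', f') ↔
        ∃ γ : c.Γ, (γ : Equiv.Perm c.U) u = u' ∧ ρ γ f = f') ∧
      ∀ e ∈ ℱ, ∀ c' ∈ 𝒵, LocallyDiffeomorphic ((𝓡 dB).prod (𝓡 dF)) (𝓡 dZ)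
        (fun w : c.U × e.U => Ψ (w.1, e.φ w.2)) c'.φ

/-! ## The join -/

section Join

variable {d₁ d₂ : ℕ} {M₁ M₂ : Type*}
  [TopologicalSpace M₁] [ChartedSpace (EuclideanSpace ℝ (Fin d₁)) M₁]
  [TopologicalSpace M₂] [ChartedSpace (EuclideanSpace ℝ (Fin d₂)) M₂]

/-- The orbits of the circle action `θ · (x, y) = (A₁(l₂ θ, x), A₂(-l₁ θ, y))` on `M₁ × M₂`. -/
def joinSetoid (A₁ : TorusAction 1 d₁ M₁) (A₂ : TorusAction 1 d₂ M₂) (l₁ l₂ : ℕ) :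
    Setoid (M₁ × M₂) where
  r p q := ∃ θ : ℝ, A₁.rot (l₂ * θ) p.1 = q.1 ∧ A₂.rot (-(l₁ * θ)) p.2 = q.2
  iseqv :=
    { refl := fun p => ⟨0, by simp [TorusAction.rot_zero]⟩
      symm := by
        rintro ⟨x, y⟩ ⟨x', y'⟩ ⟨θ, rfl, rfl⟩
        exact ⟨-θ, by simp [TorusAction.rot_rot, TorusAction.rot_zero]⟩
      trans := by
        rintro ⟨x, y⟩ ⟨x', y'⟩ ⟨x'', y''⟩ ⟨θ, rfl, rfl⟩ ⟨θ', rfl, rfl⟩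
        refine ⟨θ' + θ, ?_, ?_⟩
        · simp [TorusAction.rot_rot, mul_add]
        · simp only [TorusAction.rot_rot]
          congr 1
          ring }

/-- The `(l₁, l₂)`-join `M₁ ⋆ M₂`, with the quotient topology. -/
abbrev Join (A₁ : TorusAction 1 d₁ M₁) (A₂ : TorusAction 1 d₂ M₂) (l₁ l₂ : ℕ) : Type _ :=
  Quotient (joinSetoid A₁ A₂ l₁ l₂)

/-- The class of `(x, y)` in the join. -/
def Join.mk (A₁ : TorusAction 1 d₁ M₁) (A₂ : TorusAction 1 d₂ M₂) (l₁ l₂ : ℕ) (x : M₁) (y : M₂) :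
    Join A₁ A₂ l₁ l₂ := Quotient.mk (joinSetoid A₁ A₂ l₁ l₂) (x, y)

variable {k₁ k₂ : ℕ}

/-- The element `(v₁, v₂)` of `𝔱₁ ⊕ 𝔱₂` induces a flow on the join, which takes the class of
`(x, y)` at time `t` to the class of `(exp(t v₁) x, exp(t v₂) y)`. This relation says that the flow
takes `a` to `b` at some time. -/
def joinFlowRel (A₁ : TorusAction 1 d₁ M₁) (A₂ : TorusAction 1 d₂ M₂) (l₁ l₂ : ℕ)
    (T₁ : TorusAction k₁ d₁ M₁) (T₂ : TorusAction k₂ d₂ M₂) (v₁ : Fin k₁ → ℝ) (v₂ : Fin k₂ → ℝ)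
    (a b : Join A₁ A₂ l₁ l₂) : Prop :=
  ∃ (t : ℝ) (x : M₁) (y : M₂), a = Join.mk A₁ A₂ l₁ l₂ x y ∧
    b = Join.mk A₁ A₂ l₁ l₂ (T₁.act (t • v₁) x) (T₂.act (t • v₂) y)

/-- The flow of `(v₁, v₂)` on the join is periodic, i.e. it is a circle action. -/
def IsJoinPeriodic (A₁ : TorusAction 1 d₁ M₁) (A₂ : TorusAction 1 d₂ M₂) (l₁ l₂ : ℕ)
    (T₁ : TorusAction k₁ d₁ M₁) (T₂ : TorusAction k₂ d₂ M₂) (v₁ : Fin k₁ → ℝ) (v₂ : Fin k₂ → ℝ) :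
    Prop :=
  ∃ P : ℝ, 0 < P ∧ ∀ x y, Join.mk A₁ A₂ l₁ l₂ (T₁.act (P • v₁) x) (T₂.act (P • v₂) y)
    = Join.mk A₁ A₂ l₁ l₂ x y

/-- The quotient of the join by the flow of `(v₁, v₂)`, with the quotient topology. -/
abbrev JoinFlowQuotient (A₁ : TorusAction 1 d₁ M₁) (A₂ : TorusAction 1 d₂ M₂) (l₁ l₂ : ℕ)
    (T₁ : TorusAction k₁ d₁ M₁) (T₂ : TorusAction k₂ d₂ M₂) (v₁ : Fin k₁ → ℝ) (v₂ : Fin k₂ → ℝ) :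
    Type _ :=
  Quot (joinFlowRel A₁ A₂ l₁ l₂ T₁ T₂ v₁ v₂)

/-- The quotient `N / ℤ_m`, where `N` is the quotient of `M` by the flow of `w`, and the subgroup
`ℤ_m = (1/m)ℤ / ℤ` of the circle `ℝ / ℤ` acts on `N` through the circle action `A` on `M`. -/
abbrev CyclicQuotient {k d : ℕ} {M : Type*} [TopologicalSpace M]
    [ChartedSpace (EuclideanSpace ℝ (Fin d)) M] (A : TorusAction 1 d M) (T : TorusAction k d M)
    (w : Fin k → ℝ) (m : ℕ) : Type _ :=
  Quot (fun a b : T.FlowQuotient w => ∃ (j : ℤ) (x : M),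
    a = Quotient.mk (T.orbitSetoid w) x ∧ b = Quotient.mk (T.orbitSetoid w) (A.rot (j / m) x))

/-- The orbifold charts of the quotient of `M` by the flow of `w`. -/
def flowQuotientCharts {k d : ℕ} {M : Type*} [TopologicalSpace M]
    [ChartedSpace (EuclideanSpace ℝ (Fin d)) M] (T : TorusAction k d M) (w : Fin k → ℝ) (e : ℕ) :
    Set (OrbChart e (T.FlowQuotient w)) :=
  quotientCharts (𝓡 d) (Quotient.mk (T.orbitSetoid w))
    (fun x => Submodule.span ℝ {T.gen w x}) e

/-- The orbifold charts of `N / ℤ_m`. -/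
def cyclicQuotientCharts {k d : ℕ} {M : Type*} [TopologicalSpace M]
    [ChartedSpace (EuclideanSpace ℝ (Fin d)) M] (A : TorusAction 1 d M) (T : TorusAction k d M)
    (w : Fin k → ℝ) (m : ℕ) (e : ℕ) : Set (OrbChart e (CyclicQuotient A T w m)) :=
  quotientCharts (𝓡 d) (fun x => Quot.mk _ (Quotient.mk (T.orbitSetoid w) x))
    (fun x => Submodule.span ℝ {T.gen w x}) e

/-- A pair of tangent vectors as a tangent vector of the product. -/
def pairVec {x : M₁} {y : M₂} (a : TangentSpace (𝓡 d₁) x) (b : TangentSpace (𝓡 d₂) y) :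
    TangentSpace ((𝓡 d₁).prod (𝓡 d₂)) (x, y) :=
  id (α := EuclideanSpace ℝ (Fin d₁) × EuclideanSpace ℝ (Fin d₂)) (a, b)

/-- The orbifold charts of the quotient of the join by the flow of `(v₁, v₂)`. This is a quotient
of `M₁ × M₂`, whose orbits are spanned by `(v₁, v₂)` and by the generator of the circle action
that defines the join. -/
def joinFlowQuotientCharts (A₁ : TorusAction 1 d₁ M₁) (A₂ : TorusAction 1 d₂ M₂) (l₁ l₂ : ℕ)
    (T₁ : TorusAction k₁ d₁ M₁) (T₂ : TorusAction k₂ d₂ M₂) (v₁ : Fin k₁ → ℝ) (v₂ : Fin k₂ → ℝ)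
    (e : ℕ) : Set (OrbChart e (JoinFlowQuotient A₁ A₂ l₁ l₂ T₁ T₂ v₁ v₂)) :=
  quotientCharts ((𝓡 d₁).prod (𝓡 d₂)) (fun p : M₁ × M₂ => Quot.mk _ (Join.mk A₁ A₂ l₁ l₂ p.1 p.2))
    (fun p => Submodule.span ℝ
      {pairVec (T₁.gen v₁ p.1) (T₂.gen v₂ p.2),
        pairVec (A₁.gen (fun _ => l₂) p.1) (A₂.gen (fun _ => -l₁) p.2)}) e

end Join

section JoinCone

variable {n₁ n₂ k₁ k₂ : ℕ} {M₁ M₂ : Type*}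
  [TopologicalSpace M₁] [ChartedSpace (EuclideanSpace ℝ (Fin (2 * n₁ + 1))) M₁]
  [IsManifold (𝓡 (2 * n₁ + 1)) ∞ M₁]
  [TopologicalSpace M₂] [ChartedSpace (EuclideanSpace ℝ (Fin (2 * n₂ + 1))) M₂]
  [IsManifold (𝓡 (2 * n₂ + 1)) ∞ M₂]

/-- The Sasaki cone of the join, as the set of representatives in `𝔱₁ ⊕ 𝔱₂` of elements of
`(𝔱₁ ⊕ 𝔱₂) / {L}`: the join carries the contact form `l₁ η₁ + l₂ η₂`. -/
def joinSasakiCone (S₁ : SasakianStructure n₁ M₁) (S₂ : SasakianStructure n₂ M₂)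
    (T₁ : TorusAction k₁ (2 * n₁ + 1) M₁) (T₂ : TorusAction k₂ (2 * n₂ + 1) M₂) (l₁ l₂ : ℕ) :
    Set ((Fin k₁ → ℝ) × (Fin k₂ → ℝ)) :=
  {v | ∀ x y, 0 < l₁ * S₁.η x (T₁.gen v.1 x) + l₂ * S₂.η y (T₂.gen v.2 y)}

/-- The element of the Sasaki cone of the join represented by `(v₁, v₂)` is the image of the
element `w` of `𝔱⁺(M₁)` in the `M₁`-subcone. The image of `w` is represented by `(w / l₁, 0)`, up to
multiples of `L = ξ₁ / (2 l₁) - ξ₂ / (2 l₂)`. In particular, the image of `ξ₁` is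
`ξ₁ / (2 l₁) + ξ₂ / (2 l₂)`, the Reeb field of `l₁ η₁ + l₂ η₂`. -/
def IsLeftSubconeImage (S₁ : SasakianStructure n₁ M₁) (S₂ : SasakianStructure n₂ M₂)
    (T₁ : TorusAction k₁ (2 * n₁ + 1) M₁) (T₂ : TorusAction k₂ (2 * n₂ + 1) M₂) (l₁ l₂ : ℕ)
    (w : Fin k₁ → ℝ) (v : (Fin k₁ → ℝ) × (Fin k₂ → ℝ)) : Prop :=
  w ∈ T₁.sasakiCone S₁ ∧ v ∈ joinSasakiCone S₁ S₂ T₁ T₂ l₁ l₂ ∧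
    ∃ c : ℝ, (∀ x, T₁.gen v.1 x = (1 / l₁ : ℝ) • T₁.gen w x + (c / (2 * l₁)) • S₁.ξ x) ∧
      ∀ y, T₂.gen v.2 y = -(c / (2 * l₂)) • S₂.ξ y

/-- The same for the `M₂`-subcone: the image of `w` in `𝔱⁺(M₂)` is represented by `(0, w / l₂)`, up
to multiples of `L`. -/
def IsRightSubconeImage (S₁ : SasakianStructure n₁ M₁) (S₂ : SasakianStructure n₂ M₂)
    (T₁ : TorusAction k₁ (2 * n₁ + 1) M₁) (T₂ : TorusAction k₂ (2 * n₂ + 1) M₂) (l₁ l₂ : ℕ)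
    (w : Fin k₂ → ℝ) (v : (Fin k₁ → ℝ) × (Fin k₂ → ℝ)) : Prop :=
  w ∈ T₂.sasakiCone S₂ ∧ v ∈ joinSasakiCone S₁ S₂ T₁ T₂ l₁ l₂ ∧
    ∃ c : ℝ, (∀ x, T₁.gen v.1 x = (c / (2 * l₁)) • S₁.ξ x) ∧
      ∀ y, T₂.gen v.2 y = (1 / l₂ : ℝ) • T₂.gen w y - (c / (2 * l₂)) • S₂.ξ y

end JoinCone

end

/-! Take i = 1; for i = 2 the factors change places. The join circle has generator τ(l₂ξ₁, -l₁ξ₂), a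
multiple of L, because both Reeb circles have the same period τ. Hence a representative (v₁, v₂) of
the image of w flows like (w/l₁, 0) up to a reparametrized join circle. The quotient of the join by
its flow is therefore the quotient of M₁ × M₂ by the ℝ²-action (r, θ) · (x, y) = (exp(r w) A₁(l₂θ)
x, A₂(-l₁θ) y). This needs the torus to commute with `A₁`, which holds since it preserves ξ₁ and
integral curves are unique.

Periodicity of w: a period P on the join gives, for all x and y, some θ with exp((P/l₁) w) x =
A₁(l₂θ) x and A₂(l₁θ) y = y. The angle depends on x, but for a fixed y the stabilizer is finite of
some order N, so N l₁ θ is an integer and N l₁ steps bring every x back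
(`isPeriodic_of_forall_exists`).

The bundle: put p = l₂, q = l₁ and t = -qθ. Given t modulo ℤ, θ is determined modulo (1/q)ℤ, so the
rotation pθ of N = N_w is determined modulo (p/q)ℤ, which together with ℤ is (1/q)ℤ because p and q
are coprime. Thus two points are equivalent exactly when a rotation by t relates their components in
M₂ and a rotation by -(p/q)t relates the images of their components in F = N/ℤ_q
(`joinAction_rel_iff`). The quotient is the associated bundle M₂ ×_{S¹} F, and m = l₁. Over a slice
U of the circle action on M₂ with group Γ this is (U × F)/Γ, with Γ acting on F by these rotations
(`isOrbibundle_of_isOrbitMap`).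

The three orbifolds are handled together as quotients by a `LocallyFreeAction` of V × ℤ: V = ℝ with
discrete rotations for F, V = ℝ for the base, V = ℝ² for the total space. The slice theorem
(`exists_slice`) yields the charts. Every smoothness claim about orbifolds reduces to
`locallyDiffeomorphic_of_hasTransverseLift`: two transversals meeting the same orbits are locally
identified by sliding along the orbits. -/

noncomputable section

/-! ## Smooth maps between manifolds -/

section SmoothMaps

variable {E E' E'' H H' H'' M N Q : Type*}
  [NormedAddCommGroup E] [NormedSpace ℝ E] [TopologicalSpace H] {I : ModelWithCorners ℝ E H}
  [NormedAddCommGroup E'] [NormedSpace ℝ E'] [TopologicalSpace H'] {J : ModelWithCorners ℝ E' H'}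
  [NormedAddCommGroup E''] [NormedSpace ℝ E''] [TopologicalSpace H'']
  {K : ModelWithCorners ℝ E'' H''}
  [TopologicalSpace M] [ChartedSpace H M] [TopologicalSpace N] [ChartedSpace H' N]
  [TopologicalSpace Q] [ChartedSpace H'' Q]

/-- The derivative of a map between manifolds, as a linear map between the model spaces. -/
def modelDeriv (I : ModelWithCorners ℝ E H) (J : ModelWithCorners ℝ E' H') (f : M → N) (x : M) :
    E →L[ℝ] E' := mfderiv I J f x

theorem modelDeriv_comp {g : N → Q} {f : M → N} {x : M} (hg : MDifferentiableAt J K g (f x))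
    (hf : MDifferentiableAt I J f x) :
    modelDeriv I K (g ∘ f) x = (modelDeriv J K g (f x)).comp (modelDeriv I J f x) :=
  mfderiv_comp x hg hf

theorem modelDeriv_comp_apply {g : N → Q} {f : M → N} {x : M}
    (hg : MDifferentiableAt J K g (f x)) (hf : MDifferentiableAt I J f x) (v : E) :
    modelDeriv I K (fun y => g (f y)) x v = modelDeriv J K g (f x) (modelDeriv I J f x v) :=
  congrArg (fun L : E →L[ℝ] E'' => L v) (modelDeriv_comp hg hf)

theorem modelDeriv_congr {f g : M → N} {x : M} (h : f =ᶠ[𝓝 x] g) :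
    modelDeriv I J f x = modelDeriv I J g x := h.mfderiv_eq

theorem modelDeriv_id (x : M) : modelDeriv I I (id : M → M) x = ContinuousLinearMap.id ℝ E :=
  mfderiv_id

theorem modelDeriv_const (x : M) (c : N) : modelDeriv I J (fun _ => c) x = 0 :=
  mfderiv_const

theorem modelDeriv_eq_fderiv (f : E → E') (x : E) :
    modelDeriv 𝓘(ℝ, E) 𝓘(ℝ, E') f x = fderiv ℝ f x := mfderiv_eq_fderiv

theorem modelDeriv_fst (x : M × N) :
    modelDeriv (I.prod J) I Prod.fst x = ContinuousLinearMap.fst ℝ E E' := mfderiv_fst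

theorem modelDeriv_snd (x : M × N) :
    modelDeriv (I.prod J) J Prod.snd x = ContinuousLinearMap.snd ℝ E E' := mfderiv_snd

theorem modelDeriv_prodMk {f : M → N} {g : M → Q} {x : M} (hf : MDifferentiableAt I J f x)
    (hg : MDifferentiableAt I K g x) (v : E) :
    modelDeriv I (J.prod K) (fun y => (f y, g y)) x v
      = (modelDeriv I J f x v, modelDeriv I K g x v) :=
  congrArg (fun L : E →L[ℝ] E' × E'' => L v) (mfderiv_prodMk hf hg)

theorem modelDeriv_prod {f : M × N → Q} {p : M × N} (hf : MDifferentiableAt (I.prod J) K f p)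
    (v : E × E') :
    modelDeriv (I.prod J) K f p v = modelDeriv I K (fun z => f (z, p.2)) p.1 v.1
      + modelDeriv J K (fun z => f (p.1, z)) p.2 v.2 :=
  mfderiv_prod_eq_add_apply hf

theorem modelDeriv_bijective_of_leftInverse {f : M → N} {g : N → M} {x : M}
    (hf : MDifferentiableAt I J f x) (hg : MDifferentiableAt J I g (f x)) (hx : g (f x) = x)
    (h₁ : ∀ᶠ y in 𝓝 x, g (f y) = y) (h₂ : ∀ᶠ y in 𝓝 (f x), f (g y) = y) :
    Function.Bijective (modelDeriv I J f x) := by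
  have e₁ : (modelDeriv J I g (f x)).comp (modelDeriv I J f x) = ContinuousLinearMap.id ℝ E := by
    rw [← modelDeriv_comp hg hf, ← modelDeriv_id (I := I) x]
    exact modelDeriv_congr h₁
  have hf' : MDifferentiableAt I J f (g (f x)) := by rwa [hx]
  have e₂ : (modelDeriv I J f x).comp (modelDeriv J I g (f x)) = ContinuousLinearMap.id ℝ E' := by
    have := modelDeriv_comp hf' hg
    rw [hx] at this
    rw [← this, ← modelDeriv_id (I := J) (f x)]
    exact modelDeriv_congr h₂
  refine ⟨fun v w hvw => ?_, fun v => ⟨modelDeriv J I g (f x) v, ?_⟩⟩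
  · have := congrArg (modelDeriv J I g (f x)) hvw
    simpa only [← ContinuousLinearMap.comp_apply, e₁, ContinuousLinearMap.id_apply] using this
  · rw [← ContinuousLinearMap.comp_apply, e₂, ContinuousLinearMap.id_apply]

theorem PartialDiffeomorph.modelDeriv_bijective (L : PartialDiffeomorph I J M N ∞) {x : M}
    (hx : x ∈ L.source) : Function.Bijective (modelDeriv I J L x) := by
  have hx' : L x ∈ L.target := L.map_source hx
  refine modelDeriv_bijective_of_leftInverse (g := L.symm)
    (L.mdifferentiableAt (by simp) hx) (L.symm.mdifferentiableAt (by simp) hx')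
    (L.left_inv hx) ?_ ?_
  · filter_upwards [L.open_source.mem_nhds hx] with y hy using L.left_inv hy
  · filter_upwards [L.open_target.mem_nhds hx'] with y hy using L.right_inv hy

/-- The extended chart at a point of a boundaryless manifold. -/
def extChartPartialDiffeomorph (I : ModelWithCorners ℝ E H) [I.Boundaryless] [IsManifold I ∞ M]
    (x : M) : PartialDiffeomorph I 𝓘(ℝ, E) M E ∞ where
  toPartialEquiv := extChartAt I x
  open_source := isOpen_extChartAt_source x
  open_target := isOpen_extChartAt_target x
  contMDiffOn_toFun := by
    have := contMDiffOn_extChartAt (I := I) (n := ∞) (x := x)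
    rwa [← extChartAt_source (I := I)] at this
  contMDiffOn_invFun := contMDiffOn_extChartAt_symm x

/-- The restriction of a partial diffeomorphism to an open set. -/
def PartialDiffeomorph.restrict (L : PartialDiffeomorph I J M N ∞) (O : Set M) (hO : IsOpen O) :
    PartialDiffeomorph I J M N ∞ where
  toPartialEquiv := (L.toOpenPartialHomeomorph.restrOpen O hO).toPartialEquiv
  open_source := (L.toOpenPartialHomeomorph.restrOpen O hO).open_source
  open_target := (L.toOpenPartialHomeomorph.restrOpen O hO).open_target
  contMDiffOn_toFun := L.contMDiffOn_toFun.mono inter_subset_left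
  contMDiffOn_invFun := L.contMDiffOn_invFun.mono inter_subset_left

/-- The inverse is known to be smooth only at images of points where the derivative is invertible.
Invertible operators form an open set and the derivative is continuous, so the source is shrunk
until the derivative is invertible throughout. -/
theorem exists_partialDiffeomorph_of_fderiv_bijective [CompleteSpace E] [CompleteSpace E']
    {f : E → E'} {a : E} {O : Set E} (hO : IsOpen O) (ha : a ∈ O) (hf : ContDiffOn ℝ ∞ f O)
    (hbij : Function.Bijective (fderiv ℝ f a)) :
    ∃ L : PartialDiffeomorph 𝓘(ℝ, E) 𝓘(ℝ, E') E E' ∞,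
      a ∈ L.source ∧ L.source ⊆ O ∧ ∀ y ∈ L.source, L y = f y := by
  have hfa : ∀ y ∈ O, ContDiffAt ℝ ∞ f y := fun y hy => hf.contDiffAt (hO.mem_nhds hy)
  let e' : E ≃L[ℝ] E' := ContinuousLinearEquiv.ofBijective (fderiv ℝ f a)
    (LinearMap.ker_eq_bot.2 hbij.1) (LinearMap.range_eq_top.2 hbij.2)
  have he' : (e' : E →L[ℝ] E') = fderiv ℝ f a := ContinuousLinearEquiv.coe_ofBijective _ _ _
  have hd : HasFDerivAt f (e' : E →L[ℝ] E') a := by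
    rw [he']
    exact ((hfa a ha).differentiableAt (by simp)).hasFDerivAt
  let e := (hfa a ha).toOpenPartialHomeomorph f hd (by simp)
  have hae : a ∈ e.source := (hfa a ha).mem_toOpenPartialHomeomorph_source hd (by simp)
  have hcont : ContinuousAt (fderiv ℝ f) a :=
    (hf.continuousOn_fderiv_of_isOpen hO (by simp)).continuousAt (hO.mem_nhds ha)
  have hinv : ∀ᶠ y in 𝓝 a, fderiv ℝ f y ∈ range ((↑) : (E ≃L[ℝ] E') → E →L[ℝ] E') :=
    hcont.eventually (by rw [← he']; exact e'.nhds)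
  obtain ⟨O', hO's, hO', haO'⟩ := eventually_nhds_iff.1
    (hinv.and ((hO.mem_nhds ha : ∀ᶠ y in 𝓝 a, y ∈ O)))
  let r := e.restrOpen O' hO'
  have hr : ∀ y ∈ r.source, y ∈ O' := fun y hy => hy.2
  refine ⟨⟨r.toPartialEquiv, r.open_source, r.open_target, ?_, ?_⟩, ⟨hae, haO'⟩,
    fun y hy => (hO's y hy.2).2, fun y _ => rfl⟩
  · rw [contMDiffOn_iff_contDiffOn]
    exact hf.mono fun y hy => (hO's y hy.2).2
  · rw [contMDiffOn_iff_contDiffOn]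
    intro z hz
    have hzs : r.symm z ∈ r.source := r.map_target hz
    obtain ⟨⟨f', hf'⟩, hzO⟩ := hO's _ (hr _ hzs)
    refine (r.contDiffAt_symm hz (f₀' := f') ?_ ?_).contDiffWithinAt
    · rw [hf']
      exact ((hfa _ hzO).differentiableAt (by simp)).hasFDerivAt
    · exact hfa _ hzO

/-- The inverse function theorem on manifolds. -/
theorem exists_partialDiffeomorph_of_modelDeriv_bijective [CompleteSpace E] [CompleteSpace E']
    [I.Boundaryless] [J.Boundaryless] [IsManifold I ∞ M] [IsManifold J ∞ N]
    {f : M → N} {x : M} {O : Set M} (hO : IsOpen O) (hx : x ∈ O) (hf : ContMDiffOn I J ∞ f O)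
    (hbij : Function.Bijective (modelDeriv I J f x)) :
    ∃ L : PartialDiffeomorph I J M N ∞,
      x ∈ L.source ∧ L.source ⊆ O ∧ ∀ y ∈ L.source, L y = f y := by
  let φ := extChartPartialDiffeomorph I x
  let ψ := extChartPartialDiffeomorph J (f x)
  have hxφ : x ∈ φ.source := mem_extChartAt_source x
  have hxψ : f x ∈ ψ.source := mem_extChartAt_source (f x)
  let O₁ : Set M := O ∩ f ⁻¹' ψ.source
  have hO₁ : IsOpen O₁ := hf.continuousOn.isOpen_inter_preimage hO ψ.open_source
  let φ' := φ.restrict O₁ hO₁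
  have hxφ' : x ∈ φ'.source := ⟨hxφ, hx, hxψ⟩
  let g : E → E' := ψ ∘ f ∘ φ'.symm
  have hφ' : ∀ z ∈ φ'.target, φ'.symm z ∈ O₁ := fun z hz => (φ'.map_target hz).2
  have hg : ContMDiffOn 𝓘(ℝ, E) 𝓘(ℝ, E') ∞ g φ'.target :=
    ψ.contMDiffOn.comp ((hf.mono inter_subset_left).comp φ'.symm.contMDiffOn hφ')
      fun z hz => (hφ' z hz).2
  have hxt : φ' x ∈ φ'.target := φ'.map_source hxφ'
  have hsx : φ'.symm (φ' x) = x := φ'.left_inv hxφ'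
  have hfx : MDifferentiableAt I J f (φ'.symm (φ' x)) := by
    rw [hsx]
    exact (hf.contMDiffAt (hO.mem_nhds hx)).mdifferentiableAt (by simp)
  have h₁ : MDifferentiableAt 𝓘(ℝ, E) I φ'.symm (φ' x) :=
    φ'.symm.mdifferentiableAt (by simp) hxt
  have hψ : MDifferentiableAt J 𝓘(ℝ, E') ψ ((f ∘ φ'.symm) (φ' x)) := by
    refine ψ.mdifferentiableAt (by simp) ?_
    simpa only [Function.comp_apply, hsx] using hxψ
  have hbij' : Function.Bijective (fderiv ℝ g (φ' x)) := by
    rw [← modelDeriv_eq_fderiv, modelDeriv_comp hψ (hfx.comp _ h₁), modelDeriv_comp hfx h₁,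
      ContinuousLinearMap.coe_comp, ContinuousLinearMap.coe_comp]
    refine Function.Bijective.comp (ψ.modelDeriv_bijective ?_) (Function.Bijective.comp ?_
      (φ'.symm.modelDeriv_bijective hxt))
    · simpa only [Function.comp_apply, hsx] using hxψ
    · rwa [hsx]
  obtain ⟨L, hL₁, hL₂, hL₃⟩ := exists_partialDiffeomorph_of_fderiv_bijective φ'.open_target hxt
    (contMDiffOn_iff_contDiffOn.1 hg) hbij'
  have hgx : ∀ y ∈ φ'.source, g (φ' y) = ψ (f y) := fun y hy => by
    have : φ'.symm (φ' y) = y := φ'.left_inv hy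
    simp only [g, Function.comp_apply, this]
  refine ⟨(φ'.trans L).trans ψ.symm, ⟨⟨hxφ', hL₁⟩, ?_⟩, fun y hy => hy.1.1.2.1, ?_⟩
  · change L (φ' x) ∈ ψ.target
    rw [hL₃ _ hL₁, hgx x hxφ']
    exact ψ.map_source hxψ
  · intro y hy
    have hy₁ : y ∈ φ'.source := hy.1.1
    have hy₂ : φ' y ∈ L.source := hy.1.2
    change ψ.symm (L (φ' y)) = f y
    rw [hL₃ _ hy₂, hgx y hy₁]
    exact ψ.left_inv hy₁.2.2

/-- Two smooth maps that are inverse to each other locally define a partial diffeomorphism. -/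
theorem exists_partialDiffeomorph_of_local_inverses {f : M → N} {g : N → M} {x : M} {y : N}
    (hxy : f x = y) (hf : ∃ O, IsOpen O ∧ x ∈ O ∧ ContMDiffOn I J ∞ f O)
    (hg : ∃ O, IsOpen O ∧ y ∈ O ∧ ContMDiffOn J I ∞ g O)
    (hgf : ∀ᶠ z in 𝓝 x, g (f z) = z) (hfg : ∀ᶠ z in 𝓝 y, f (g z) = z) {S : Set M}
    (hS : S ∈ 𝓝 x) :
    ∃ L : PartialDiffeomorph I J M N ∞, x ∈ L.source ∧ L.source ⊆ S ∧ ∀ z, L z = f z := by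
  obtain ⟨O, hO, hxO, hf⟩ := hf
  obtain ⟨O', hO', hyO', hg⟩ := hg
  obtain ⟨A, hA, hAo, hxA⟩ := eventually_nhds_iff.1
    ((hgf.and (hO.mem_nhds hxO : ∀ᶠ z in 𝓝 x, z ∈ O)).and (hS : ∀ᶠ z in 𝓝 x, z ∈ S))
  obtain ⟨B, hB, hBo, hyB⟩ := eventually_nhds_iff.1
    (hfg.and (hO'.mem_nhds hyO' : ∀ᶠ z in 𝓝 y, z ∈ O'))
  have hfA : ContMDiffOn I J ∞ f A := hf.mono fun z hz => (hA z hz).1.2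
  have hgB : ContMDiffOn J I ∞ g B := hg.mono fun z hz => (hB z hz).2
  refine ⟨⟨⟨f, g, A ∩ f ⁻¹' B, B ∩ g ⁻¹' A, ?_, ?_, ?_, ?_⟩, ?_, ?_, ?_, ?_⟩, ⟨hxA, ?_⟩,
    fun z hz => (hA z hz.1).2, fun _ => rfl⟩
  · rintro z ⟨hz, hz'⟩
    refine ⟨hz', ?_⟩
    simpa only [mem_preimage, (hA z hz).1.1] using hz
  · rintro z ⟨hz, hz'⟩
    refine ⟨hz', ?_⟩
    simpa only [mem_preimage, (hB z hz).1] using hz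
  · exact fun z hz => (hA z hz.1).1.1
  · exact fun z hz => (hB z hz.1).1
  · exact hfA.continuousOn.isOpen_inter_preimage hAo hBo
  · exact hgB.continuousOn.isOpen_inter_preimage hBo hAo
  · exact hfA.mono inter_subset_left
  · exact hgB.mono inter_subset_left
  · simpa only [mem_preimage, hxy] using hyB

theorem modelDeriv_subtypeVal_bijective (U : TopologicalSpace.Opens M) (u : U) :
    Function.Bijective (modelDeriv I I (Subtype.val : U → M) u) := by
  classical
  -- The value outside `U` is arbitrary: only the germ at `u` enters the derivative.
  let g : M → U := fun x => if h : x ∈ U then ⟨x, h⟩ else u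
  have hgx : ∀ x : U, g x = x := fun x => by simp only [g, x.2, dif_pos, Subtype.coe_eta]
  have hev : ∀ᶠ x in 𝓝 (u : M), ((g x : U) : M) = x := by
    filter_upwards [U.isOpen.mem_nhds u.2] with x hx
    exact congrArg Subtype.val (hgx ⟨x, hx⟩)
  have hg : ContMDiffAt I I ∞ g (u : M) := by
    rw [← ContMDiffAt.subtypeVal_comp_iff]
    exact contMDiffAt_id.congr_of_eventuallyEq hev
  exact modelDeriv_bijective_of_leftInverse
    ((contMDiff_subtype_val (I := I) (n := ∞) u).mdifferentiableAt (by simp))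
    (hg.mdifferentiableAt (by simp)) (hgx u) (Filter.Eventually.of_forall hgx) hev

end SmoothMaps

/-! ## Locally free actions -/

section Actions

variable {E H M : Type*} [NormedAddCommGroup E] [NormedSpace ℝ E] [TopologicalSpace H]
  [TopologicalSpace M] [ChartedSpace H M]

/-- A smooth locally free action of `V × ℤ` on a manifold, for a vector space `V`, which factors
through a compact quotient of `V × ℤ`. -/
structure LocallyFreeAction (V : Type*) [NormedAddCommGroup V] [NormedSpace ℝ V]
    (I : ModelWithCorners ℝ E H) (M : Type*) [TopologicalSpace M] [ChartedSpace H M] where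
  act : V × ℤ → M → M
  smooth : ∀ j : ℤ, ContMDiff (𝓘(ℝ, V).prod I) I ∞ (fun p : V × M => act (p.1, j) p.2)
  act_zero : ∀ x, act 0 x = x
  act_add : ∀ g h x, act (g + h) x = act g (act h x)
  cocompact : ∃ K : Set (V × ℤ), IsCompact K ∧ ∀ g, ∃ g' ∈ K, act g' = act g
  free : ∀ x, Function.Injective (modelDeriv 𝓘(ℝ, V) I (fun t => act (t, 0) x) 0)

namespace LocallyFreeAction

variable {V : Type*} [NormedAddCommGroup V] [NormedSpace ℝ V] {I : ModelWithCorners ℝ E H}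
  (T : LocallyFreeAction V I M)

theorem act_neg_act (g : V × ℤ) (x : M) : T.act (-g) (T.act g x) = x := by
  rw [← T.act_add, neg_add_cancel, T.act_zero]

theorem act_act_neg (g : V × ℤ) (x : M) : T.act g (T.act (-g) x) = x := by
  rw [← T.act_add, add_neg_cancel, T.act_zero]

theorem act_comm (g h : V × ℤ) (x : M) : T.act g (T.act h x) = T.act h (T.act g x) := by
  rw [← T.act_add, add_comm, T.act_add]

theorem contMDiff_act (g : V × ℤ) : ContMDiff I I ∞ (T.act g) :=
  (T.smooth g.2).comp (contMDiff_const.prodMk contMDiff_id : ContMDiff I (𝓘(ℝ, V).prod I) ∞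
    (fun x => (g.1, x)))

theorem contMDiff_orbit (j : ℤ) (x : M) : ContMDiff 𝓘(ℝ, V) I ∞ (fun t => T.act (t, j) x) :=
  (T.smooth j).comp (contMDiff_id.prodMk contMDiff_const : ContMDiff 𝓘(ℝ, V) (𝓘(ℝ, V).prod I) ∞
    (fun t => (t, x)))

theorem mdifferentiable_act (g : V × ℤ) : MDifferentiable I I (T.act g) :=
  (T.contMDiff_act g).mdifferentiable (by simp)

theorem continuous_uncurry : Continuous (fun p : (V × ℤ) × M => T.act p.1 p.2) := by
  have : Continuous (fun p : ℤ × (V × M) => T.act (p.2.1, p.1) p.2.2) :=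
    continuous_prod_of_discrete_left.2 fun j => (T.smooth j).continuous
  exact this.comp (by fun_prop : Continuous fun p : (V × ℤ) × M => (p.1.2, (p.1.1, p.2)))

/-- The homeomorphism given by an element of the group. -/
def toHomeomorph (g : V × ℤ) : M ≃ₜ M where
  toFun := T.act g
  invFun := T.act (-g)
  left_inv := T.act_neg_act g
  right_inv := T.act_act_neg g
  continuous_toFun := (T.contMDiff_act g).continuous
  continuous_invFun := (T.contMDiff_act (-g)).continuous

/-- The derivative of the orbit map at the identity. -/
def orbitDeriv (x : M) : V →L[ℝ] E := modelDeriv 𝓘(ℝ, V) I (fun t => T.act (t, 0) x) 0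

/-- The tangent space of the orbit of `x`. -/
def vert (x : M) : Submodule ℝ E := (T.orbitDeriv x).range

/-- Differentiate h(t · x) = t · h(x) at t = 0. -/
theorem modelDeriv_orbitDeriv {h : M → M} (hh : MDifferentiable I I h)
    (hc : ∀ g y, h (T.act g y) = T.act g (h y)) (x : M) (v : V) :
    modelDeriv I I h x (T.orbitDeriv x v) = T.orbitDeriv (h x) v := by
  have h₀ : T.act (0, 0) x = x := T.act_zero x
  have H := modelDeriv_comp_apply (f := fun t => T.act (t, 0) x) (x := (0 : V))
    (hh _) ((T.contMDiff_orbit 0 x).mdifferentiable (by simp) 0) v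
  simp only [hc] at H
  rw [h₀] at H
  exact H.symm

theorem modelDeriv_act_orbitDeriv (g : V × ℤ) (x : M) (v : V) :
    modelDeriv I I (T.act g) x (T.orbitDeriv x v) = T.orbitDeriv (T.act g x) v :=
  T.modelDeriv_orbitDeriv (T.mdifferentiable_act g) (T.act_comm g) x v

theorem modelDeriv_act_bijective (g : V × ℤ) (x : M) :
    Function.Bijective (modelDeriv I I (T.act g) x) :=
  modelDeriv_bijective_of_leftInverse (g := T.act (-g)) (T.mdifferentiable_act g x)
    (T.mdifferentiable_act (-g) _) (T.act_neg_act g x)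
    (Filter.Eventually.of_forall (T.act_neg_act g))
    (Filter.Eventually.of_forall (T.act_act_neg g))

/-! ### Tubes around transversals, and sliding along orbits. -/

section Tube

variable {E' H' P : Type*} [NormedAddCommGroup E'] [NormedSpace ℝ E'] [TopologicalSpace H']
  {J : ModelWithCorners ℝ E' H'} [TopologicalSpace P] [ChartedSpace H' P]

/-- The map `s` is at `p` an immersion transverse to the orbits and of complementary dimension. -/
def Transverse (J : ModelWithCorners ℝ E' H') (s : P → M) (p : P) : Prop :=
  Function.Injective (modelDeriv J I s p) ∧ IsCompl (modelDeriv J I s p).range (T.vert (s p))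

/-- Translates transversality into the bijectivity that the inverse function theorem asks for, and
back. -/
theorem bijective_add_iff {A : V →L[ℝ] E} {B : E' →L[ℝ] E} (hA : Function.Injective A) :
    Function.Bijective (fun v : V × E' => A v.1 + B v.2) ↔
      Function.Injective B ∧ IsCompl B.range A.range := by
  constructor
  · rintro ⟨hi, hs⟩
    refine ⟨fun v w h => ?_, ?_, ?_⟩
    · simpa using @hi (0, v) (0, w) (by simpa using h)
    · rw [Submodule.disjoint_def]
      rintro _ ⟨w, rfl⟩ ⟨v, hv⟩
      have := @hi (v, -w) (0, 0) (by simpa [← sub_eq_add_neg, sub_eq_zero] using hv)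
      simp only [Prod.mk.injEq, neg_eq_zero] at this
      simp [this.2]
    · rw [codisjoint_iff, eq_top_iff]
      intro z _
      obtain ⟨⟨v, w⟩, rfl⟩ := hs z
      change A v + B w ∈ _
      rw [add_comm]
      exact Submodule.add_mem_sup ⟨w, rfl⟩ ⟨v, rfl⟩
  · rintro ⟨hB, hd, hc⟩
    constructor
    · rintro ⟨v, w⟩ ⟨v', w'⟩ h
      have h' : B (w - w') = A (v' - v) := by
        rw [map_sub, map_sub, sub_eq_sub_iff_add_eq_add]
        simpa [add_comm] using h
      have h0 := (Submodule.disjoint_def.1 hd) _ ⟨w - w', rfl⟩ ⟨v' - v, h'.symm⟩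
      have hw : w - w' = 0 := hB (by simpa using h0)
      have hv : v' - v = 0 := hA (by rw [← h', map_zero]; exact h0)
      rw [sub_eq_zero.1 hw, sub_eq_zero.1 hv]
    · intro z
      obtain ⟨_, ⟨w, rfl⟩, _, ⟨v, rfl⟩, h⟩ :=
        Submodule.mem_sup.1 (codisjoint_iff.1 hc ▸ Submodule.mem_top : z ∈ _)
      exact ⟨(v, w), by rw [← h]; exact add_comm _ _⟩

/-- The map `(t, p) ↦ t · s(p)`. -/
def tube (s : P → M) (z : V × P) : M := T.act (z.1, 0) (s z.2)

theorem contMDiffOn_tube {s : P → M} {A : Set P} (hs : ContMDiffOn J I ∞ s A) :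
    ContMDiffOn (𝓘(ℝ, V).prod J) I ∞ (T.tube s) (univ ×ˢ A) :=
  (T.smooth 0).comp_contMDiffOn (f := fun z : V × P => (z.1, s z.2))
    (contMDiffOn_fst.prodMk (hs.comp contMDiffOn_snd fun _ hz => hz.2))

theorem modelDeriv_tube_bijective_iff {s : P → M} {p : P}
    (hs : ContMDiffAt J I ∞ s p) :
    Function.Bijective (modelDeriv (𝓘(ℝ, V).prod J) I (T.tube s) (0, p)) ↔
      T.Transverse J s p := by
  have h₀ : ∀ x, T.act (0, 0) x = x := T.act_zero
  have hd : MDifferentiableAt (𝓘(ℝ, V).prod J) I (T.tube s) (0, p) := by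
    have : ContMDiffAt (𝓘(ℝ, V).prod J) I ∞ (T.tube s) (0, p) :=
      ((T.smooth 0) (0, s p)).comp (0, p) (f := fun z : V × P => (z.1, s z.2))
        (contMDiffAt_fst.prodMk (ContMDiffAt.comp (0, p) (f := Prod.snd) (g := s) hs
          contMDiffAt_snd))
    exact this.mdifferentiableAt (by simp)
  have h : ⇑(modelDeriv (𝓘(ℝ, V).prod J) I (T.tube s) (0, p))
      = fun v => T.orbitDeriv (s p) v.1 + modelDeriv J I s p v.2 := by
    funext v
    rw [modelDeriv_prod hd v]
    simp only [tube, h₀]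
    rfl
  rw [h]
  exact bijective_add_iff (T.free (s p))

/-- Stated for equivariant maps and not only for elements of the group: the holonomy of the
orbibundle acts on the fibre by rotations that need not belong to the group whose quotient is the
fibre. -/
theorem Transverse.comp {s : P → M} {p : P} (hs : MDifferentiableAt J I s p)
    (ht : T.Transverse J s p) {h : M → M} (hh : MDifferentiable I I h)
    (hc : ∀ g y, h (T.act g y) = T.act g (h y))
    (hb : Function.Bijective (modelDeriv I I h (s p))) :
    T.Transverse J (fun w => h (s w)) p := by
  have hd : modelDeriv J I (fun w => h (s w)) p
      = (modelDeriv I I h (s p)).comp (modelDeriv J I s p) :=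
    modelDeriv_comp (hh _) hs
  let e := LinearEquiv.ofBijective (modelDeriv I I h (s p) : E →ₗ[ℝ] E) hb
  have hv : T.vert (h (s p)) = (T.vert (s p)).map (e : E →ₗ[ℝ] E) := by
    ext z
    constructor
    · rintro ⟨v, rfl⟩
      exact ⟨_, ⟨v, rfl⟩, T.modelDeriv_orbitDeriv hh hc (s p) v⟩
    · rintro ⟨_, ⟨v, rfl⟩, rfl⟩
      exact ⟨v, (T.modelDeriv_orbitDeriv hh hc (s p) v).symm⟩
  have hr : (modelDeriv J I (fun w => h (s w)) p).range
      = (modelDeriv J I s p).range.map (e : E →ₗ[ℝ] E) := by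
    rw [hd]
    ext z
    constructor
    · rintro ⟨v, rfl⟩
      exact ⟨_, ⟨v, rfl⟩, rfl⟩
    · rintro ⟨_, ⟨v, rfl⟩, rfl⟩
      exact ⟨v, rfl⟩
  refine ⟨?_, ?_⟩
  · rw [hd]
    exact hb.1.comp ht.1
  · rw [hr, hv]
    exact ht.2.map (Submodule.orderIsoMapComap e)

theorem Transverse.act {s : P → M} {p : P} (hs : MDifferentiableAt J I s p)
    (ht : T.Transverse J s p) (g : V × ℤ) : T.Transverse J (fun w => T.act g (s w)) p :=
  ht.comp T hs (T.mdifferentiable_act g) (T.act_comm g) (T.modelDeriv_act_bijective g _)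

variable {E'' H'' Q : Type*} [NormedAddCommGroup E''] [NormedSpace ℝ E''] [TopologicalSpace H'']
  {J' : ModelWithCorners ℝ E'' H''} [TopologicalSpace Q] [ChartedSpace H'' Q]

/-- The second tube coordinate around `s'` is the projection along orbits onto that transversal. If
`s w` has coordinates (t, q') there, then moving `s w` by -t gives `s' q'`, whose coordinates in the
tube around `s` are (-t, w). So projecting back recovers `w`, and the two projections are mutually
inverse near `p` and `q`. -/
theorem eventually_symm_tube_symm_tube {s : P → M} {s' : Q → M} {p : P} {q : Q}
    (L : PartialDiffeomorph (𝓘(ℝ, V).prod J) I (V × P) M ∞)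
    (L' : PartialDiffeomorph (𝓘(ℝ, V).prod J') I (V × Q) M ∞)
    (hp : (0, p) ∈ L.source) (hL : ∀ z ∈ L.source, L z = T.tube s z)
    (hq : (0, q) ∈ L'.source) (hL' : ∀ z ∈ L'.source, L' z = T.tube s' z)
    (hs : ContinuousAt s p) (h : s p = s' q) :
    ∀ᶠ w in 𝓝 p, s w ∈ L'.target ∧
      T.act (-(L'.symm (s w)).1, 0) (s w) = s' (L'.symm (s w)).2 ∧
      (L.symm (s' (L'.symm (s w)).2)).2 = w := by
  have hLq : L' (0, q) = s p := by
    rw [hL' _ hq, h]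
    exact T.act_zero _
  have hpt : s p ∈ L'.target := hLq ▸ L'.map_source hq
  have hsym : L'.symm (s p) = (0, q) := by
    rw [← hLq]
    exact L'.left_inv hq
  have hc : ContinuousAt (fun w => L'.symm (s w)) p :=
    ((L'.symm.contMDiffOn.continuousOn).continuousAt (L'.open_target.mem_nhds hpt)).comp
      (f := s) hs
  have hc' : ContinuousAt (fun w => (-(L'.symm (s w)).1, w)) p :=
    (continuous_neg.continuousAt.comp (continuous_fst.continuousAt.comp hc)).prodMk continuousAt_id
  have hev : ∀ᶠ w in 𝓝 p, (-(L'.symm (s w)).1, w) ∈ L.source :=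
    hc'.eventually_mem (L.open_source.mem_nhds (by rw [hsym, neg_zero]; exact hp))
  filter_upwards [hev, hs.eventually_mem (L'.open_target.mem_nhds hpt)] with w hw hw'
  have e₁ : T.tube s' (L'.symm (s w)) = s w :=
    (hL' _ (L'.map_target hw')).symm.trans (L'.right_inv hw')
  have e₂ : T.act (-(L'.symm (s w)).1, 0) (s w) = s' (L'.symm (s w)).2 := by
    have := T.act_neg_act ((L'.symm (s w)).1, 0) (s' (L'.symm (s w)).2)
    rw [Prod.neg_mk, neg_zero] at this
    exact (congrArg _ e₁).symm.trans this
  refine ⟨hw', e₂, ?_⟩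
  rw [← e₂]
  have : L.symm (T.tube s (-(L'.symm (s w)).1, w)) = (-(L'.symm (s w)).1, w) := by
    rw [← hL _ hw]
    exact L.left_inv hw
  exact congrArg Prod.snd this

theorem contMDiffOn_symm_snd {s : P → M} {A : Set P} {p : P} {q : Q} {s' : Q → M}
    (hA : IsOpen A) (hp : p ∈ A) (hs : ContMDiffOn J I ∞ s A)
    (L' : PartialDiffeomorph (𝓘(ℝ, V).prod J') I (V × Q) M ∞)
    (hq : (0, q) ∈ L'.source) (hL' : ∀ z ∈ L'.source, L' z = T.tube s' z) (h : s p = s' q) :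
    ∃ O, IsOpen O ∧ p ∈ O ∧ ContMDiffOn J J' ∞ (fun w => (L'.symm (s w)).2) O := by
  have hLq : L' (0, q) = s p := by
    rw [hL' _ hq, h]
    exact T.act_zero _
  have hpt : s p ∈ L'.target := hLq ▸ L'.map_source hq
  exact ⟨A ∩ s ⁻¹' L'.target, hs.continuousOn.isOpen_inter_preimage hA L'.open_target, ⟨hp, hpt⟩,
    contMDiff_snd.comp_contMDiffOn
      (L'.symm.contMDiffOn.comp (hs.mono inter_subset_left) fun _ hw => hw.2)⟩

variable [FiniteDimensional ℝ V] [FiniteDimensional ℝ E] [FiniteDimensional ℝ E']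
  [I.Boundaryless] [J.Boundaryless] [IsManifold I ∞ M] [IsManifold J ∞ P]
  [FiniteDimensional ℝ E''] [J'.Boundaryless] [IsManifold J' ∞ Q]

theorem exists_tube {s : P → M} {A : Set P} {p : P} (hA : IsOpen A) (hp : p ∈ A)
    (hs : ContMDiffOn J I ∞ s A) (ht : T.Transverse J s p) :
    ∃ L : PartialDiffeomorph (𝓘(ℝ, V).prod J) I (V × P) M ∞, (0, p) ∈ L.source ∧
      (∀ z ∈ L.source, z.2 ∈ A) ∧ ∀ z ∈ L.source, L z = T.tube s z := by
  have := FiniteDimensional.complete ℝ V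
  have := FiniteDimensional.complete ℝ E
  have := FiniteDimensional.complete ℝ E'
  obtain ⟨L, h₁, h₂, h₃⟩ := exists_partialDiffeomorph_of_modelDeriv_bijective
    (isOpen_univ.prod hA) (⟨trivial, hp⟩ : ((0 : V), p) ∈ univ ×ˢ A) (T.contMDiffOn_tube hs)
    ((T.modelDeriv_tube_bijective_iff (hs.contMDiffAt (hA.mem_nhds hp))).2 ht)
  exact ⟨L, h₁, fun z hz => (h₂ hz).2, h₃⟩

/-- Two transversals through one point are locally related by a diffeomorphism along the orbits. -/
theorem exists_partialDiffeomorph_of_transverse {s : P → M} {A : Set P} {p : P} (hA : IsOpen A)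
    (hp : p ∈ A) (hs : ContMDiffOn J I ∞ s A) (ht : T.Transverse J s p) {s' : Q → M} {A' : Set Q}
    {q : Q} (hA' : IsOpen A') (hq : q ∈ A') (hs' : ContMDiffOn J' I ∞ s' A')
    (ht' : T.Transverse J' s' q) (h : s p = s' q) :
    ∃ L : PartialDiffeomorph J J' P Q ∞, p ∈ L.source ∧ L p = q ∧
      ∀ w ∈ L.source, w ∈ A ∧ L w ∈ A' ∧ ∃ g, T.act g (s w) = s' (L w) := by
  obtain ⟨L, hpL, hLA, hL⟩ := T.exists_tube hA hp hs ht
  obtain ⟨L', hqL, hLA', hL'⟩ := T.exists_tube hA' hq hs' ht'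
  have ev := T.eventually_symm_tube_symm_tube L L' hpL hL hqL hL'
    (hs.continuousOn.continuousAt (hA.mem_nhds hp)) h
  have ev' := T.eventually_symm_tube_symm_tube L' L hqL hL' hpL hL
    (hs'.continuousOn.continuousAt (hA'.mem_nhds hq)) h.symm
  have hLq : L' (0, q) = s p := by
    rw [hL' _ hqL, h]
    exact T.act_zero _
  have hpq : (L'.symm (s p)).2 = q := by
    rw [← hLq]
    exact congrArg Prod.snd (L'.left_inv hqL)
  obtain ⟨F, hF₁, hF₂, hF₃⟩ := exists_partialDiffeomorph_of_local_inverses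
    (f := fun w => (L'.symm (s w)).2) (g := fun w => (L.symm (s' w)).2) hpq
    (T.contMDiffOn_symm_snd hA hp hs L' hqL hL' h)
    (T.contMDiffOn_symm_snd hA' hq hs' L hpL hL h.symm)
    (ev.mono fun w hw => hw.2.2) (ev'.mono fun w hw => hw.2.2)
    (Filter.inter_mem (hA.mem_nhds hp) ev)
  refine ⟨F, hF₁, (hF₃ p).trans hpq, fun w hw => ?_⟩
  obtain ⟨hwA, hw₁, hw₂, -⟩ := hF₂ hw
  rw [hF₃]
  exact ⟨hwA, hLA' _ (L'.map_target hw₁), _, hw₂⟩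

variable {X : Type*}

/-- Near `p`, the map `f` to the quotient lifts to a smooth transversal. -/
def HasTransverseLift (J : ModelWithCorners ℝ E' H') (qt : M → X) (f : P → X) (p : P) : Prop :=
  ∃ (A : Set P) (s : P → M), IsOpen A ∧ p ∈ A ∧ ContMDiffOn J I ∞ s A ∧
    (∀ w ∈ A, qt (s w) = f w) ∧ T.Transverse J s p

/-- Used for the compatibility of charts, for the smoothness of the holonomy and for that of the
trivialization. A group element moves the first lift until both pass through one point; sliding
along the orbits then does not change the image in the quotient. -/
theorem locallyDiffeomorphic_of_hasTransverseLift {qt : M → X}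
    (hqt : ∀ x y, qt x = qt y ↔ ∃ g, T.act g x = y) {f : P → X} {f' : Q → X}
    (hf : ∀ p, T.HasTransverseLift J qt f p) (hf' : ∀ q, T.HasTransverseLift J' qt f' q) :
    LocallyDiffeomorphic J J' f f' := by
  intro p q hpq
  obtain ⟨A, s, hA, hp, hs, hsf, ht⟩ := hf p
  obtain ⟨A', s', hA', hq, hs', hsf', ht'⟩ := hf' q
  obtain ⟨g, hg⟩ := (hqt (s p) (s' q)).1 (by rw [hsf p hp, hsf' q hq, hpq])
  obtain ⟨L, h₁, h₂, h₃⟩ := T.exists_partialDiffeomorph_of_transverse hA hp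
    ((T.contMDiff_act g).comp_contMDiffOn hs)
    (ht.act T ((hs.contMDiffAt (hA.mem_nhds hp)).mdifferentiableAt (by simp)) g) hA' hq hs' ht' hg
  refine ⟨L, h₁, h₂, fun w hw => ?_⟩
  obtain ⟨hwA, hwA', g', hg'⟩ := h₃ w hw
  rw [← hsf w hwA, ← hsf' _ hwA', eq_comm, hqt]
  exact ⟨g' + g, by rw [T.act_add]; exact hg'⟩

end Tube

end LocallyFreeAction

end Actions

/-! ## Linearization of finite groups at fixed points -/

section Linearization

variable {E H M : Type*} [NormedAddCommGroup E] [NormedSpace ℝ E] [TopologicalSpace H]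
  [TopologicalSpace M] [ChartedSpace H M] {I : ModelWithCorners ℝ E H}

theorem modelDeriv_mul {f g : Equiv.Perm M} (hf : ContMDiff I I ∞ f) (hg : ContMDiff I I ∞ g)
    {x : M} (hx : g x = x) :
    modelDeriv I I (f * g : Equiv.Perm M) x
      = (modelDeriv I I f x).comp (modelDeriv I I g x) := by
  have := modelDeriv_comp (K := I) (hf.mdifferentiable (by simp) (g x))
    (hg.mdifferentiable (by simp) x)
  rwa [hx] at this

theorem modelDeriv_sub_const {f : M → E} {x : M} (hf : MDifferentiableAt I 𝓘(ℝ, E) f x) (c : E) :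
    modelDeriv I 𝓘(ℝ, E) (fun y => f y - c) x = modelDeriv I 𝓘(ℝ, E) f x := by
  have := modelDeriv_comp (I := I) (J := 𝓘(ℝ, E)) (K := 𝓘(ℝ, E)) (g := fun z => z - c) (f := f)
    (x := x) ((differentiable_id.sub_const c).mdifferentiable _) hf
  rw [modelDeriv_eq_fderiv, fderiv_sub_const, fderiv_fun_id, ContinuousLinearMap.id_comp] at this
  exact this

theorem modelDeriv_add {f g : M → E} {x : M} (hf : MDifferentiableAt I 𝓘(ℝ, E) f x)
    (hg : MDifferentiableAt I 𝓘(ℝ, E) g x) :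
    modelDeriv I 𝓘(ℝ, E) (f + g) x
      = modelDeriv I 𝓘(ℝ, E) f x + modelDeriv I 𝓘(ℝ, E) g x :=
  mfderiv_add hf hg

theorem modelDeriv_const_smul {f : M → E} {x : M} (hf : MDifferentiableAt I 𝓘(ℝ, E) f x) (c : ℝ) :
    modelDeriv I 𝓘(ℝ, E) (c • f) x = c • modelDeriv I 𝓘(ℝ, E) f x :=
  (hf.hasMFDerivAt.const_smul c).mfderiv

theorem modelDeriv_sum {ι : Type*} (t : Finset ι) {f : ι → M → E} {x : M}
    (hf : ∀ i ∈ t, MDifferentiableAt I 𝓘(ℝ, E) (f i) x) :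
    MDifferentiableAt I 𝓘(ℝ, E) (∑ i ∈ t, f i) x ∧
      modelDeriv I 𝓘(ℝ, E) (∑ i ∈ t, f i) x = ∑ i ∈ t, modelDeriv I 𝓘(ℝ, E) (f i) x := by
  classical
  induction t using Finset.induction_on with
  | empty =>
    rw [Finset.sum_empty, Finset.sum_empty]
    exact ⟨mdifferentiableAt_const, modelDeriv_const x 0⟩
  | insert i t hi IH =>
    obtain ⟨h₁, h₂⟩ := IH fun k hk => hf k (Finset.mem_insert_of_mem hk)
    have h₃ := hf i (Finset.mem_insert_self i t)
    rw [Finset.sum_insert hi, Finset.sum_insert hi, ← h₂]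
    exact ⟨h₃.add h₁, modelDeriv_add h₃ h₁⟩

theorem modelDeriv_extChartAt_self [I.Boundaryless] [IsManifold I ∞ M] (x : M) :
    modelDeriv I 𝓘(ℝ, E) (extChartAt I x) x = ContinuousLinearMap.id ℝ E := by
  have : IsManifold I 1 M := IsManifold.of_le (n := ∞) (by simp)
  exact mfderiv_extChartAt_self

/-- A finite group of diffeomorphisms with a common fixed point is linear in suitable local
coordinates. -/
theorem exists_linearization [I.Boundaryless] [IsManifold I ∞ M] [CompleteSpace E]
    (G : Subgroup (Equiv.Perm M)) [Finite G] (hG : ∀ f ∈ G, ContMDiff I I ∞ f) {x : M}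
    (hx : ∀ f ∈ G, f x = x) :
    ∃ (F : M → E) (L : PartialDiffeomorph I 𝓘(ℝ, E) M E ∞), x ∈ L.source ∧ F x = 0 ∧
      (∀ y ∈ L.source, L y = F y) ∧ modelDeriv I 𝓘(ℝ, E) F x = ContinuousLinearMap.id ℝ E ∧
      ∀ f ∈ G, ∀ y, F (f y) = modelDeriv I I f x (F y) := by
  have := Fintype.ofFinite G
  let A : G → E →L[ℝ] E := fun f => modelDeriv I I f.1 x
  have hA : ∀ f g : G, A (f * g) = (A f).comp (A g) := fun f g =>
    modelDeriv_mul (hG f f.2) (hG g g.2) (hx g g.2)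
  have hA₁ : A 1 = ContinuousLinearMap.id ℝ E := modelDeriv_id (I := I) x
  let φ : M → E := fun y => extChartAt I x y - extChartAt I x x
  -- Averaging the centred chart over the group, each term corrected by the inverse of the
  -- linearized transformation, makes it equivariant and keeps the derivative at `x` equal to the
  -- identity.
  let F : M → E := fun y => (Fintype.card G : ℝ)⁻¹ • ∑ f : G, A f⁻¹ (φ (f.1 y))
  have hcard : (Fintype.card G : ℝ) ≠ 0 := Nat.cast_ne_zero.2 Fintype.card_ne_zero
  let O : Set M := ⋂ f : G, f.1 ⁻¹' (chartAt H x).source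
  have hO : IsOpen O := isOpen_iInter_of_finite fun f =>
    (chartAt H x).open_source.preimage (hG f f.2).continuous
  have hxO : x ∈ O := mem_iInter.2 fun f => by
    rw [mem_preimage, hx f f.2]
    exact mem_chart_source H x
  have hφ : ContMDiffOn I 𝓘(ℝ, E) ∞ φ (chartAt H x).source :=
    contMDiffOn_extChartAt.sub contMDiffOn_const
  have hterm : ∀ f : G, ContMDiffOn I 𝓘(ℝ, E) ∞ (fun y => A f⁻¹ (φ (f.1 y))) O := fun f =>
    (A f⁻¹).contMDiff.comp_contMDiffOn (hφ.comp (hG f f.2).contMDiffOn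
      fun y hy => mem_iInter.1 hy f)
  have hF : ContMDiffOn I 𝓘(ℝ, E) ∞ F O :=
    ((Fintype.card G : ℝ)⁻¹ • ContinuousLinearMap.id ℝ E).contMDiff.comp_contMDiffOn
      (contMDiffOn_finsetSum fun f _ => hterm f)
  have hφd : modelDeriv I 𝓘(ℝ, E) φ x = ContinuousLinearMap.id ℝ E := by
    rw [← modelDeriv_extChartAt_self (I := I) x]
    exact modelDeriv_sub_const
      ((contMDiffAt_extChartAt (n := ∞)).mdifferentiableAt (by simp)) _
  have hFd : modelDeriv I 𝓘(ℝ, E) F x = ContinuousLinearMap.id ℝ E := by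
    have hterm' : ∀ f : G, MDifferentiableAt I 𝓘(ℝ, E) (fun y => A f⁻¹ (φ (f.1 y))) x :=
      fun f => ((hterm f).contMDiffAt (hO.mem_nhds hxO)).mdifferentiableAt (by simp)
    have hd : ∀ f : G, modelDeriv I 𝓘(ℝ, E) (fun y => A f⁻¹ (φ (f.1 y))) x
        = ContinuousLinearMap.id ℝ E := fun f => by
      have hfd := (hG f f.2).mdifferentiable (by simp) x
      have hφ' : MDifferentiableAt I 𝓘(ℝ, E) φ (f.1 x) := by
        rw [hx f f.2]
        exact (hφ.contMDiffAt ((chartAt H x).open_source.mem_nhds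
          (mem_chart_source H x))).mdifferentiableAt (by simp)
      have h₁ := modelDeriv_comp (I := I) (J := 𝓘(ℝ, E)) (K := 𝓘(ℝ, E)) (g := A f⁻¹)
        (f := φ ∘ f.1) (x := x) (A f⁻¹).mdifferentiableAt (hφ'.comp x hfd)
      rw [modelDeriv_comp hφ' hfd, hx f f.2, hφd, ContinuousLinearMap.id_comp,
        modelDeriv_eq_fderiv, ContinuousLinearMap.fderiv] at h₁
      have h₂ := hA f⁻¹ f
      rw [inv_mul_cancel, hA₁] at h₂
      exact h₁.trans h₂.symm
    have h := modelDeriv_sum Finset.univ fun f _ => hterm' f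
    have hFe : F = (Fintype.card G : ℝ)⁻¹ • ∑ f : G, (fun y => A f⁻¹ (φ (f.1 y))) := by
      funext y
      simp only [F, Pi.smul_apply, Finset.sum_apply]
    rw [hFe, modelDeriv_const_smul h.1, h.2, Finset.sum_congr rfl fun f _ => hd f, Finset.sum_const, Finset.card_univ,
      ← Nat.cast_smul_eq_nsmul ℝ, inv_smul_smul₀ hcard]
  have hF₀ : F x = 0 := by
    have : ∀ f : G, φ (f.1 x) = 0 := fun f => by rw [hx f f.2]; exact sub_self _
    simp only [F, this, map_zero, Finset.sum_const_zero, smul_zero]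
  obtain ⟨L, hL₁, -, hL₂⟩ := exists_partialDiffeomorph_of_modelDeriv_bijective hO hxO hF
    (by rw [hFd]; exact Function.bijective_id)
  refine ⟨F, L, hL₁, hF₀, hL₂, hFd, fun k hk y => ?_⟩
  change F (k y) = A ⟨k, hk⟩ (F y)
  simp only [F, map_smul, map_sum]
  congr 1
  -- Substituting f k for f turns A_k A_{(fk)⁻¹} into A_{f⁻¹}. This is pure reindexing, so
  -- equivariance holds for every `y`, also where `F` is not known to be smooth.
  rw [← Equiv.sum_comp (Equiv.mulRight (⟨k, hk⟩ : G))
    (fun f => A ⟨k, hk⟩ (A f⁻¹ (φ (f.1 y))))]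
  refine Finset.sum_congr rfl fun f _ => ?_
  rw [← ContinuousLinearMap.comp_apply, ← hA, Equiv.coe_mulRight, mul_inv_rev, mul_inv_cancel_left]
  rfl

end Linearization

/-! ## Slices -/

/-- Maschke's argument. Since the group fixes W pointwise, the average of P₀ ∘ A_f, without
conjugating, is still a projection onto W; it is unchanged by composition with A_g, so its kernel is
an invariant complement. -/
theorem exists_invariant_isCompl {E G : Type*} [AddCommGroup E] [Module ℝ E] [Group G] [Finite G]
    (A : G → E →ₗ[ℝ] E) (hA : ∀ f g, A (f * g) = A f ∘ₗ A g) (W : Submodule ℝ E)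
    (hW : ∀ f, ∀ v ∈ W, A f v = v) :
    ∃ C : Submodule ℝ E, IsCompl C W ∧ ∀ f, ∀ v ∈ C, A f v ∈ C := by
  have := Fintype.ofFinite G
  obtain ⟨C, hC⟩ := W.exists_isCompl
  let P₀ : E →ₗ[ℝ] E := W.projection C hC
  have hcard : (Fintype.card G : ℝ) ≠ 0 := Nat.cast_ne_zero.2 Fintype.card_ne_zero
  let P : E →ₗ[ℝ] E := (Fintype.card G : ℝ)⁻¹ • ∑ f : G, P₀ ∘ₗ A f
  have hP : ∀ v, P v = (Fintype.card G : ℝ)⁻¹ • ∑ f : G, P₀ (A f v) := fun v => by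
    simp [P, LinearMap.sum_apply]
  have hmem : ∀ v, P v ∈ W := fun v => by
    rw [hP]
    exact W.smul_mem _ (W.sum_mem fun f _ => (Submodule.projection_apply_mem hC (A f v)))
  have hid : ∀ v ∈ W, P v = v := fun v hv => by
    have h₀ : P₀ v = v :=
      congrArg Subtype.val (Submodule.projectionOnto_apply_left hC ⟨v, hv⟩)
    rw [hP, Finset.sum_congr rfl fun f _ => by rw [hW f v hv, h₀], Finset.sum_const,
      Finset.card_univ, ← Nat.cast_smul_eq_nsmul ℝ, inv_smul_smul₀ hcard]
  have hinv : ∀ g v, P (A g v) = P v := fun g v => by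
    rw [hP, hP, ← Equiv.sum_comp (Equiv.mulRight g) (fun f => P₀ (A f v))]
    congr 1
    refine Finset.sum_congr rfl fun f _ => ?_
    rw [Equiv.coe_mulRight, hA]
    rfl
  refine ⟨P.ker, (LinearMap.IsProj.isCompl ⟨hmem, hid⟩).symm, fun g v hv => ?_⟩
  rw [LinearMap.mem_ker, hinv]
  exact hv

namespace LocallyFreeAction

section Slice

variable {E H M : Type*} [NormedAddCommGroup E] [NormedSpace ℝ E] [TopologicalSpace H]
  [TopologicalSpace M] [ChartedSpace H M]
  {V : Type*} [NormedAddCommGroup V] [NormedSpace ℝ V] {I : ModelWithCorners ℝ E H}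
  (T : LocallyFreeAction V I M)

/-- The group of transformations of `M` defined by the stabilizer of `x`. -/
def stab (x : M) : Subgroup (Equiv.Perm M) where
  carrier := {f | ∃ g, T.act g x = x ∧ ∀ y, f y = T.act g y}
  one_mem' := ⟨0, T.act_zero x, fun y => (T.act_zero y).symm⟩
  mul_mem' := by
    rintro f f' ⟨g, hg, hf⟩ ⟨g', hg', hf'⟩
    exact ⟨g + g', by rw [T.act_add, hg', hg], fun y => by
      rw [Equiv.Perm.mul_apply, hf', hf, T.act_add]⟩
  inv_mem' := by
    rintro f ⟨g, hg, hf⟩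
    refine ⟨-g, ?_, fun y => ?_⟩
    · conv_lhs => rw [← hg, T.act_neg_act]
    · rw [Equiv.Perm.inv_eq_iff_eq, hf, T.act_act_neg]

/-- An element of the stabilizer as an element of the group of transformations. -/
def toStab {x : M} {g : V × ℤ} (hg : T.act g x = x) : T.stab x :=
  ⟨(T.toHomeomorph g).toEquiv, g, hg, fun _ => rfl⟩

theorem stab_apply {x : M} (f : T.stab x) : (f : Equiv.Perm M) x = x := by
  obtain ⟨f, g, hg, hf⟩ := f
  exact (hf x).trans hg

theorem contMDiff_stab {x : M} {f : Equiv.Perm M} (hf : f ∈ T.stab x) : ContMDiff I I ∞ f := by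
  obtain ⟨g, -, hf⟩ := hf
  rw [funext hf]
  exact T.contMDiff_act g

/-- By compactness it is enough to treat group elements near one fixed `g`. If `g` moves x,
continuity separates the two points. If `g` fixes x, a nearby g' is `g`, which acts on the slice
through `A`, followed by g' - g, which lies in V near 0 because ℤ is discrete; injectivity of the
tube map then forces g' = g. -/
theorem eventually_act_eq_of_act_slice_eq [T2Space M] {x : M} {d : ℕ} {s : EuclideanSpace ℝ (Fin d) → M}
    {A : T.stab x → EuclideanSpace ℝ (Fin d) →L[ℝ] EuclideanSpace ℝ (Fin d)} (hs₀ : s 0 = x)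
    (hs : ContinuousAt s 0)
    (L : PartialDiffeomorph (𝓘(ℝ, V).prod (𝓡 d)) I (V × EuclideanSpace ℝ (Fin d)) M ∞)
    (h0L : (0, 0) ∈ L.source) (hL : ∀ z ∈ L.source, L z = T.tube s z)
    (hA : ∀ f : T.stab x, ∀ᶠ u in 𝓝 0, (f : Equiv.Perm M) (s u) = s (A f u)) :
    ∀ᶠ w : EuclideanSpace ℝ (Fin d) × EuclideanSpace ℝ (Fin d) in 𝓝 (0, 0),
      ∀ g, T.act g (s w.1) = s w.2 → T.act g x = x := by
  obtain ⟨K, hK, hKg⟩ := T.cocompact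
  suffices ∀ᶠ w : EuclideanSpace ℝ (Fin d) × EuclideanSpace ℝ (Fin d) in 𝓝 (0, 0),
      ∀ g ∈ K, T.act g (s w.1) = s w.2 → T.act g x = x by
    filter_upwards [this] with w hw g hg
    obtain ⟨g', hg'K, hg'⟩ := hKg g
    rw [← hg'] at hg ⊢
    exact hw g' hg'K hg
  refine hK.eventually_forall_of_forall_eventually fun g _ => ?_
  have hs' : ContinuousAt s ((((0, 0), g) : (EuclideanSpace ℝ (Fin d) ×
    EuclideanSpace ℝ (Fin d)) × (V × ℤ)).1).1 := hs
  have hs'' : ContinuousAt s ((((0, 0), g) : (EuclideanSpace ℝ (Fin d) ×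
    EuclideanSpace ℝ (Fin d)) × (V × ℤ)).1).2 := hs
  have c₁ : ContinuousAt (fun z : (EuclideanSpace ℝ (Fin d) × EuclideanSpace ℝ (Fin d)) × (V × ℤ)
      => s z.1.1) ((0, 0), g) :=
    hs'.comp (f := fun z : (EuclideanSpace ℝ (Fin d) × EuclideanSpace ℝ (Fin d)) × (V × ℤ)
      => z.1.1) (by fun_prop)
  have c₂ : ContinuousAt (fun z : (EuclideanSpace ℝ (Fin d) × EuclideanSpace ℝ (Fin d)) × (V × ℤ)
      => s z.1.2) ((0, 0), g) :=
    hs''.comp (f := fun z : (EuclideanSpace ℝ (Fin d) × EuclideanSpace ℝ (Fin d)) × (V × ℤ)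
      => z.1.2) (by fun_prop)
  have c₃ : ContinuousAt (fun z : (EuclideanSpace ℝ (Fin d) × EuclideanSpace ℝ (Fin d)) × (V × ℤ)
      => T.act z.2 (s z.1.1)) ((0, 0), g) :=
    T.continuous_uncurry.continuousAt.comp (continuousAt_snd.prodMk c₁)
  by_cases hg : T.act g x = x
  · have t₁ : Filter.Tendsto (fun z : (EuclideanSpace ℝ (Fin d) × EuclideanSpace ℝ (Fin d)) ×
        (V × ℤ) => ((z.2 - g).1, A (T.toStab hg) z.1.1)) (𝓝 ((0, 0), g)) (𝓝 (0, 0)) :=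
      (by fun_prop : Continuous _).tendsto' _ _ (by simp)
    have t₂ : Filter.Tendsto (fun z : (EuclideanSpace ℝ (Fin d) × EuclideanSpace ℝ (Fin d)) ×
        (V × ℤ) => ((0 : V), z.1.2)) (𝓝 ((0, 0), g)) (𝓝 (0, 0)) :=
      (by fun_prop : Continuous _).tendsto' _ _ (by simp)
    have t₃ : Filter.Tendsto (fun z : (EuclideanSpace ℝ (Fin d) × EuclideanSpace ℝ (Fin d)) ×
        (V × ℤ) => (z.2 - g).2) (𝓝 ((0, 0), g)) (𝓝 0) :=
      (by fun_prop : Continuous _).tendsto' _ _ (by simp)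
    have t₄ : Filter.Tendsto (fun z : (EuclideanSpace ℝ (Fin d) × EuclideanSpace ℝ (Fin d)) ×
        (V × ℤ) => z.1.1) (𝓝 ((0, 0), g)) (𝓝 0) :=
      (by fun_prop : Continuous _).tendsto' _ _ (by simp)
    filter_upwards [t₁.eventually_mem (L.open_source.mem_nhds h0L),
      t₂.eventually_mem (L.open_source.mem_nhds h0L),
      t₃.eventually_mem (isOpen_discrete {0} |>.mem_nhds rfl), t₄.eventually (hA (T.toStab hg))]
      with z h₁ h₂ h₃ h₄ h
    have h₃ : (z.2 - g).2 = 0 := h₃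
    have h₄ : T.act g (s z.1.1) = s (A (T.toStab hg) z.1.1) := h₄
    have e : L ((z.2 - g).1, A (T.toStab hg) z.1.1) = L (0, z.1.2) := by
      rw [hL _ h₁, hL _ h₂]
      change T.act ((z.2 - g).1, 0) (s (A (T.toStab hg) z.1.1)) = T.act 0 (s z.1.2)
      rw [T.act_zero, ← h, ← h₃, ← h₄, ← T.act_add, Prod.mk.eta, sub_add_cancel]
    have e' : (z.2 - g).1 = 0 := congrArg Prod.fst (L.injOn h₁ h₂ e)
    have e'' : z.2 - g = 0 := Prod.ext e' h₃
    rw [sub_eq_zero.1 e'']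
    exact hg
  · have hne : T.act g (s 0) ≠ s 0 := by rwa [hs₀]
    filter_upwards [(ContinuousAt.ne_iff_eventually_ne c₃ c₂).1 hne] with z hz h using absurd h hz

variable [FiniteDimensional ℝ V] [I.Boundaryless] [IsManifold I ∞ M]

/-- In a chart the orbit map has injective derivative at 0, hence does not return to its value at 0
for small nonzero `t`. -/
theorem eventually_eq_zero_of_act_eq (x : M) : ∀ᶠ t in 𝓝 (0 : V), T.act (t, 0) x = x → t = 0 := by
  let f : V → E := fun t => extChartAt I x (T.act (t, 0) x)
  have h₀ : T.act (0, 0) x = x := T.act_zero x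
  have hφ : MDifferentiableAt I 𝓘(ℝ, E) (extChartAt I x) (T.act (0, 0) x) := by
    rw [h₀]
    exact (contMDiffAt_extChartAt (n := ∞)).mdifferentiableAt (by simp)
  have ho := (T.contMDiff_orbit 0 x).mdifferentiable (by simp) 0
  have hd : HasFDerivAt f (T.orbitDeriv x) 0 := by
    have h := modelDeriv_comp (f := fun t : V => T.act (t, 0) x) hφ ho
    rw [h₀, modelDeriv_extChartAt_self, ContinuousLinearMap.id_comp, modelDeriv_eq_fderiv] at h
    change HasFDerivAt f (modelDeriv 𝓘(ℝ, V) I (fun t => T.act (t, 0) x) 0) 0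
    rw [← h]
    exact (mdifferentiableAt_iff_differentiableAt.1 (MDifferentiableAt.comp (f := fun t : V => T.act (t, 0) x)
      0 hφ ho)).hasFDerivAt
  obtain ⟨C, -, hC⟩ := (T.orbitDeriv x : V →ₗ[ℝ] E).exists_antilipschitzWith
    (LinearMap.ker_eq_bot.2 (T.free x))
  have := hd.eventually_ne (c := extChartAt I x x) ⟨C, hC⟩
  rw [eventually_nhdsWithin_iff] at this
  filter_upwards [this] with t ht hx
  by_contra hne
  exact ht hne (congrArg (extChartAt I x) hx)

theorem eventually_eq_of_act_eq {x : M} {g : V × ℤ} (hg : T.act g x = x) :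
    ∀ᶠ g' in 𝓝 g, T.act g' x = x → g' = g := by
  have h₁ : Filter.Tendsto (fun g' : V × ℤ => (g' - g).1) (𝓝 g) (𝓝 0) :=
    (by fun_prop : Continuous fun g' : V × ℤ => (g' - g).1).tendsto' _ _ (by simp)
  have h₂ : Filter.Tendsto (fun g' : V × ℤ => (g' - g).2) (𝓝 g) (𝓝 0) :=
    (by fun_prop : Continuous fun g' : V × ℤ => (g' - g).2).tendsto' _ _ (by simp)
  filter_upwards [h₁.eventually (T.eventually_eq_zero_of_act_eq x),
    h₂.eventually_mem (isOpen_discrete {0} |>.mem_nhds rfl)] with g' hg₁ hg₂ hg'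
  have hg₂ : (g' - g).2 = 0 := hg₂
  have hfix : T.act (g' - g) x = x := by
    conv_lhs => rw [← hg, ← T.act_add, sub_add_cancel, hg']
  have : g' - g = 0 := Prod.ext (hg₁ (by rw [← hg₂]; exact hfix)) hg₂
  exact sub_eq_zero.1 this

variable [T2Space M]

/-- The stabilizer in V × ℤ may be infinite, but it is closed and discrete, so it meets the compact
set of representatives in finitely many elements, and these already give all its transformations. -/
theorem finite_stab (x : M) : Finite (T.stab x) := by
  obtain ⟨K, hK, hKg⟩ := T.cocompact
  have hcl : IsClosed {g | T.act g x = x} :=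
    isClosed_eq (T.continuous_uncurry.comp (by fun_prop : Continuous fun g => (g, x)))
      continuous_const
  have hfin : (K ∩ {g | T.act g x = x}).Finite := by
    refine (hK.inter_right hcl).finite ?_
    refine IsDiscrete.of_nhdsWithin fun g hg => ?_
    rw [Filter.le_pure_iff, mem_nhdsWithin_iff_eventually]
    filter_upwards [T.eventually_eq_of_act_eq hg.2] with g' hg' h using hg' h.2
  refine (hfin.image fun g => (T.toHomeomorph g).toEquiv).subset ?_
  rintro f ⟨g, hg, hf⟩
  obtain ⟨g', hg'K, hg'⟩ := hKg g
  refine ⟨g', ⟨hg'K, by rw [mem_ofPred_eq, hg', hg]⟩, Equiv.ext fun y => ?_⟩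
  exact (congrFun hg' y).trans (hf y).symm

variable [FiniteDimensional ℝ E]

/-- Near `x` there is a slice on which the stabilizer of `x` acts linearly. -/
theorem exists_linear_slice (x : M) {d : ℕ}
    (hd : Module.finrank ℝ E = Module.finrank ℝ V + d) :
    ∃ (s : EuclideanSpace ℝ (Fin d) → M) (O : Set (EuclideanSpace ℝ (Fin d)))
      (A : T.stab x → EuclideanSpace ℝ (Fin d) →L[ℝ] EuclideanSpace ℝ (Fin d)),
      s 0 = x ∧ IsOpen O ∧ 0 ∈ O ∧ ContMDiffOn (𝓡 d) I ∞ s O ∧ T.Transverse (𝓡 d) s 0 ∧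
      (∀ f g, A (f * g) = (A f).comp (A g)) ∧ A 1 = ContinuousLinearMap.id ℝ _ ∧
      ∀ f : T.stab x, ∀ᶠ u in 𝓝 0, (f : Equiv.Perm M) (s u) = s (A f u) := by
  have := FiniteDimensional.complete ℝ E
  have := T.finite_stab x
  obtain ⟨F, L, hxL, hF₀, hLF, hFd, hFeq⟩ := exists_linearization (T.stab x)
    (fun f hf => T.contMDiff_stab hf) (fun f hf => T.stab_apply ⟨f, hf⟩)
  let A : T.stab x → E →L[ℝ] E := fun f => modelDeriv I I f.1 x
  have hA : ∀ f g : T.stab x, A (f * g) = (A f).comp (A g) := fun f g =>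
    modelDeriv_mul (T.contMDiff_stab f.2) (T.contMDiff_stab g.2) (T.stab_apply g)
  have hA₁ : A 1 = ContinuousLinearMap.id ℝ E := modelDeriv_id (I := I) x
  -- The acting group is abelian, so the stabilizer acts trivially on the tangent space of the
  -- orbit.
  have hW : ∀ f, ∀ v ∈ T.vert x, A f v = v := by
    rintro ⟨f, g, hg, hf⟩ _ ⟨v, rfl⟩
    have := T.modelDeriv_act_orbitDeriv g x v
    rw [hg, ← funext hf] at this
    exact this
  obtain ⟨C, hC, hCA⟩ := exists_invariant_isCompl (fun f => (A f : E →ₗ[ℝ] E))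
    (fun f g => by rw [hA]; rfl) (T.vert x) hW
  have hCd : Module.finrank ℝ C = d := by
    have h₁ := Submodule.finrank_add_eq_of_isCompl hC
    have h₂ : Module.finrank ℝ (T.vert x) = Module.finrank ℝ V :=
      LinearMap.finrank_range_of_inj (T.free x)
    omega
  let e : EuclideanSpace ℝ (Fin d) ≃L[ℝ] C := ContinuousLinearEquiv.ofFinrankEq (by simp [hCd])
  let ι : EuclideanSpace ℝ (Fin d) →L[ℝ] E := C.subtypeL.comp (e : _ →L[ℝ] C)
  have hι : Function.Injective ι := Subtype.val_injective.comp e.injective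
  have hιr : ι.range = C := by
    ext z
    constructor
    · rintro ⟨u, rfl⟩
      exact (e u).2
    · exact fun hz => ⟨e.symm ⟨z, hz⟩, by simp [ι]⟩
  let B : T.stab x → EuclideanSpace ℝ (Fin d) →L[ℝ] EuclideanSpace ℝ (Fin d) := fun f =>
    (e.symm : C →L[ℝ] _).comp (((A f).comp ι).codRestrict C fun u => hCA f _ (e u).2)
  have hB : ∀ f u, ι (B f u) = A f (ι u) := fun f u =>
    congrArg Subtype.val (e.apply_symm_apply _)
  -- In the linearizing coordinates, the slice is an invariant linear complement of the tangent
  -- space of the orbit.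
  let s : EuclideanSpace ℝ (Fin d) → M := fun u => L.symm (ι u)
  have hLx : L x = 0 := (hLF x hxL).trans hF₀
  have h0t : (0 : E) ∈ L.target := hLx ▸ L.map_source hxL
  have hs₀ : s 0 = x := by
    change L.symm (ι 0) = x
    rw [map_zero, ← hLx]
    exact L.left_inv hxL
  have hO : IsOpen (ι ⁻¹' L.target) := L.open_target.preimage ι.continuous
  have h0O : (0 : EuclideanSpace ℝ (Fin d)) ∈ ι ⁻¹' L.target := by
    rw [mem_preimage, map_zero]
    exact h0t
  have hs : ContMDiffOn (𝓡 d) I ∞ s (ι ⁻¹' L.target) :=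
    L.symm.contMDiffOn.comp ι.contMDiff.contMDiffOn fun _ hu => hu
  have hsc : ContinuousAt s 0 := hs.continuousOn.continuousAt (hO.mem_nhds h0O)
  have hFs : ∀ u ∈ ι ⁻¹' L.target, F (s u) = ι u := fun u hu =>
    (hLF _ (L.map_target hu)).symm.trans (L.right_inv hu)
  have hsd : modelDeriv (𝓡 d) I s 0 = ι := by
    have h₁ : MDifferentiableAt (𝓡 d) I s 0 :=
      (hs.contMDiffAt (hO.mem_nhds h0O)).mdifferentiableAt (by simp)
    have h₂ : MDifferentiableAt I 𝓘(ℝ, E) F (s 0) := by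
      rw [hs₀]
      refine (L.mdifferentiableAt (by simp) hxL).congr_of_eventuallyEq ?_
      filter_upwards [L.open_source.mem_nhds hxL] with y hy using (hLF y hy).symm
    have h := modelDeriv_comp h₂ h₁
    rw [hs₀, hFd, ContinuousLinearMap.id_comp] at h
    rw [← h, modelDeriv_congr (g := ι), modelDeriv_eq_fderiv, ContinuousLinearMap.fderiv]
    filter_upwards [hO.mem_nhds h0O] with u hu using hFs u hu
  refine ⟨s, ι ⁻¹' L.target, B, hs₀, hO, h0O, hs, ?_, ?_, ?_, ?_⟩
  · rw [Transverse, hsd, hs₀, hιr]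
    exact ⟨hι, hC⟩
  · intro f g
    ext1 u
    apply hι
    refine (hB _ u).trans ?_
    rw [hA]
    exact (congrArg (A f) (hB g u)).symm.trans (hB f _).symm
  · ext1 u
    apply hι
    rw [hB, hA₁]
    rfl
  · intro f
    have h₁ : ∀ᶠ u in 𝓝 0, (f : Equiv.Perm M) (s u) ∈ L.source := by
      refine ((T.contMDiff_stab f.2).continuous.continuousAt.comp hsc).eventually_mem
        (L.open_source.mem_nhds ?_)
      rw [Function.comp_apply, hs₀, T.stab_apply]
      exact hxL
    have h₂ : ∀ᶠ u in 𝓝 0, B f u ∈ ι ⁻¹' L.target :=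
      (B f).continuous.continuousAt.eventually_mem (hO.mem_nhds (by rwa [map_zero]))
    filter_upwards [h₁, h₂, hO.mem_nhds h0O] with u hu₁ hu₂ hu₃
    have : L ((f : Equiv.Perm M) (s u)) = ι (B f u) := by
      rw [hLF _ hu₁, hFeq f f.2, hFs u hu₃, hB]
    rw [← L.left_inv hu₁]
    exact congrArg L.symm this

/-- The slice theorem: through `x` there is a slice, parametrized by a convex open set on which
the stabilizer of `x` acts linearly. -/
theorem exists_slice (x : M) {d : ℕ} (hd : Module.finrank ℝ E = Module.finrank ℝ V + d) :
    ∃ (U : Set (EuclideanSpace ℝ (Fin d))) (s : EuclideanSpace ℝ (Fin d) → M)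
      (A : T.stab x → EuclideanSpace ℝ (Fin d) →L[ℝ] EuclideanSpace ℝ (Fin d)),
      IsOpen U ∧ Convex ℝ U ∧ 0 ∈ U ∧ s 0 = x ∧ ContMDiffOn (𝓡 d) I ∞ s U ∧ InjOn s U ∧
      (∀ u ∈ U, T.Transverse (𝓡 d) s u) ∧
      (∀ f : T.stab x, ∀ u ∈ U, A f u ∈ U ∧ (f : Equiv.Perm M) (s u) = s (A f u)) ∧
      ∀ g, ∀ u ∈ U, ∀ u' ∈ U, T.act g (s u) = s u' → T.act g x = x := by
  have := T.finite_stab x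
  obtain ⟨s, O, A, hs₀, hO, h0O, hs, ht, hA, hA₁, hAs⟩ := T.exists_linear_slice x hd
  obtain ⟨L, h0L, -, hL⟩ := T.exists_tube hO h0O hs ht
  have hsc : ContinuousAt s 0 := hs.continuousOn.continuousAt (hO.mem_nhds h0O)
  have ev₁ := T.eventually_act_eq_of_act_slice_eq hs₀ hsc L h0L hL hAs
  have ev₂ : ∀ᶠ u in 𝓝 (0 : EuclideanSpace ℝ (Fin d)), ((0 : V), u) ∈ L.source :=
    (by fun_prop : Continuous fun u : EuclideanSpace ℝ (Fin d) => ((0 : V), u)).continuousAt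
      |>.eventually_mem (L.open_source.mem_nhds h0L)
  have ev₃ := Filter.eventually_all.2 hAs
  obtain ⟨ε₁, hε₁, hb₁⟩ := Metric.eventually_nhds_iff_ball.1 ev₁
  obtain ⟨ε₂, hε₂, hb₂⟩ := Metric.eventually_nhds_iff_ball.1
    ((ev₂.and ev₃).and (hO.mem_nhds h0O : ∀ᶠ u in 𝓝 0, u ∈ O))
  let ε := min ε₁ ε₂
  have hε : 0 < ε := lt_min hε₁ hε₂
  -- Intersecting the preimages of a ball under all the linear maps `A f` gives an open, convex set
  -- that is invariant because `A` is multiplicative, and that lies in the ball because `A 1` is the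
  -- identity.
  let U : Set (EuclideanSpace ℝ (Fin d)) := ⋂ f, A f ⁻¹' Metric.ball 0 ε
  have hUb : ∀ u ∈ U, u ∈ Metric.ball (0 : EuclideanSpace ℝ (Fin d)) ε := fun u hu => by
    have := mem_iInter.1 hu 1
    rwa [mem_preimage, hA₁] at this
  have hU₁ : ∀ u ∈ U, ∀ u' ∈ U, (u, u') ∈ Metric.ball (((0, 0) :
      EuclideanSpace ℝ (Fin d) × EuclideanSpace ℝ (Fin d))) ε₁ := fun u hu u' hu' => by
    rw [← ball_prod_same]
    exact ⟨Metric.ball_subset_ball (min_le_left _ _) (hUb u hu),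
      Metric.ball_subset_ball (min_le_left _ _) (hUb u' hu')⟩
  have hU₂ : ∀ u ∈ U, u ∈ Metric.ball (0 : EuclideanSpace ℝ (Fin d)) ε₂ := fun u hu =>
    Metric.ball_subset_ball (min_le_right _ _) (hUb u hu)
  have hLs : ∀ u, T.tube s (0, u) = s u := fun u => T.act_zero _
  refine ⟨U, s, A, isOpen_iInter_of_finite fun f => Metric.isOpen_ball.preimage (A f).continuous,
    convex_iInter fun f => (convex_ball _ _).is_linear_preimage (A f).toLinearMap.isLinear,
    mem_iInter.2 fun f => by simpa using hε, hs₀,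
    hs.mono fun u hu => (hb₂ u (hU₂ u hu)).2, fun u hu u' hu' h => ?_, fun u hu => ?_,
    fun f u hu => ⟨mem_iInter.2 fun f' => ?_, (hb₂ u (hU₂ u hu)).1.2 f⟩,
    fun g u hu u' hu' => hb₁ (u, u') (hU₁ u hu u' hu') g⟩
  · have h₁ := (hb₂ u (hU₂ u hu)).1.1
    have h₂ := (hb₂ u' (hU₂ u' hu')).1.1
    exact congrArg Prod.snd (L.injOn h₁ h₂ (by rw [hL _ h₁, hL _ h₂, hLs, hLs, h]))
  · have h₁ := (hb₂ u (hU₂ u hu)).1.1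
    -- Transversality is known only at 0; at other points of `U` it follows from the tube map being
    -- a diffeomorphism near (0, u).
    rw [← T.modelDeriv_tube_bijective_iff
      (hs.contMDiffAt (hO.mem_nhds (hb₂ u (hU₂ u hu)).2)), modelDeriv_congr (g := L)]
    · exact L.modelDeriv_bijective h₁
    · filter_upwards [L.open_source.mem_nhds h₁] with z hz using (hL z hz).symm
  · have := mem_iInter.1 hu (f' * f)
    rwa [hA] at this

end Slice

end LocallyFreeAction

/-! ## Orbifold charts on quotients -/

namespace LocallyFreeAction

section Quotient

variable {E H M : Type*} [NormedAddCommGroup E] [NormedSpace ℝ E] [TopologicalSpace H]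
  [TopologicalSpace M] [ChartedSpace H M]
  {V : Type*} [NormedAddCommGroup V] [NormedSpace ℝ V] {I : ModelWithCorners ℝ E H}
  (T : LocallyFreeAction V I M) {X : Type*}

/-- The tangent spaces of the orbits. -/
def vertical (x : M) : Submodule ℝ (TangentSpace I x) := T.vert x

theorem mem_quotientCharts_iff [TopologicalSpace X] {qt : M → X} {d : ℕ} {c : OrbChart d X} :
    c ∈ quotientCharts I qt T.vertical d ↔ ∀ u, T.HasTransverseLift (𝓡 d) qt c.φ u :=
  Iff.rfl

/-- The map `qt` exhibits `X` as the topological quotient of `M` by the action. -/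
structure IsOrbitMap [TopologicalSpace X] (qt : M → X) : Prop where
  isOpenQuotientMap : IsOpenQuotientMap qt
  eq_iff : ∀ x y, qt x = qt y ↔ ∃ g, T.act g x = y

theorem IsOrbitMap.of_isQuotientMap [TopologicalSpace X] {qt : M → X}
    (h : IsQuotientMap qt) (hqt : ∀ x y, qt x = qt y ↔ ∃ g, T.act g x = y) :
    T.IsOrbitMap qt := by
  refine ⟨⟨h.surjective, h.continuous, fun O hO => ?_⟩, hqt⟩
  rw [← h.isOpen_preimage]
  have : qt ⁻¹' (qt '' O) = ⋃ g, T.act g '' O := by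
    ext y
    simp only [mem_preimage, mem_image, mem_iUnion, hqt]
    exact ⟨fun ⟨x, hx, g, hg⟩ => ⟨g, x, hx, hg⟩, fun ⟨g, x, hx, hg⟩ => ⟨x, hx, g, hg⟩⟩
  rw [this]
  exact isOpen_iUnion fun g => (T.toHomeomorph g).isOpenMap O hO

/-- The orbit relation is the projection, along a compact factor, of a closed set; hence it is
closed, and the quotient by it is Hausdorff since the projection is open. -/
theorem IsOrbitMap.t2Space [T2Space M] [TopologicalSpace X] {qt : M → X}
    (h : T.IsOrbitMap qt) : T2Space X := by
  rw [t2Space_iff_of_isOpenQuotientMap h.isOpenQuotientMap]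
  obtain ⟨K, hK, hKg⟩ := T.cocompact
  have hcl : IsClosed {z : (M × M) × K | T.act z.2 z.1.1 = z.1.2} :=
    isClosed_eq (T.continuous_uncurry.comp
      (by fun_prop : Continuous fun z : (M × M) × K => ((z.2 : V × ℤ), z.1.1))) (by fun_prop)
  have : CompactSpace K := isCompact_iff_compactSpace.1 hK
  have hr : {z : M × M | qt z.1 = qt z.2}
      = Prod.fst '' {z : (M × M) × K | T.act z.2 z.1.1 = z.1.2} := by
    ext ⟨a, b⟩
    constructor
    · intro hab
      obtain ⟨g, hg⟩ := (h.eq_iff a b).1 hab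
      obtain ⟨g', hg'K, hg'⟩ := hKg g
      exact ⟨((a, b), ⟨g', hg'K⟩), (congrFun hg' a).trans hg, rfl⟩
    · rintro ⟨⟨⟨a', b'⟩, k⟩, hk, hab⟩
      obtain ⟨rfl, rfl⟩ := Prod.mk.inj hab
      exact (h.eq_iff _ _).2 ⟨k, hk⟩
  rw [hr]
  exact isClosedMap_fst_of_compactSpace _ hcl

theorem IsOrbitMap.secondCountableTopology [SecondCountableTopology M] [TopologicalSpace X]
    {qt : M → X} (h : T.IsOrbitMap qt) : SecondCountableTopology X :=
  h.isOpenQuotientMap.isQuotientMap.secondCountableTopology h.isOpenQuotientMap.isOpenMap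

theorem Transverse.subtypeVal {d : ℕ} {U : TopologicalSpace.Opens (EuclideanSpace ℝ (Fin d))}
    {s : EuclideanSpace ℝ (Fin d) → M} {u : U} (hs : MDifferentiableAt (𝓡 d) I s u)
    (ht : T.Transverse (𝓡 d) s u) : T.Transverse (𝓡 d) (fun w : U => s w) u := by
  have hb := modelDeriv_subtypeVal_bijective (I := 𝓡 d) U u
  have h : modelDeriv (𝓡 d) I (fun w : U => s w) u
      = (modelDeriv (𝓡 d) I s u).comp (modelDeriv (𝓡 d) (𝓡 d) Subtype.val u) :=
    modelDeriv_comp hs ((contMDiff_subtype_val (n := ∞) u).mdifferentiableAt (by simp))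
  have hr : (modelDeriv (𝓡 d) I (fun w : U => s w) u).range = (modelDeriv (𝓡 d) I s u).range := by
    rw [h]
    exact LinearMap.range_comp_of_range_eq_top _ (LinearMap.range_eq_top.2 hb.2)
  refine ⟨?_, ?_⟩
  · rw [h]
    exact ht.1.comp hb.1
  · rw [hr]
    exact ht.2

variable [FiniteDimensional ℝ V] [FiniteDimensional ℝ E] [I.Boundaryless] [IsManifold I ∞ M]

/-- Openness of `f` at `p`: on the tube, `qt` composed with the local homeomorphism (t, w) ↦ t ·
s(w) equals f(w), and `qt` is open. -/
theorem nhds_le_map_of_hasTransverseLift [TopologicalSpace X] {qt : M → X} (hqt : IsOpenMap qt)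
    {E' H' P : Type*} [NormedAddCommGroup E'] [NormedSpace ℝ E'] [TopologicalSpace H']
    {J : ModelWithCorners ℝ E' H'} [TopologicalSpace P] [ChartedSpace H' P]
    [FiniteDimensional ℝ E'] [J.Boundaryless] [IsManifold J ∞ P]
    (hqi : ∀ g x, qt (T.act g x) = qt x) {f : P → X} {p : P}
    (hf : T.HasTransverseLift J qt f p) : 𝓝 (f p) ≤ Filter.map f (𝓝 p) := by
  obtain ⟨A, s, hA, hp, hs, hsf, ht⟩ := hf
  obtain ⟨L, hpL, hLA, hL⟩ := T.exists_tube hA hp hs ht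
  have h₀ : qt (L (0, p)) = f p := by
    rw [hL _ hpL, ← hsf p hp]
    exact hqi 0 _
  have h₁ : 𝓝 (L (0, p)) ≤ Filter.map L (𝓝 (0, p)) :=
    (L.toOpenPartialHomeomorph.map_nhds_eq hpL).ge
  have h₂ : Filter.map qt (Filter.map L (𝓝 (0, p)))
      = Filter.map f (Filter.map Prod.snd (𝓝 ((0 : V), p))) := by
    rw [Filter.map_map, Filter.map_map]
    refine Filter.map_congr ?_
    filter_upwards [L.open_source.mem_nhds hpL] with z hz
    change qt (L z) = f z.2
    rw [hL z hz, ← hsf _ (hLA z hz)]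
    exact hqi _ _
  calc 𝓝 (f p) ≤ Filter.map qt (𝓝 (L (0, p))) := h₀ ▸ hqt.nhds_le _
    _ ≤ Filter.map qt (Filter.map L (𝓝 (0, p))) := Filter.map_mono h₁
    _ = Filter.map f (𝓝 p) := by rw [h₂, map_snd_nhds]

/-- Every point near `s p` is a translate of a point of the transversal, and the group is abelian.
-/
theorem eventually_act_eq_self {E' H' P : Type*} [NormedAddCommGroup E'] [NormedSpace ℝ E']
    [TopologicalSpace H'] {J : ModelWithCorners ℝ E' H'} [TopologicalSpace P] [ChartedSpace H' P]
    [FiniteDimensional ℝ E'] [J.Boundaryless] [IsManifold J ∞ P] {s : P → M}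
    (hs : ContMDiff J I ∞ s) {p : P} (ht : T.Transverse J s p) {g : V × ℤ}
    (hg : ∀ w, T.act g (s w) = s w) : ∀ᶠ y in 𝓝 (s p), T.act g y = y := by
  obtain ⟨L, hpL, -, hL⟩ := T.exists_tube isOpen_univ (mem_univ p) hs.contMDiffOn ht
  have h₀ : L (0, p) = s p := (hL _ hpL).trans (T.act_zero _)
  have hm : Filter.map L (𝓝 (0, p)) = 𝓝 (L (0, p)) := L.toOpenPartialHomeomorph.map_nhds_eq hpL
  rw [← h₀, ← hm, Filter.eventually_map]
  filter_upwards [L.open_source.mem_nhds hpL] with z hz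
  rw [hL z hz]
  change T.act g (T.act _ _) = T.act _ _
  rw [T.act_comm, hg]

variable [T2Space M] [TopologicalSpace X]

/-- The chart comes with its slice and with a dictionary between Γ and the stabilizer of `x`,
because the local trivialization needs the group elements that induce Γ. Points of the slice on one
orbit are related only by elements fixing `x`, so the fibres of the chart map are exactly the
Γ-orbits. -/
theorem exists_slice_chart {qt : M → X} (h : T.IsOrbitMap qt) (x : M) {d : ℕ}
    (hd : Module.finrank ℝ E = Module.finrank ℝ V + d) :
    ∃ (c : OrbChart d X) (s : c.U → M), c ∈ quotientCharts I qt T.vertical d ∧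
      (∀ u, qt (s u) = c.φ u) ∧ (∃ u, s u = x) ∧ ContMDiff (𝓡 d) I ∞ s ∧
      (∀ u, T.Transverse (𝓡 d) s u) ∧
      (∀ γ ∈ c.Γ, ∃ g, T.act g x = x ∧ ∀ u, T.act g (s u) = s (γ u)) ∧
      (∀ g, T.act g x = x → ∃ γ ∈ c.Γ, ∀ u, T.act g (s u) = s (γ u)) ∧
      (∀ g u u', T.act g (s u) = s u' → T.act g x = x) ∧ Function.Injective s := by
  have := T.finite_stab x
  obtain ⟨U, s, A, hU, hUc, h0U, hs₀, hs, hsi, ht, hA, hst⟩ := T.exists_slice x hd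
  let U' : TopologicalSpace.Opens (EuclideanSpace ℝ (Fin d)) := ⟨U, hU⟩
  let s' : U' → M := fun u => s u
  have hs' : ContMDiff (𝓡 d) I ∞ s' := fun u =>
    (hs.contMDiffAt (hU.mem_nhds u.2)).comp u (contMDiff_subtype_val u)
  have hsi' : Function.Injective s' := fun u u' huu => Subtype.ext (hsi u.2 u'.2 huu)
  have ht' : ∀ u, T.Transverse (𝓡 d) s' u := fun u =>
    (ht u u.2).subtypeVal T ((hs.contMDiffAt (hU.mem_nhds u.2)).mdifferentiableAt (by simp))
  let B : T.stab x → U' → U' := fun f u => ⟨A f u, (hA f u u.2).1⟩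
  have hB : ∀ (f : T.stab x) u, (f : Equiv.Perm M) (s' u) = s' (B f u) := fun f u => (hA f u u.2).2
  let P : T.stab x → Equiv.Perm U' := fun f =>
    { toFun := B f
      invFun := B f⁻¹
      left_inv := fun u => hsi' (by rw [← hB, ← hB]; exact (f : Equiv.Perm M).symm_apply_apply _)
      right_inv := fun u => hsi' (by rw [← hB, ← hB]; exact (f : Equiv.Perm M).apply_symm_apply _) }
  let G : Subgroup (Equiv.Perm U') :=
    { carrier := {γ | ∃ f : T.stab x, ∀ u, (f : Equiv.Perm M) (s' u) = s' (γ u)}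
      one_mem' := ⟨1, fun u => rfl⟩
      mul_mem' := by
        rintro γ γ' ⟨f, hf⟩ ⟨f', hf'⟩
        exact ⟨f * f', fun u => ((congrArg f.1 (hf' u)).trans (hf _))⟩
      inv_mem' := by
        rintro γ ⟨f, hf⟩
        refine ⟨f⁻¹, fun u => ?_⟩
        have : (f : Equiv.Perm M) (s' (γ⁻¹ u)) = s' u :=
          (hf _).trans (congrArg s' (γ.apply_symm_apply u))
        rw [← this]
        exact (f : Equiv.Perm M).symm_apply_apply _ }
  have hlift : ∀ u, T.HasTransverseLift (𝓡 d) qt (fun w => qt (s' w)) u := fun u =>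
    ⟨univ, s', isOpen_univ, trivial, hs'.contMDiffOn, fun _ _ => rfl, ht' u⟩
  have hqi : ∀ g y, qt (T.act g y) = qt y := fun g y => ((h.eq_iff _ _).2 ⟨g, rfl⟩).symm
  let c : OrbChart d X :=
    { U := U'
      connected := ⟨⟨0, h0U⟩, hUc.isPreconnected⟩
      Γ := G
      finite := by
        refine Finite.of_injective (fun γ : G => γ.2.choose) fun γ γ' hγ => ?_
        refine Subtype.ext (Equiv.ext fun u => hsi' ?_)
        have h₁ := γ.2.choose_spec u
        have h₂ := γ'.2.choose_spec u
        rw [← h₁, ← h₂]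
        exact congrArg (fun f : T.stab x => (f : Equiv.Perm M) (s' u)) hγ
      smooth := by
        rintro γ ⟨f, hf⟩
        have hγ : (γ : U' → U') = B f := funext fun u => hsi' ((hf u).symm.trans (hB f u))
        rw [hγ, ← ContMDiff.subtypeVal_comp_iff]
        exact (A f).contMDiff.comp contMDiff_subtype_val
      φ := fun u => qt (s' u)
      continuous := h.isOpenQuotientMap.continuous.comp hs'.continuous
      isOpenMap := isOpenMap_iff_nhds_le.2 fun u =>
        T.nhds_le_map_of_hasTransverseLift h.isOpenQuotientMap.isOpenMap hqi (hlift u)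
      fibers := fun u u' => by
        rw [h.eq_iff]
        constructor
        · rintro ⟨g, hg⟩
          have hgx := hst g u u.2 u' u'.2 hg
          refine ⟨P (T.toStab hgx), ⟨T.toStab hgx, hB _⟩, hsi' ?_⟩
          exact (hB (T.toStab hgx) u).symm.trans hg
        · rintro ⟨γ, hγ, rfl⟩
          obtain ⟨⟨f, g, hgx, hg⟩, hf⟩ := hγ
          exact ⟨g, by rw [← hg]; exact hf u⟩ }
  refine ⟨c, s', hlift, fun _ => rfl, ⟨⟨0, h0U⟩, hs₀⟩, hs', ht', ?_, ?_, ?_, hsi'⟩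
  · rintro γ ⟨⟨f, g, hgx, hg⟩, hf⟩
    exact ⟨g, hgx, fun u => by rw [← hg]; exact hf u⟩
  · intro g hg
    exact ⟨P (T.toStab hg), ⟨T.toStab hg, hB _⟩, hB (T.toStab hg)⟩
  · exact fun g u u' => hst g u u.2 u' u'.2

theorem isOrbifoldAtlas_quotientCharts [SecondCountableTopology M] {qt : M → X}
    (h : T.IsOrbitMap qt) {d : ℕ} (hd : Module.finrank ℝ E = Module.finrank ℝ V + d) :
    IsOrbifoldAtlas (quotientCharts I qt T.vertical d) where
  t2 := h.t2Space
  secondCountable := h.secondCountableTopology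
  covers := fun z => by
    obtain ⟨x, rfl⟩ := h.isOpenQuotientMap.surjective z
    obtain ⟨c, s, hc, hs, ⟨u, rfl⟩, -⟩ := T.exists_slice_chart h x hd
    exact ⟨c, hc, u, (hs u).symm⟩
  compatible := fun _ hc _ hc' => T.locallyDiffeomorphic_of_hasTransverseLift h.eq_iff hc hc'

/-- A transformation in the group that is the identity near one point is the identity. -/
theorem act_eq_self_of_eventually [ConnectedSpace M] {g : V × ℤ} {x₀ : M}
    (hx₀ : ∀ᶠ y in 𝓝 x₀, T.act g y = y) (x : M) : T.act g x = x := by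
  have := FiniteDimensional.complete ℝ E
  let S : Set M := {x | ∀ᶠ y in 𝓝 x, T.act g y = y}
  have hSo : IsOpen S := isOpen_setOfPred_eventually_nhds
  have hSf : ∀ y ∈ S, T.act g y = y := fun y (hy : ∀ᶠ z in 𝓝 y, T.act g z = z) =>
    hy.self_of_nhds
  have hSc : IsClosed S := by
    refine isClosed_of_closure_subset fun y hy => ?_
    have hgy : T.act g y = y :=
      closure_minimal hSf (isClosed_eq (T.contMDiff_act g).continuous continuous_id) hy
    -- In linearizing coordinates at the limit point `y`, the transformation is a linear map that is
    -- the identity on a nonempty open set. So it is the identity, and `y` is an interior point of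
    -- `S`.
    have := T.finite_stab y
    obtain ⟨F, L, hyL, -, hLF, -, hF⟩ := exists_linearization (T.stab y)
      (fun f hf => T.contMDiff_stab hf) (fun f hf => T.stab_apply ⟨f, hf⟩)
    have hFg : ∀ z, F (T.act g z) = modelDeriv I I (T.act g) y (F z) :=
      hF _ (T.toStab hgy).2
    obtain ⟨z, hzL, hzS⟩ := mem_closure_iff.1 hy L.source L.open_source hyL
    have hid : modelDeriv I I (T.act g) y = ContinuousLinearMap.id ℝ E := by
      have hev : ∀ᶠ w in 𝓝 (L z), modelDeriv I I (T.act g) y w = w := by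
        have hm : Filter.map L (𝓝 z) = 𝓝 (L z) := L.toOpenPartialHomeomorph.map_nhds_eq hzL
        rw [← hm, Filter.eventually_map]
        filter_upwards [L.open_source.mem_nhds hzL, hSo.mem_nhds hzS] with w hw hwS
        rw [hLF w hw, ← hFg, hSf w hwS]
      exact (modelDeriv I I (T.act g) y).hasFDerivAt.unique
        ((hasFDerivAt_id (L z)).congr_of_eventuallyEq hev)
    filter_upwards [L.open_source.mem_nhds hyL,
      ((T.contMDiff_act g).continuous.continuousAt).eventually_mem
        (L.open_source.mem_nhds (hgy.symm ▸ hyL))] with w hw hw'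
    refine L.injOn hw' hw ?_
    rw [hLF _ hw', hLF _ hw, hFg, hid]
    rfl
  have : S = univ := IsClopen.eq_univ ⟨hSc, hSo⟩ ⟨x₀, hx₀⟩
  exact hSf x (this ▸ mem_univ x)

end Quotient

end LocallyFreeAction

/-! ## Flows of torus actions -/

/-- A vector field, with values in the model space. -/
def VField.toModel {d : ℕ} {M : Type*} [TopologicalSpace M]
    [ChartedSpace (EuclideanSpace ℝ (Fin d)) M] (X : VField d M) (x : M) :
    EuclideanSpace ℝ (Fin d) := X x

/-- The Reeb field, with values in the model space. -/
def SasakianStructure.reeb {n : ℕ} {M : Type*} [TopologicalSpace M]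
    [ChartedSpace (EuclideanSpace ℝ (Fin (2 * n + 1))) M] [IsManifold (𝓡 (2 * n + 1)) ∞ M]
    (S : SasakianStructure n M) (x : M) : EuclideanSpace ℝ (Fin (2 * n + 1)) := S.ξ x

namespace TorusAction

section Flows

variable {k k' d : ℕ} {M : Type*} [TopologicalSpace M] [ChartedSpace (EuclideanSpace ℝ (Fin d)) M]
  (T : TorusAction k d M) (A : TorusAction 1 d M)

theorem contMDiff_act (v : Fin k → ℝ) : ContMDiff (𝓡 d) (𝓡 d) ∞ (T.act v) :=
  T.smooth.comp (contMDiff_const.prodMk contMDiff_id :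
    ContMDiff (𝓡 d) (𝓘(ℝ, Fin k → ℝ).prod (𝓡 d)) ∞ (fun x => (v, x)))

theorem mdifferentiable_act (v : Fin k → ℝ) : MDifferentiable (𝓡 d) (𝓡 d) (T.act v) :=
  (T.contMDiff_act v).mdifferentiable (by simp)

theorem contMDiff_orbit (x : M) :
    ContMDiff 𝓘(ℝ, Fin k → ℝ) (𝓡 d) ∞ (fun v => T.act v x) :=
  T.smooth.comp (contMDiff_id.prodMk contMDiff_const :
    ContMDiff 𝓘(ℝ, Fin k → ℝ) (𝓘(ℝ, Fin k → ℝ).prod (𝓡 d)) ∞ (fun v => (v, x)))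

theorem contMDiff_flow (v : Fin k → ℝ) (x : M) :
    ContMDiff 𝓘(ℝ, ℝ) (𝓡 d) ∞ (fun t : ℝ => T.act (t • v) x) :=
  (T.contMDiff_orbit x).comp ((contDiff_id.smul contDiff_const).contMDiff :
    ContMDiff 𝓘(ℝ, ℝ) 𝓘(ℝ, Fin k → ℝ) ∞ fun t : ℝ => t • v)

theorem act_neg_act (v : Fin k → ℝ) (x : M) : T.act (-v) (T.act v x) = x := by
  rw [← T.act_add, neg_add_cancel, T.act_zero]

theorem act_act_neg (v : Fin k → ℝ) (x : M) : T.act v (T.act (-v) x) = x := by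
  rw [← T.act_add, add_neg_cancel, T.act_zero]

theorem modelDeriv_act_bijective (v : Fin k → ℝ) (x : M) :
    Function.Bijective (modelDeriv (𝓡 d) (𝓡 d) (T.act v) x) :=
  modelDeriv_bijective_of_leftInverse (g := T.act (-v)) (T.mdifferentiable_act v x)
    (T.mdifferentiable_act (-v) _) (T.act_neg_act v x)
    (Filter.Eventually.of_forall (T.act_neg_act v))
    (Filter.Eventually.of_forall (T.act_act_neg v))

/-- The vector field generated by `v`, with values in the model space. -/
def velocity (v : Fin k → ℝ) (x : M) : EuclideanSpace ℝ (Fin d) := T.gen v x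

theorem velocity_eq (v : Fin k → ℝ) (x : M) :
    T.velocity v x = modelDeriv 𝓘(ℝ, ℝ) (𝓡 d) (fun t : ℝ => T.act (t • v) x) 0 1 := rfl

theorem modelDeriv_comp_linear {V : Type*} [NormedAddCommGroup V] [NormedSpace ℝ V]
    (f : V →L[ℝ] (Fin k → ℝ)) (x : M) (v : V) :
    modelDeriv 𝓘(ℝ, V) (𝓡 d) (fun t => T.act (f t) x) 0 v
      = modelDeriv 𝓘(ℝ, Fin k → ℝ) (𝓡 d) (fun u => T.act u x) 0 (f v) := by
  have := modelDeriv_comp_apply (I := 𝓘(ℝ, V)) (J := 𝓘(ℝ, Fin k → ℝ)) (K := 𝓡 d)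
    (g := fun u => T.act u x) (f := f) (x := (0 : V))
    ((T.contMDiff_orbit x).mdifferentiable (by simp) _) f.mdifferentiableAt v
  rwa [map_zero, modelDeriv_eq_fderiv, ContinuousLinearMap.fderiv] at this

theorem velocity_eq_modelDeriv_orbit (v : Fin k → ℝ) (x : M) :
    T.velocity v x = modelDeriv 𝓘(ℝ, Fin k → ℝ) (𝓡 d) (fun u => T.act u x) 0 v := by
  have := T.modelDeriv_comp_linear ((1 : ℝ →L[ℝ] ℝ).smulRight v) x 1
  simpa [velocity_eq] using this

theorem velocity_add (v w : Fin k → ℝ) (x : M) :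
    T.velocity (v + w) x = T.velocity v x + T.velocity w x := by
  simp only [velocity_eq_modelDeriv_orbit, map_add]

theorem velocity_smul (c : ℝ) (v : Fin k → ℝ) (x : M) :
    T.velocity (c • v) x = c • T.velocity v x := by
  simp only [velocity_eq_modelDeriv_orbit, map_smul]

theorem modelDeriv_flow (v : Fin k → ℝ) (x : M) (t : ℝ) :
    modelDeriv 𝓘(ℝ, ℝ) (𝓡 d) (fun t : ℝ => T.act (t • v) x) t 1
      = T.velocity v (T.act (t • v) x) := by
  have H := modelDeriv_comp_apply (I := 𝓘(ℝ, ℝ)) (J := 𝓘(ℝ, ℝ)) (K := 𝓡 d)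
    (g := fun r : ℝ => T.act (r • v) (T.act (t • v) x)) (f := fun r => r - t) (x := t)
    ((T.contMDiff_flow v _).mdifferentiable (by simp) _)
    ((differentiable_id.sub_const t).mdifferentiable _) 1
  rw [modelDeriv_eq_fderiv, fderiv_sub_const, fderiv_fun_id, sub_self,
    ContinuousLinearMap.id_apply, ← velocity_eq] at H
  simp only [← T.act_add, ← add_smul, sub_add_cancel] at H
  exact H

theorem isMIntegralCurve_of_modelDeriv {γ : ℝ → M} (hγ : ContMDiff 𝓘(ℝ, ℝ) (𝓡 d) ∞ γ)
    {X : VField d M} (h : ∀ t, modelDeriv 𝓘(ℝ, ℝ) (𝓡 d) γ t 1 = X (γ t)) :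
    IsMIntegralCurve (I := 𝓡 d) γ X := by
  intro t
  have h₁ := (hγ.mdifferentiable (by simp) t).hasMFDerivAt
  have h₂ : mfderiv 𝓘(ℝ, ℝ) (𝓡 d) γ t = (1 : ℝ →L[ℝ] ℝ).smulRight (X (γ t)) :=
    ContinuousLinearMap.ext_ring ((h t).trans (one_smul ℝ (X (γ t))).symm)
  rwa [h₂] at h₁

theorem rot_eq_act_smul (θ : ℝ) (x : M) :
    A.rot θ x = A.act (θ • fun _ => 1) x :=
  congrArg (fun v => A.act v x) (funext fun _ => (mul_one θ).symm)

variable [T2Space M] [IsManifold (𝓡 d) ∞ M]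

theorem curve_eq_of_modelDeriv {γ γ' : ℝ → M} (hγ : ContMDiff 𝓘(ℝ, ℝ) (𝓡 d) ∞ γ)
    (hγ' : ContMDiff 𝓘(ℝ, ℝ) (𝓡 d) ∞ γ') {X : VField d M} (hX : SmoothVField X) (c : ℝ)
    (h : ∀ t, modelDeriv 𝓘(ℝ, ℝ) (𝓡 d) γ t 1 = c • VField.toModel X (γ t))
    (h' : ∀ t, modelDeriv 𝓘(ℝ, ℝ) (𝓡 d) γ' t 1 = c • VField.toModel X (γ' t))
    (h₀ : γ 0 = γ' 0) : γ = γ' := by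
  have : IsManifold (𝓡 d) 1 M := IsManifold.of_le (n := ∞) (by simp)
  have hcX : SmoothVField (fun x => c • X x) := contMDiff_const.smul_section hX
  exact isMIntegralCurve_Ioo_eq_of_contMDiff_boundaryless (t₀ := 0) (hcX.of_le (by simp))
    (isMIntegralCurve_of_modelDeriv hγ h) (isMIntegralCurve_of_modelDeriv hγ' h') h₀

end Flows

section Reeb

variable {k n : ℕ} {M : Type*} [TopologicalSpace M]
  [ChartedSpace (EuclideanSpace ℝ (Fin (2 * n + 1))) M] [IsManifold (𝓡 (2 * n + 1)) ∞ M]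
  {S : SasakianStructure n M} {A : TorusAction 1 (2 * n + 1) M} {τ : ℝ}
  {T : TorusAction k (2 * n + 1) M}

theorem IsReebCircle.velocity (hA : A.IsReebCircle S τ) (x : M) :
    A.velocity (fun _ => 1) x = τ • S.reeb x := hA.2 x

/-- The torus element preserves ξ, so both sides are integral curves of τξ through the same point.
-/
theorem act_rot_comm [T2Space M] (hA : A.IsReebCircle S τ) (hT : ∀ v, S.IsPreservedBy (T.act v))
    (v : Fin k → ℝ) (θ : ℝ) (x : M) : T.act v (A.rot θ x) = A.rot θ (T.act v x) := by
  have h : (fun t : ℝ => T.act v (A.act (t • fun _ => 1) x))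
      = fun t : ℝ => A.act (t • fun _ => 1) (T.act v x) := by
    refine curve_eq_of_modelDeriv ((T.contMDiff_act v).comp (A.contMDiff_flow _ x))
      (A.contMDiff_flow _ _) S.smooth_ξ τ (fun t => ?_) (fun t => ?_) ?_
    · refine (modelDeriv_comp_apply (f := fun t : ℝ => A.act (t • fun _ => 1) x)
        (T.mdifferentiable_act v _) ((A.contMDiff_flow _ x).mdifferentiable (by simp) t) 1).trans ?_
      rw [A.modelDeriv_flow, hA.velocity, map_smul]
      exact congrArg (fun z : EuclideanSpace ℝ (Fin (2 * n + 1)) => τ • z) ((hT v).map_ξ _)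
    · rw [A.modelDeriv_flow, hA.velocity]
      rfl
    · simp only [zero_smul, A.act_zero]
  simpa only [rot_eq_act_smul] using congrFun h θ

/-- Uniqueness of integral curves again. A full rotation takes Reeb time τ, whence the factor a/τ.
-/
theorem act_smul_eq_rot [T2Space M] (hA : A.IsReebCircle S τ) {u : Fin k → ℝ} {a : ℝ}
    (hu : ∀ x, T.velocity u x = a • S.reeb x) (t : ℝ) (x : M) :
    T.act (t • u) x = A.rot (t * (a / τ)) x := by
  have h : (fun t : ℝ => T.act (t • u) x) = fun t : ℝ => A.act (t • (a / τ) • fun _ => 1) x := by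
    refine curve_eq_of_modelDeriv (T.contMDiff_flow _ x) (A.contMDiff_flow _ x) S.smooth_ξ a
      (fun t => ?_) (fun t => ?_) ?_
    · rw [T.modelDeriv_flow, hu]
      rfl
    · rw [A.modelDeriv_flow, A.velocity_smul, hA.velocity, smul_smul, div_mul_cancel₀ _ hA.1.ne']
      rfl
    · simp only [zero_smul, A.act_zero, T.act_zero]
  rw [rot_eq_act_smul, ← smul_smul]
  exact congrFun h t

theorem IsReebCircle.velocity_ne_zero (hA : A.IsReebCircle S τ) (x : M) :
    A.velocity (fun _ => 1) x ≠ 0 := by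
  rw [hA.velocity]
  refine smul_ne_zero hA.1.ne' fun h => ?_
  have := S.η_ξ x
  rw [show S.ξ x = 0 from h, map_zero] at this
  exact zero_ne_one this

theorem velocity_ne_zero_of_mem_sasakiCone {w : Fin k → ℝ} (hw : w ∈ T.sasakiCone S) (x : M) :
    T.velocity w x ≠ 0 := fun h => by
  have := hw x
  rw [show T.gen w x = 0 from h, map_zero] at this
  exact lt_irrefl _ this

end Reeb

end TorusAction

/-! ## The actions defined by the flows -/

namespace TorusAction

section Rotations

variable {k d : ℕ} {M : Type*} [TopologicalSpace M] [ChartedSpace (EuclideanSpace ℝ (Fin d)) M]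
  (T : TorusAction k d M) (A : TorusAction 1 d M)

theorem rot_add (s t : ℝ) (x : M) : A.rot (s + t) x = A.rot s (A.rot t x) :=
  (A.rot_rot s t x).symm

theorem rot_intCast (n : ℤ) (x : M) : A.rot n x = x :=
  (A.ker _).2 (fun _ => ⟨n, rfl⟩) x

theorem exists_eq_intCast_of_rot_eq {t : ℝ} (h : ∀ x, A.rot t x = x) : ∃ n : ℤ, t = n :=
  (A.ker _).1 h 0

theorem rot_sub_intCast (t : ℝ) (n : ℤ) (x : M) : A.rot (t - n) x = A.rot t x := by
  rw [sub_eq_add_neg, rot_add, ← Int.cast_neg, rot_intCast]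

theorem act_intCast_mul_smul {w : Fin k → ℝ} {P : ℝ} (hP : ∀ x, T.act (P • w) x = x) (n : ℤ)
    (x : M) : T.act ((n * P) • w) x = x := by
  induction n using Int.induction_on with
  | zero => rw [Int.cast_zero, zero_mul, zero_smul, T.act_zero]
  | succ n ih =>
    rw [Int.cast_add, add_mul, add_smul, T.act_add, Int.cast_one, one_mul, hP]
    exact ih
  | pred n ih =>
    rw [← hP (T.act _ x), ← T.act_add, ← add_smul]
    convert ih using 3
    push_cast
    ring

theorem act_fract_smul {w : Fin k → ℝ} {P : ℝ} (hP₀ : 0 < P) (hP : ∀ x, T.act (P • w) x = x)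
    (t : ℝ) (x : M) : T.act ((Int.fract (t / P) * P) • w) x = T.act (t • w) x := by
  have : t • w = (Int.fract (t / P) * P) • w + ((⌊t / P⌋ : ℝ) * P) • w := by
    rw [← add_smul, ← add_mul, Int.fract_add_floor, div_mul_cancel₀ _ hP₀.ne']
  rw [this, T.act_add, T.act_intCast_mul_smul hP]

theorem fract_mul_mem_Icc {P : ℝ} (hP : 0 < P) (t : ℝ) : Int.fract (t / P) * P ∈ Icc 0 P :=
  ⟨mul_nonneg (Int.fract_nonneg _) hP.le,
    (mul_le_mul_of_nonneg_right (Int.fract_lt_one _).le hP.le).trans_eq (one_mul P)⟩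

theorem modelDeriv_flow_zero (w : Fin k → ℝ) (x : M) (r : ℝ) :
    modelDeriv 𝓘(ℝ, ℝ) (𝓡 d) (fun t : ℝ => T.act (t • w) x) 0 r = r • T.velocity w x := by
  rw [← velocity_smul, velocity_eq_modelDeriv_orbit]
  exact T.modelDeriv_comp_linear ((1 : ℝ →L[ℝ] ℝ).smulRight w) x r

theorem contMDiff_act_comp {E H P : Type*} [NormedAddCommGroup E] [NormedSpace ℝ E]
    [TopologicalSpace H] {I : ModelWithCorners ℝ E H} [TopologicalSpace P] [ChartedSpace H P]
    {f : P → Fin k → ℝ} {h : P → M} (hf : ContMDiff I 𝓘(ℝ, Fin k → ℝ) ∞ f)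
    (hh : ContMDiff I (𝓡 d) ∞ h) : ContMDiff I (𝓡 d) ∞ (fun p => T.act (f p) (h p)) :=
  T.smooth.comp (hf.prodMk hh)

theorem modelDeriv_act_comp {E H P : Type*} [NormedAddCommGroup E] [NormedSpace ℝ E]
    [TopologicalSpace H] {I : ModelWithCorners ℝ E H} [TopologicalSpace P] [ChartedSpace H P]
    {f : P → Fin k → ℝ} {h : P → M} {p : P} (hf : MDifferentiableAt I 𝓘(ℝ, Fin k → ℝ) f p)
    (hh : MDifferentiableAt I (𝓡 d) h p) (hp : f p = 0) (v : E) :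
    modelDeriv I (𝓡 d) (fun p => T.act (f p) (h p)) p v
      = T.velocity (modelDeriv I 𝓘(ℝ, Fin k → ℝ) f p v) (h p) + modelDeriv I (𝓡 d) h p v := by
  have h₁ : MDifferentiableAt (𝓘(ℝ, Fin k → ℝ).prod (𝓡 d)) (𝓡 d)
    (fun z : (Fin k → ℝ) × M => T.act z.1 z.2) (f p, h p) := T.smooth.mdifferentiable (by simp) _
  refine (modelDeriv_comp_apply (f := fun p => (f p, h p)) h₁ (hf.prodMk hh) v).trans ?_
  have h₀ : (fun z : M => T.act 0 z) = id := funext T.act_zero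
  rw [modelDeriv_prod h₁, modelDeriv_prodMk hf hh, hp, h₀, modelDeriv_id,
    velocity_eq_modelDeriv_orbit]
  rfl

/-- The action of `ℝ × ℤ` by the flow of `w` and by rotations by multiples of `1 / m`. -/
def flowAction (w : Fin k → ℝ) (m : ℕ)
    (hc : ∀ v θ x, T.act v (A.rot θ x) = A.rot θ (T.act v x)) (hw : T.IsPeriodic w)
    (hv : ∀ x, T.velocity w x ≠ 0) (hm : 0 < m) : LocallyFreeAction ℝ (𝓡 d) M where
  act g x := T.act (g.1 • w) (A.rot (g.2 / m) x)
  smooth j := T.contMDiff_act_comp (f := fun p : ℝ × M => p.1 • w)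
    ((contDiff_id.smul contDiff_const).contMDiff.comp contMDiff_fst)
    ((A.contMDiff_act fun _ => (j : ℝ) / m).comp contMDiff_snd)
  act_zero x := by
    rw [Prod.fst_zero, Prod.snd_zero, zero_smul, T.act_zero, Int.cast_zero, zero_div, A.rot_zero]
  act_add g h x := by
    rw [Prod.fst_add, Prod.snd_add, Int.cast_add, add_div, add_smul, T.act_add, rot_add, hc, hc]
  cocompact := by
    obtain ⟨P, hP₀, hP⟩ := hw
    have hm' : (m : ℝ) ≠ 0 := Nat.cast_ne_zero.2 hm.ne'
    -- The flow parameter matters only modulo the period and the integer only modulo `m`.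
    refine ⟨Icc 0 P ×ˢ Icc 0 (m : ℤ), isCompact_Icc.prod (finite_Icc _ _).isCompact,
      fun g => ⟨(Int.fract (g.1 / P) * P, g.2 % m), ⟨fract_mul_mem_Icc hP₀ _,
        Int.emod_nonneg _ (by omega), (Int.emod_lt_of_pos _ (by omega)).le⟩, funext fun x => ?_⟩⟩
    have : (g.2 : ℝ) / m = ((g.2 % m : ℤ) : ℝ) / m + ((g.2 / m : ℤ) : ℝ) := by
      rw [div_add' _ _ _ hm']
      congr 1
      exact_mod_cast (Int.emod_add_ediv_mul g.2 m).symm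
    simp only [T.act_fract_smul hP₀ hP]
    rw [this, rot_add, A.rot_intCast]
  free x t t' h := by
    have h' : modelDeriv 𝓘(ℝ, ℝ) (𝓡 d) (fun t : ℝ => T.act (t • w) (A.rot (((0 : ℤ) : ℝ) / m) x)) 0 t
      = modelDeriv 𝓘(ℝ, ℝ) (𝓡 d) (fun t : ℝ => T.act (t • w) (A.rot (((0 : ℤ) : ℝ) / m) x)) 0 t' := h
    rw [modelDeriv_flow_zero, modelDeriv_flow_zero] at h'
    exact smul_left_injective ℝ (hv _) h'

theorem flowAction_orbitDeriv {w : Fin k → ℝ} {m : ℕ}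
    (hc : ∀ v θ x, T.act v (A.rot θ x) = A.rot θ (T.act v x)) (hw : T.IsPeriodic w)
    (hv : ∀ x, T.velocity w x ≠ 0) (hm : 0 < m) (x : M) (r : ℝ) :
    (flowAction T A w m hc hw hv hm).orbitDeriv x r = r • T.velocity w x := by
  change modelDeriv 𝓘(ℝ, ℝ) (𝓡 d)
    (fun t : ℝ => T.act (t • w) (A.rot (((0 : ℤ) : ℝ) / m) x)) 0 r = r • T.velocity w x
  rw [modelDeriv_flow_zero, Int.cast_zero, zero_div, A.rot_zero]

theorem flowAction_vertical {w : Fin k → ℝ} {m : ℕ}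
    (hc : ∀ v θ x, T.act v (A.rot θ x) = A.rot θ (T.act v x)) (hw : T.IsPeriodic w)
    (hv : ∀ x, T.velocity w x ≠ 0) (hm : 0 < m) :
    (flowAction T A w m hc hw hv hm).vertical = fun x => Submodule.span ℝ {T.gen w x} := by
  funext x
  ext z
  rw [Submodule.mem_span_singleton]
  exact exists_congr fun r =>
    Eq.congr_left (T.flowAction_orbitDeriv A hc hw hv hm x r)

theorem contMDiff_rot_mul_snd (c : ℝ) (y : M) (r : ℝ × ℝ) :
    ContMDiff 𝓘(ℝ, ℝ × ℝ) (𝓡 d) ∞ (fun t : ℝ × ℝ => A.rot (c * t.2) y) ∧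
      modelDeriv 𝓘(ℝ, ℝ × ℝ) (𝓡 d) (fun t : ℝ × ℝ => A.rot (c * t.2) y) 0 r
        = (c * r.2) • A.velocity (fun _ => 1) y := by
  let f : ℝ × ℝ →L[ℝ] (Fin 1 → ℝ) :=
    (c • ContinuousLinearMap.snd ℝ ℝ ℝ).smulRight (fun _ => (1 : ℝ))
  have hf : (fun t : ℝ × ℝ => A.rot (c * t.2) y) = fun t => A.act (f t) y := by
    funext t
    exact A.rot_eq_act_smul _ _
  rw [hf]
  refine ⟨(A.contMDiff_orbit y).comp f.contMDiff, ?_⟩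
  rw [A.modelDeriv_comp_linear, ← velocity_eq_modelDeriv_orbit, ← velocity_smul]
  rfl

end Rotations

section JoinAction

variable {k d d' : ℕ} {M B : Type*} [TopologicalSpace M]
  [ChartedSpace (EuclideanSpace ℝ (Fin d)) M] [TopologicalSpace B]
  [ChartedSpace (EuclideanSpace ℝ (Fin d')) B]
  (T : TorusAction k d M) (A : TorusAction 1 d M) (A' : TorusAction 1 d' B)

theorem modelDeriv_joinAction (w : Fin k → ℝ) (a b : ℝ) (z : M × B) (r : ℝ × ℝ) :
    modelDeriv 𝓘(ℝ, ℝ × ℝ) ((𝓡 d).prod (𝓡 d'))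
        (fun t : ℝ × ℝ => (T.act (t.1 • w) (A.rot (a * t.2) z.1), A'.rot (b * t.2) z.2)) 0 r
      = (r.1 • T.velocity w z.1 + (a * r.2) • A.velocity (fun _ => 1) z.1,
        (b * r.2) • A'.velocity (fun _ => 1) z.2) := by
  obtain ⟨h₁, h₁'⟩ := A.contMDiff_rot_mul_snd a z.1 r
  obtain ⟨h₂, h₂'⟩ := A'.contMDiff_rot_mul_snd b z.2 r
  let f : ℝ × ℝ →L[ℝ] (Fin k → ℝ) := (ContinuousLinearMap.fst ℝ ℝ ℝ).smulRight w
  have h₃ := T.contMDiff_act_comp (f := f) f.contMDiff h₁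
  refine (modelDeriv_prodMk (h₃.mdifferentiable (by simp) 0)
    (h₂.mdifferentiable (by simp) 0) r).trans ?_
  rw [h₂', T.modelDeriv_act_comp f.mdifferentiableAt (h₁.mdifferentiable (by simp) 0) (map_zero f),
    h₁', modelDeriv_eq_fderiv, ContinuousLinearMap.fderiv, Prod.snd_zero, mul_zero, A.rot_zero]
  have h : T.velocity (f r) z.1 = r.1 • T.velocity w z.1 := T.velocity_smul r.1 w z.1
  rw [h]

/-- The action on `M × B` by the flow of `w` on `M` and by the rotations
`(A(p θ), A'(-q θ))`. -/
def joinAction (w : Fin k → ℝ) (p q : ℕ)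
    (hc : ∀ v θ x, T.act v (A.rot θ x) = A.rot θ (T.act v x)) (hw : T.IsPeriodic w)
    (hv : ∀ x, T.velocity w x ≠ 0) (hv' : ∀ y, A'.velocity (fun _ => 1) y ≠ 0) (hq : 0 < q) :
    LocallyFreeAction (ℝ × ℝ) ((𝓡 d).prod (𝓡 d')) (M × B) where
  -- The ℤ coordinate `g.2` acts trivially here.
  act g z := (T.act (g.1.1 • w) (A.rot (p * g.1.2) z.1), A'.rot (-q * g.1.2) z.2)
  smooth j := (T.contMDiff_act_comp (f := fun z : (ℝ × ℝ) × (M × B) => z.1.1 • w)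
      ((contDiff_fst.smul contDiff_const).contMDiff.comp contMDiff_fst)
      (A.contMDiff_act_comp (f := fun z : (ℝ × ℝ) × (M × B) => fun _ => p * z.1.2)
        ((contDiff_pi.2 fun _ => contDiff_const.mul contDiff_snd).contMDiff.comp contMDiff_fst)
        (contMDiff_fst.comp contMDiff_snd))).prodMk
    (A'.contMDiff_act_comp (f := fun z : (ℝ × ℝ) × (M × B) => fun _ => -q * z.1.2)
        ((contDiff_pi.2 fun _ => contDiff_const.mul contDiff_snd).contMDiff.comp contMDiff_fst)
        (contMDiff_snd.comp contMDiff_snd))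
  act_zero z := by
    simp [T.act_zero, rot_zero]
  act_add g h z := by
    simp only [Prod.fst_add, Prod.snd_add, mul_add, add_smul, T.act_add, rot_add, hc]
  cocompact := by
    obtain ⟨P, hP₀, hP⟩ := hw
    refine ⟨(Icc 0 P ×ˢ Icc 0 1) ×ˢ {0}, (isCompact_Icc.prod isCompact_Icc).prod isCompact_singleton,
      fun g => ⟨((Int.fract (g.1.1 / P) * P, Int.fract g.1.2), 0), ⟨⟨fract_mul_mem_Icc hP₀ _,
        Int.fract_nonneg _, (Int.fract_lt_one _).le⟩, rfl⟩, funext fun z => ?_⟩⟩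
    have h₁ : (p : ℝ) * Int.fract g.1.2 = p * g.1.2 - ((p * ⌊g.1.2⌋ : ℤ) : ℝ) := by
      rw [Int.fract]
      push_cast
      ring
    have h₂ : -(q : ℝ) * Int.fract g.1.2 = -q * g.1.2 - ((-q * ⌊g.1.2⌋ : ℤ) : ℝ) := by
      rw [Int.fract]
      push_cast
      ring
    simp only [T.act_fract_smul hP₀ hP, h₁, h₂, rot_sub_intCast]
  free z r r' h := by
    have h' := ((T.modelDeriv_joinAction A A' w p (-q) z r).symm.trans h).trans
      (T.modelDeriv_joinAction A A' w p (-q) z r')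
    have hq' : -(q : ℝ) ≠ 0 := neg_ne_zero.2 (Nat.cast_ne_zero.2 hq.ne')
    -- The component in `B` sees only the rotation parameter and determines it because q ≠ 0; the
    -- flow parameter is then read off in `M`.
    have e₂ : r.2 = r'.2 :=
      mul_left_cancel₀ hq' (smul_left_injective ℝ (hv' z.2) (congrArg Prod.snd h'))
    have e₁ := congrArg Prod.fst h'
    simp only [e₂, add_left_inj] at e₁
    exact Prod.ext (smul_left_injective ℝ (hv z.1) e₁) e₂

variable {T A A'} in
theorem joinAction_orbitDeriv {w : Fin k → ℝ} {p q : ℕ}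
    (hc : ∀ v θ x, T.act v (A.rot θ x) = A.rot θ (T.act v x)) (hw : T.IsPeriodic w)
    (hv : ∀ x, T.velocity w x ≠ 0) (hv' : ∀ y, A'.velocity (fun _ => 1) y ≠ 0) (hq : 0 < q)
    (z : M × B) (r : ℝ × ℝ) :
    (joinAction T A A' w p q hc hw hv hv' hq).orbitDeriv z r
      = (r.1 • T.velocity w z.1 + (p * r.2) • A.velocity (fun _ => 1) z.1,
        (-q * r.2) • A'.velocity (fun _ => 1) z.2) :=
  T.modelDeriv_joinAction A A' w p (-q) z r

end JoinAction

end TorusAction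

/-! ## The orbit spaces of the flows -/

namespace TorusAction

section OrbitMaps

variable {k d : ℕ} {M : Type*} [TopologicalSpace M] [ChartedSpace (EuclideanSpace ℝ (Fin d)) M]
  (T : TorusAction k d M) (A : TorusAction 1 d M)

theorem act_rot_comm_self (v : Fin 1 → ℝ) (θ : ℝ) (x : M) :
    A.act v (A.rot θ x) = A.rot θ (A.act v x) := by
  rw [rot, ← A.act_add, add_comm, A.act_add]

theorem isPeriodic_one : A.IsPeriodic (fun _ => 1) :=
  ⟨1, one_pos, fun x => by
    rw [← rot_eq_act_smul]
    exact_mod_cast A.rot_intCast 1 x⟩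

/-- The circle action, as a locally free action of `ℝ × ℤ`. -/
def circleAction (hv : ∀ x, A.velocity (fun _ => 1) x ≠ 0) : LocallyFreeAction ℝ (𝓡 d) M :=
  flowAction A A (fun _ => 1) 1 A.act_rot_comm_self A.isPeriodic_one hv one_pos

theorem circleAction_act (hv : ∀ x, A.velocity (fun _ => 1) x ≠ 0) (g : ℝ × ℤ) (x : M) :
    (A.circleAction hv).act g x = A.rot g.1 x := by
  change A.act (g.1 • fun _ => 1) (A.rot (g.2 / (1 : ℕ)) x) = _
  rw [Nat.cast_one, div_one, rot_intCast, rot_eq_act_smul]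

theorem isOrbitMap_circleQuotient (hv : ∀ x, A.velocity (fun _ => 1) x ≠ 0) :
    (A.circleAction hv).IsOrbitMap (Quotient.mk (A.orbitSetoid fun _ => 1)) := by
  refine .of_isQuotientMap _ isQuotientMap_quotient_mk' fun x y => ?_
  simp only [circleAction_act, rot_eq_act_smul]
  exact Quotient.eq.trans ⟨fun ⟨t, ht⟩ => ⟨(t, 0), ht⟩, fun ⟨g, hg⟩ => ⟨g.1, hg⟩⟩

/-- The projection of `M` to `N / ℤ_m`, where `N` is the quotient by the flow of `w`. -/
def cyclicMk (w : Fin k → ℝ) (m : ℕ) (x : M) : CyclicQuotient A T w m :=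
  Quot.mk _ (Quotient.mk (T.orbitSetoid w) x)

variable {T A}

/-- Commutation with the rotations makes the relation on N defining N/ℤ_m an equivalence relation
already, so no zigzags are needed in the `Quot`. -/
theorem cyclicMk_eq_iff {w : Fin k → ℝ} {m : ℕ}
    (hc : ∀ v θ x, T.act v (A.rot θ x) = A.rot θ (T.act v x)) (x y : M) :
    T.cyclicMk A w m x = T.cyclicMk A w m y ↔
      ∃ (r : ℝ) (j : ℤ), T.act (r • w) (A.rot (j / m) x) = y := by
  have hr : ∀ {x y : M}, (Quotient.mk (T.orbitSetoid w) x = Quotient.mk (T.orbitSetoid w) y) ↔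
      ∃ r : ℝ, T.act (r • w) x = y := Quotient.eq
  have he : Equivalence (fun a b : T.FlowQuotient w => ∃ (j : ℤ) (x : M),
      a = Quotient.mk (T.orbitSetoid w) x ∧
        b = Quotient.mk (T.orbitSetoid w) (A.rot (j / m) x)) := by
    refine ⟨fun a => ?_, ?_, ?_⟩
    · obtain ⟨x, rfl⟩ := Quotient.exists_rep a
      exact ⟨0, x, rfl, by rw [Int.cast_zero, zero_div, rot_zero]⟩
    · rintro _ _ ⟨j, x, rfl, rfl⟩
      refine ⟨-j, _, rfl, ?_⟩
      rw [rot_rot, Int.cast_neg, neg_div, neg_add_cancel, rot_zero]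
    · rintro _ _ _ ⟨j, x, rfl, rfl⟩ ⟨j', y, h, rfl⟩
      obtain ⟨r, rfl⟩ := hr.1 h
      refine ⟨j' + j, x, rfl, ?_⟩
      rw [← hc, rot_rot, Int.cast_add, add_div, eq_comm, hr]
      exact ⟨r, rfl⟩
  refine (he.quot_mk_eq_iff _ _).trans ⟨?_, ?_⟩
  · rintro ⟨j, z, h, h'⟩
    obtain ⟨r, rfl⟩ := hr.1 h
    obtain ⟨r', rfl⟩ := hr.1 h'.symm
    refine ⟨r' + r, j, ?_⟩
    rw [add_smul, T.act_add, hc (r • w)]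
  · rintro ⟨r, j, rfl⟩
    exact ⟨j, x, rfl, (hr.2 ⟨r, rfl⟩).symm⟩

theorem isOrbitMap_cyclicMk {w : Fin k → ℝ} {m : ℕ}
    (hc : ∀ v θ x, T.act v (A.rot θ x) = A.rot θ (T.act v x)) (hw : T.IsPeriodic w)
    (hv : ∀ x, T.velocity w x ≠ 0) (hm : 0 < m) :
    (flowAction T A w m hc hw hv hm).IsOrbitMap (T.cyclicMk A w m) :=
  .of_isQuotientMap _ (isQuotientMap_quot_mk.comp isQuotientMap_quotient_mk') fun x y =>
    (cyclicMk_eq_iff hc x y).trans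
      ⟨fun ⟨r, j, h⟩ => ⟨(r, j), h⟩, fun ⟨g, h⟩ => ⟨g.1, g.2, h⟩⟩

variable (A) in
/-- Slices for a circle action. -/
theorem exists_circle_slice [T2Space M] [ConnectedSpace M] [IsManifold (𝓡 d) ∞ M]
    (hv : ∀ x, A.velocity (fun _ => 1) x ≠ 0) {e : ℕ} (hd : d = 1 + e) (y : M) :
    ∃ (c : OrbChart e A.CircleQuotient) (s : c.U → M), c ∈ flowQuotientCharts A (fun _ => 1) e ∧
      (∀ u, Quotient.mk (A.orbitSetoid fun _ => 1) (s u) = c.φ u) ∧ (∃ u, s u = y) ∧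
      ContMDiff (𝓡 e) (𝓡 d) ∞ s ∧ (∀ u, (A.circleAction hv).Transverse (𝓡 e) s u) ∧
      (∀ γ : c.Γ, ∃ t, ∀ u, A.rot t (s u) = s ((γ : Equiv.Perm c.U) u)) ∧
      (∀ t u u', A.rot t (s u) = s u' →
        ∃ γ : c.Γ, ∀ u, A.rot t (s u) = s ((γ : Equiv.Perm c.U) u)) ∧
      (∀ t, (∀ u, A.rot t (s u) = s u) → ∃ n : ℤ, t = n) ∧ Function.Injective s := by
  obtain ⟨c, s, hcm, hφ, ⟨u₀, hu₀⟩, hs, ht, h₁, h₂, h₃, hi⟩ :=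
    (A.circleAction hv).exists_slice_chart (A.isOrbitMap_circleQuotient hv) y (d := e)
      (by simpa using hd)
  refine ⟨c, s, ?_, hφ, ⟨u₀, hu₀⟩, hs, ht, fun γ => ?_, fun t u u' h => ?_, fun t h => ?_, hi⟩
  · rwa [circleAction, flowAction_vertical] at hcm
  · obtain ⟨g, -, hg⟩ := h₁ γ γ.2
    exact ⟨g.1, fun u => by rw [← hg, circleAction_act]⟩
  · have hr : ∀ x, A.rot t x = (A.circleAction hv).act (t, 0) x := fun x =>
      (A.circleAction_act hv (t, 0) x).symm
    obtain ⟨γ, hγ, hγ'⟩ := h₂ (t, 0) (h₃ (t, 0) u u' (by rw [← hr, h]))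
    exact ⟨⟨γ, hγ⟩, fun u => by rw [hr]; exact hγ' u⟩
  · have hr : ∀ x, A.rot t x = (A.circleAction hv).act (t, 0) x := fun x =>
      (A.circleAction_act hv (t, 0) x).symm
    -- A rotation fixing the slice pointwise fixes a neighbourhood, hence all of the connected
    -- manifold; effectiveness makes its angle an integer.
    refine A.exists_eq_intCast_of_rot_eq fun x => ?_
    rw [hr]
    exact LocallyFreeAction.act_eq_self_of_eventually _
      ((A.circleAction hv).eventually_act_eq_self hs (ht u₀) fun u => by rw [← hr, h]) x

end OrbitMaps

section FibreRotation

variable {d : ℕ} {M F : Type*} [TopologicalSpace M] [ChartedSpace (EuclideanSpace ℝ (Fin d)) M]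
  [TopologicalSpace F] (A : TorusAction 1 d M) {qF : M → F}

theorem continuous_rot (t : ℝ) : Continuous (A.rot t) := (A.contMDiff_act _).continuous

/-- The rotation by `t` on a quotient of `M`. -/
def quotientRot (hq : IsQuotientMap qF)
    (hR : ∀ t x y, qF x = qF y → qF (A.rot t x) = qF (A.rot t y)) (t : ℝ) : F ≃ₜ F :=
  have h : ∀ t x, qF (A.rot t (Function.surjInv hq.surjective (qF x))) = qF (A.rot t x) :=
    fun t x => hR t _ _ (Function.surjInv_eq hq.surjective (qF x))
  have hc : ∀ t, Continuous (fun f => qF (A.rot t (Function.surjInv hq.surjective f))) := fun t =>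
    hq.continuous_iff.2 ((hq.continuous.comp (A.continuous_rot t)).congr fun x => (h t x).symm)
  { toFun := fun f => qF (A.rot t (Function.surjInv hq.surjective f))
    invFun := fun f => qF (A.rot (-t) (Function.surjInv hq.surjective f))
    left_inv := fun f => by
      dsimp only
      rw [h, rot_rot, neg_add_cancel, rot_zero, Function.surjInv_eq hq.surjective f]
    right_inv := fun f => by
      dsimp only
      rw [h, rot_rot, add_neg_cancel, rot_zero, Function.surjInv_eq hq.surjective f]
    continuous_toFun := hc t
    continuous_invFun := hc (-t) }

theorem quotientRot_apply (hq : IsQuotientMap qF)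
    (hR : ∀ t x y, qF x = qF y → qF (A.rot t x) = qF (A.rot t y)) (t : ℝ) (x : M) :
    A.quotientRot hq hR t (qF x) = qF (A.rot t x) :=
  hR t _ _ (Function.surjInv_eq hq.surjective (qF x))

theorem quotientRot_add (hq : IsQuotientMap qF)
    (hR : ∀ t x y, qF x = qF y → qF (A.rot t x) = qF (A.rot t y)) (s t : ℝ) :
    A.quotientRot hq hR (s + t) = A.quotientRot hq hR s * A.quotientRot hq hR t := by
  ext f
  obtain ⟨x, rfl⟩ := hq.surjective f
  change A.quotientRot hq hR (s + t) (qF x) = A.quotientRot hq hR s (A.quotientRot hq hR t (qF x))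
  simp only [quotientRot_apply, rot_add]

end FibreRotation

end TorusAction

/-! ## The fibration of the quotient of a product -/

/-- The matrix is block triangular: the second component determines t and u', after which the
off-diagonal term in `b` is known and the first component determines r and u. It shows that
transversals in the two factors combine to a transversal for the action on the product. -/
theorem bijective_triangular {E₁ E₁' E₂ E₂' : Type*} [AddCommGroup E₁] [Module ℝ E₁]
    [AddCommGroup E₁'] [Module ℝ E₁'] [AddCommGroup E₂] [Module ℝ E₂] [AddCommGroup E₂']
    [Module ℝ E₂'] {D : E₁' →ₗ[ℝ] E₁} {D' : E₂' →ₗ[ℝ] E₂} {a b : E₁} {a' : E₂} {p q : ℝ}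
    (hq : q ≠ 0) (h : Function.Bijective fun v : ℝ × E₁' => v.1 • a + D v.2)
    (h' : Function.Bijective fun v : ℝ × E₂' => v.1 • a' + D' v.2) :
    Function.Bijective fun v : (ℝ × ℝ) × (E₂' × E₁') =>
      ((v.1.1 • a + (p * v.1.2) • b, (q * v.1.2) • a') + (D v.2.2, D' v.2.1) : E₁ × E₂) := by
  constructor
  · rintro ⟨⟨r, t⟩, u', u⟩ ⟨⟨r₀, t₀⟩, u₀', u₀⟩ H
    obtain ⟨H₁, H₂⟩ := Prod.mk.inj H
    obtain ⟨ht, hu'⟩ := Prod.mk.inj (@h'.1 (q * t, u') (q * t₀, u₀') H₂)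
    have ht' : t = t₀ := mul_left_cancel₀ hq ht
    dsimp only at H₁
    rw [ht', add_right_comm, add_right_comm (r₀ • a), add_left_inj] at H₁
    obtain ⟨hr, hu⟩ := Prod.mk.inj (@h.1 (r, u) (r₀, u₀) H₁)
    rw [hr, ht', hu, show u' = u₀' from hu']
  · rintro ⟨z₁, z₂⟩
    obtain ⟨⟨t, u'⟩, ht⟩ := h'.2 z₂
    obtain ⟨⟨r, u⟩, hr⟩ := h.2 (z₁ - (p * (t / q)) • b)
    refine ⟨((r, t / q), u', u), Prod.ext ?_ ?_⟩
    · change r • a + (p * (t / q)) • b + D u = z₁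
      rw [add_right_comm, eq_sub_iff_add_eq.1 hr]
    · change (q * (t / q)) • a' + D' u' = z₂
      rw [mul_div_cancel₀ _ hq]
      exact ht

namespace TorusAction

section Fibration

variable {k d d' : ℕ} {M B : Type*} [TopologicalSpace M]
  [ChartedSpace (EuclideanSpace ℝ (Fin d)) M] [TopologicalSpace B]
  [ChartedSpace (EuclideanSpace ℝ (Fin d')) B]
  {T : TorusAction k d M} {A : TorusAction 1 d M} {A' : TorusAction 1 d' B} {w : Fin k → ℝ}
  {p q : ℕ}

theorem transverse_joinAction {e e' : ℕ} {P P' : Type*} [TopologicalSpace P]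
    [ChartedSpace (EuclideanSpace ℝ (Fin e)) P] [TopologicalSpace P']
    [ChartedSpace (EuclideanSpace ℝ (Fin e')) P']
    (hc : ∀ v θ x, T.act v (A.rot θ x) = A.rot θ (T.act v x)) (hw : T.IsPeriodic w)
    (hv : ∀ x, T.velocity w x ≠ 0) (hv' : ∀ y, A'.velocity (fun _ => 1) y ≠ 0) (hq : 0 < q)
    {σ : P → M} {s : P' → B} {u : P' × P} (hσ : MDifferentiableAt (𝓡 e) (𝓡 d) σ u.2)
    (hs : MDifferentiableAt (𝓡 e') (𝓡 d') s u.1)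
    (hσt : (flowAction T A w q hc hw hv hq).Transverse (𝓡 e) σ u.2)
    (hst : (A'.circleAction hv').Transverse (𝓡 e') s u.1) :
    (joinAction T A A' w p q hc hw hv hv' hq).Transverse ((𝓡 e').prod (𝓡 e))
      (fun z : P' × P => (σ z.2, s z.1)) u := by
  have h₁ := (LocallyFreeAction.bijective_add_iff ((flowAction T A w q hc hw hv hq).free _)).2 hσt
  have h₂ := (LocallyFreeAction.bijective_add_iff ((A'.circleAction hv').free _)).2 hst
  have e₁ := T.flowAction_orbitDeriv A hc hw hv hq (σ u.2)
  have e₂ := A'.flowAction_orbitDeriv A' A'.act_rot_comm_self A'.isPeriodic_one hv' one_pos (s u.1)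
  have hd : ∀ v, modelDeriv ((𝓡 e').prod (𝓡 e)) ((𝓡 d).prod (𝓡 d'))
      (fun z : P' × P => (σ z.2, s z.1)) u v
        = (modelDeriv (𝓡 e) (𝓡 d) σ u.2 v.2, modelDeriv (𝓡 e') (𝓡 d') s u.1 v.1) := fun v => by
    have hσ' : MDifferentiableAt ((𝓡 e').prod (𝓡 e)) (𝓡 d) (fun z : P' × P => σ z.2) u :=
      MDifferentiableAt.comp u (f := Prod.snd) hσ mdifferentiableAt_snd
    have hs' : MDifferentiableAt ((𝓡 e').prod (𝓡 e)) (𝓡 d') (fun z : P' × P => s z.1) u :=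
      MDifferentiableAt.comp u (f := Prod.fst) hs mdifferentiableAt_fst
    refine (modelDeriv_prodMk hσ' hs' v).trans (Prod.ext ?_ ?_)
    · refine (modelDeriv_comp_apply (f := Prod.snd) hσ mdifferentiableAt_snd v).trans ?_
      rw [modelDeriv_snd]
      rfl
    · refine (modelDeriv_comp_apply (f := Prod.fst) hs mdifferentiableAt_fst v).trans ?_
      rw [modelDeriv_fst]
      rfl
  refine (LocallyFreeAction.bijective_add_iff
    ((joinAction T A A' w p q hc hw hv hv' hq).free (σ u.2, s u.1))).1 ?_
  have hq' : -(q : ℝ) ≠ 0 := neg_ne_zero.2 (Nat.cast_ne_zero.2 hq.ne')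
  have h₃ : Function.Bijective fun v : ℝ × EuclideanSpace ℝ (Fin e) =>
      v.1 • T.velocity w (σ u.2) + (modelDeriv (𝓡 e) (𝓡 d) σ u.2).toLinearMap v.2 := by
    simp only [← e₁]
    exact h₁
  have h₄ : Function.Bijective fun v : ℝ × EuclideanSpace ℝ (Fin e') =>
      v.1 • A'.velocity (fun _ => 1) (s u.1)
        + (modelDeriv (𝓡 e') (𝓡 d') s u.1).toLinearMap v.2 := by
    simp only [← e₂]
    exact h₂
  have h₅ := bijective_triangular (p := p) (b := A.velocity (fun _ => 1) (σ u.2)) hq' h₃ h₄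
  convert h₅ using 2 with v
  exact congrArg₂ (· + ·) (joinAction_orbitDeriv hc hw hv hv' hq (σ u.2, s u.1) v.1) (hd v.2)

theorem cyclicMk_rot {hc : ∀ v θ x, T.act v (A.rot θ x) = A.rot θ (T.act v x)} (t : ℝ) (x y : M)
    (h : T.cyclicMk A w q x = T.cyclicMk A w q y) :
    T.cyclicMk A w q (A.rot t x) = T.cyclicMk A w q (A.rot t y) := by
  rw [cyclicMk_eq_iff hc] at h ⊢
  obtain ⟨r, j, rfl⟩ := h
  exact ⟨r, j, by rw [← hc, rot_rot, rot_rot, add_comm]⟩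

/-- Two points of `M × B` lie on one orbit when a rotation of `B` relates their components in `B`
and the corresponding rotation of `N / ℤ_q` the images of their components in `M`. -/
theorem joinAction_rel_iff (hpq : Nat.Coprime p q)
    (hc : ∀ v θ x, T.act v (A.rot θ x) = A.rot θ (T.act v x)) (hw : T.IsPeriodic w)
    (hv : ∀ x, T.velocity w x ≠ 0) (hv' : ∀ y, A'.velocity (fun _ => 1) y ≠ 0) (hq : 0 < q)
    (z z' : M × B) :
    (∃ g, (joinAction T A A' w p q hc hw hv hv' hq).act g z = z') ↔
      ∃ t, T.cyclicMk A w q (A.rot (-(p / q) * t) z.1) = T.cyclicMk A w q z'.1 ∧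
        A'.rot t z.2 = z'.2 := by
  have hq' : (q : ℝ) ≠ 0 := Nat.cast_ne_zero.2 hq.ne'
  constructor
  · rintro ⟨⟨⟨r, θ⟩, i⟩, rfl⟩
    refine ⟨-q * θ, (cyclicMk_eq_iff hc _ _).2 ⟨r, 0, ?_⟩, rfl⟩
    rw [Int.cast_zero, zero_div, rot_zero]
    change T.act _ _ = T.act _ (A.rot (p * θ) z.1)
    congr 2
    field_simp
  · rintro ⟨t, h₁, h₂⟩
    obtain ⟨r, j, h₁⟩ := (cyclicMk_eq_iff hc _ _).1 h₁
    -- The angle θ must satisfy -qθ ≡ t and pθ ≡ j/q - (p/q)t modulo ℤ. With a p + b q = 1, the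
    -- choice θ = (j a - t)/q works, with integer errors j a and j b.
    obtain ⟨a, b, hab⟩ : IsCoprime (p : ℤ) q := Nat.isCoprime_iff_coprime.2 hpq
    have hab' : (a * p + b * q : ℝ) = 1 := by exact_mod_cast hab
    refine ⟨((r, (j * a - t) / q), 0), Prod.ext ?_ ?_⟩
    · refine Eq.trans ?_ h₁
      change T.act (r • w) (A.rot (p * ((j * a - t) / q)) z.1) = _
      rw [rot_rot, ← A.rot_sub_intCast (_ + _) (j * b)]
      congr 2
      push_cast
      field_simp
      linear_combination (j : ℝ) * hab'
    · refine Eq.trans ?_ h₂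
      change A'.rot (-q * ((j * a - t) / q)) z.2 = _
      rw [← A'.rot_sub_intCast t (j * a)]
      congr 1
      push_cast
      field_simp
      ring

end Fibration

end TorusAction

/-! ## The orbibundle -/

namespace TorusAction

section Orbibundle

variable {k d d' : ℕ} {M B Z : Type*} [TopologicalSpace M] [T2Space M] [CompactSpace M]
  [ChartedSpace (EuclideanSpace ℝ (Fin d)) M] [IsManifold (𝓡 d) ∞ M]
  [TopologicalSpace B] [T2Space B] [CompactSpace B] [ConnectedSpace B]
  [ChartedSpace (EuclideanSpace ℝ (Fin d')) B] [IsManifold (𝓡 d') ∞ B]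
  {T : TorusAction k d M} {A : TorusAction 1 d M} {A' : TorusAction 1 d' B} {w : Fin k → ℝ}
  {p q : ℕ}

/-- The quotient of `M × B` by the flow of `w` and by the rotations `(A(p θ), A'(-q θ))` is an
orbibundle over `B / A'` with generic fibre `N / ℤ_q`. -/
theorem isOrbibundle_of_isOrbitMap [TopologicalSpace Z] (hpq : Nat.Coprime p q)
    (hc : ∀ v θ x, T.act v (A.rot θ x) = A.rot θ (T.act v x)) (hw : T.IsPeriodic w)
    (hv : ∀ x, T.velocity w x ≠ 0) (hv' : ∀ y, A'.velocity (fun _ => 1) y ≠ 0) (hq : 0 < q)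
    {e e' e'' : ℕ} (he : d = 1 + e) (he' : d' = 1 + e') (he'' : e'' = e + e') {qZ : M × B → Z}
    (hZ : (joinAction T A A' w p q hc hw hv hv' hq).IsOrbitMap qZ) {π : Z → A'.CircleQuotient}
    (hπ : ∀ z, π (qZ z) = Quotient.mk _ z.2) :
    IsOrbibundle (quotientCharts ((𝓡 d).prod (𝓡 d')) qZ
        (joinAction T A A' w p q hc hw hv hv' hq).vertical e'')
      (flowQuotientCharts A' (fun _ => 1) e') (cyclicQuotientCharts A T w q e) π := by
  have : SecondCountableTopology M :=
    ChartedSpace.secondCountable_of_sigmaCompact (EuclideanSpace ℝ (Fin d)) M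
  have : SecondCountableTopology B :=
    ChartedSpace.secondCountable_of_sigmaCompact (EuclideanSpace ℝ (Fin d')) B
  have hF := isOrbitMap_cyclicMk (A := A) hc hw hv hq
  have hB := A'.isOrbitMap_circleQuotient hv'
  have hℱ : cyclicQuotientCharts A T w q e = quotientCharts (𝓡 d) (T.cyclicMk A w q)
      (flowAction T A w q hc hw hv hq).vertical e := by
    rw [flowAction_vertical]
    rfl
  have hℬ : flowQuotientCharts A' (fun _ => 1) e' =
      quotientCharts (𝓡 d') (Quotient.mk (A'.orbitSetoid fun _ => 1))
        (A'.circleAction hv').vertical e' := by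
    rw [circleAction, flowAction_vertical]
    rfl
  have hFq := hF.isOpenQuotientMap
  have hZq := hZ.isOpenQuotientMap
  have hrel : ∀ z z', qZ z = qZ z' ↔ _ := fun z z' =>
    (hZ.eq_iff z z').trans (joinAction_rel_iff hpq hc hw hv hv' hq z z')
  have hπc : Continuous π := hZq.isQuotientMap.continuous_iff.2
    ((hB.isOpenQuotientMap.continuous.comp continuous_snd).congr fun z => (hπ z).symm)
  refine ⟨?_, ?_, ?_, hπc, fun b => ?_⟩
  · exact LocallyFreeAction.isOrbifoldAtlas_quotientCharts _ hZ (by simp; omega)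
  · rw [hℬ]
    exact LocallyFreeAction.isOrbifoldAtlas_quotientCharts _ hB (by simpa using he')
  · rw [hℱ]
    exact LocallyFreeAction.isOrbifoldAtlas_quotientCharts _ hF (by simpa using he)
  obtain ⟨y, rfl⟩ := hB.isOpenQuotientMap.surjective b
  obtain ⟨c, s, hcm, hφ, ⟨u₀, hu₀⟩, hs, hst, h₁, h₂, h₃, hsi⟩ := A'.exists_circle_slice hv' he' y
  refine ⟨c, hcm, ⟨u₀, by rw [← hφ, hu₀]⟩, ?_⟩
  -- the rotations of the fibre
  have hR : ∀ t x y, T.cyclicMk A w q x = T.cyclicMk A w q y → _ := cyclicMk_rot (hc := hc)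
  -- A rotation of `B` by t forces the rotation of `M` by -(p/q)t. For integral t this is a multiple
  -- of 1/q, hence trivial on N/ℤ_q, so `R` descends to ℝ/ℤ.
  let R : ℝ → (CyclicQuotient A T w q ≃ₜ CyclicQuotient A T w q) := fun t =>
    A.quotientRot hFq.isQuotientMap hR (-(p / q) * t)
  have hRx : ∀ t x, R t (T.cyclicMk A w q x) = T.cyclicMk A w q (A.rot (-(p / q) * t) x) :=
    fun t x => A.quotientRot_apply _ hR _ x
  have hRadd : ∀ t t', R (t + t') = R t * R t' := fun t t' => by
    rw [← A.quotientRot_add, ← mul_add]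
  have hRint : ∀ n : ℤ, R n = 1 := fun n => Homeomorph.ext fun f => by
    obtain ⟨x, rfl⟩ := hFq.surjective f
    rw [hRx, eq_comm]
    refine (cyclicMk_eq_iff hc _ _).2 ⟨0, -p * n, ?_⟩
    rw [zero_smul, T.act_zero]
    congr 1
    push_cast
    ring
  have hReq : ∀ t t', (∀ u, A'.rot t (s u) = A'.rot t' (s u)) → R t = R t' := fun t t' h => by
    obtain ⟨n, hn⟩ := h₃ (-t' + t) fun u => by rw [rot_add, h, rot_rot, neg_add_cancel, rot_zero]
    rw [show t = t' + n by rw [← hn]; ring, hRadd, hRint, mul_one]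
  -- The angle inducing γ on the slice is determined up to an integer, and `R` is trivial on
  -- integers; so γ ↦ R(τ γ) is a homomorphism although `τ` is chosen arbitrarily.
  choose τ hτ using h₁
  let ρ : c.Γ →* (CyclicQuotient A T w q ≃ₜ CyclicQuotient A T w q) :=
    MonoidHom.mk' (fun γ => R (τ γ)) fun γ γ' => by
      rw [← hRadd]
      refine hReq _ _ fun u => ?_
      rw [hτ, rot_add, hτ, hτ]
      rfl
  -- the trivialization
  let Ψ : c.U × CyclicQuotient A T w q → Z := fun z =>
    qZ (Function.surjInv hFq.surjective z.2, s z.1)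
  have hrel' : ∀ x b x' b', qZ (x, b) = qZ (x', b') ↔
      ∃ t, R t (T.cyclicMk A w q x) = T.cyclicMk A w q x' ∧ A'.rot t b = b' := fun x b x' b' => by
    simp only [hRx]
    exact hrel (x, b) (x', b')
  have hΨ : ∀ u x, Ψ (u, T.cyclicMk A w q x) = qZ (x, s u) := fun u x => by
    refine (hrel' _ _ _ _).2 ⟨0, ?_, A'.rot_zero _⟩
    rw [Function.surjInv_eq hFq.surjective, ← Int.cast_zero, hRint]
    rfl
  have hΨc : Continuous Ψ := by
    rw [(IsOpenQuotientMap.id.prodMap hFq).isQuotientMap.continuous_iff]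
    refine (hZq.continuous.comp (continuous_snd.prodMk (hs.continuous.comp continuous_fst))).congr
      fun z => (hΨ z.1 z.2).symm
  have hlift : ∀ f ∈ cyclicQuotientCharts A T w q e, ∀ u : c.U × f.U,
      (joinAction T A A' w p q hc hw hv hv' hq).HasTransverseLift ((𝓡 e').prod (𝓡 e)) qZ
        (fun z => Ψ (z.1, f.φ z.2)) u := by
    intro f hf u
    rw [hℱ] at hf
    obtain ⟨O, σ, hO, huO, hσ, hσf, hσt⟩ := LocallyFreeAction.mem_quotientCharts_iff _ |>.1 hf u.2
    refine ⟨univ ×ˢ O, fun z => (σ z.2, s z.1), isOpen_univ.prod hO, ⟨trivial, huO⟩,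
      (hσ.comp contMDiffOn_snd fun _ hz => hz.2).prodMk
        (hs.comp_contMDiffOn contMDiffOn_fst), fun z hz => ?_, ?_⟩
    · exact (hΨ z.1 (σ z.2)).symm.trans (congrArg (fun f => Ψ (z.1, f)) (hσf _ hz.2))
    · exact transverse_joinAction hc hw hv hv' hq
        ((hσ.contMDiffAt (hO.mem_nhds huO)).mdifferentiableAt (by simp))
        (hs.mdifferentiable (by simp) _) hσt (hst _)
  have hqi : ∀ g x, qZ ((joinAction T A A' w p q hc hw hv hv' hq).act g x) = qZ x := fun g x =>
    ((hZ.eq_iff _ _).2 ⟨g, rfl⟩).symm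
  refine ⟨ρ, Ψ, fun γ => ?_, hΨc, ?_, ?_, ?_, ?_, ?_⟩
  · intro f hf f' hf'
    rw [hℱ] at hf hf'
    refine LocallyFreeAction.locallyDiffeomorphic_of_hasTransverseLift _ hF.eq_iff
      (fun u => ?_) hf'
    obtain ⟨O, σ, hO, huO, hσ, hσf, hσt⟩ := LocallyFreeAction.mem_quotientCharts_iff _ |>.1 hf u
    refine ⟨O, fun z => A.rot (-(p / q) * τ γ) (σ z), hO, huO,
      (A.contMDiff_act _).comp_contMDiffOn hσ, fun z hz => ?_, ?_⟩
    · rw [← hRx, hσf z hz]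
      rfl
    · refine hσt.comp _ ((hσ.contMDiffAt (hO.mem_nhds huO)).mdifferentiableAt (by simp))
        (A.mdifferentiable_act _) (fun g x => ?_) (A.modelDeriv_act_bijective _ _)
      change A.rot _ (T.act _ (A.rot _ _)) = T.act _ (A.rot _ (A.rot _ _))
      rw [← hc, rot_rot, rot_rot, add_comm]
  -- In a chart of the fibre, `Ψ` lifts to a transversal in M × B, and maps with transverse lifts
  -- are open.
  · refine isOpenMap_iff_nhds_le.2 fun z => ?_
    obtain ⟨u, f⟩ := z
    have hcov : ∃ c ∈ cyclicQuotientCharts A T w q e, f ∈ range c.φ := by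
      rw [hℱ]
      exact (LocallyFreeAction.isOrbifoldAtlas_quotientCharts _ hF (by simpa using he)).covers f
    obtain ⟨χ, hχ, v, rfl⟩ := hcov
    refine (LocallyFreeAction.nhds_le_map_of_hasTransverseLift _ hZq.isOpenMap hqi
      (hlift χ hχ (u, v))).trans ?_
    have hcont : Continuous fun z : c.U × χ.U => (z.1, χ.φ z.2) :=
      continuous_fst.prodMk (χ.continuous.comp continuous_snd)
    exact (Filter.map_map (f := 𝓝 (u, v)) (m := fun z : c.U × χ.U => (z.1, χ.φ z.2))
      (m' := Ψ)).symm.le.trans (Filter.map_mono (hcont.tendsto (u, v)))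
  · ext z
    constructor
    · rintro ⟨z, rfl⟩
      exact ⟨z.1, by rw [← hφ, hπ]⟩
    · rintro ⟨u, hu⟩
      obtain ⟨⟨x, b⟩, rfl⟩ := hZq.surjective z
      rw [hπ, ← hφ] at hu
      obtain ⟨g, hg⟩ := (hB.eq_iff _ _).1 hu
      rw [circleAction_act] at hg
      -- Rotating the component in `B` back onto the slice is compensated in the fibre by `R`.
      obtain ⟨x', hx'⟩ := hFq.surjective (R (-g.1) (T.cyclicMk A w q x))
      refine ⟨(u, T.cyclicMk A w q x'), ?_⟩
      rw [hΨ, eq_comm]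
      refine (hrel' _ _ _ _).2 ⟨-g.1, hx'.symm, ?_⟩
      rw [← show A'.rot g.1 (s u) = b from hg, rot_rot, neg_add_cancel, rot_zero]
  · intro u f
    rw [← hφ, hπ]
  · intro u f u' f'
    obtain ⟨x, rfl⟩ := hFq.surjective f
    obtain ⟨x', rfl⟩ := hFq.surjective f'
    rw [hΨ, hΨ, hrel']
    constructor
    · rintro ⟨t, hx, ht⟩
      -- A rotation joining two points of the slice comes from Γ, and its angle may differ from the
      -- chosen `τ γ` by an integer only.
      obtain ⟨γ, hγ⟩ := h₂ t u u' ht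
      refine ⟨γ, hsi (by rw [← hγ, ht]), ?_⟩
      rw [← hx, hReq t (τ γ) fun u => by rw [hγ, hτ]]
      rfl
    · rintro ⟨γ, rfl, hγ⟩
      exact ⟨τ γ, hγ, hτ γ u⟩
  · exact fun f hf c' hc' =>
      LocallyFreeAction.locallyDiffeomorphic_of_hasTransverseLift _ hZ.eq_iff (hlift f hf) hc'

theorem exists_isOrbibundle_of_isOrbitMap [TopologicalSpace Z] (hpq : Nat.Coprime p q)
    (hc : ∀ v θ x, T.act v (A.rot θ x) = A.rot θ (T.act v x)) (hw : T.IsPeriodic w)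
    (hv : ∀ x, T.velocity w x ≠ 0) (hv' : ∀ y, A'.velocity (fun _ => 1) y ≠ 0) (hq : 0 < q)
    {e e' e'' : ℕ} (he : d = 1 + e) (he' : d' = 1 + e') (he'' : e'' = e + e') {qZ : M × B → Z}
    (hZ : (joinAction T A A' w p q hc hw hv hv' hq).IsOrbitMap qZ) :
    ∃ π : Z → A'.CircleQuotient, (∀ x y, π (qZ (x, y)) = Quotient.mk _ y) ∧
      IsOrbibundle (quotientCharts ((𝓡 d).prod (𝓡 d')) qZ
          (joinAction T A A' w p q hc hw hv hv' hq).vertical e'')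
        (flowQuotientCharts A' (fun _ => 1) e') (cyclicQuotientCharts A T w q e) π := by
  have hs := hZ.isOpenQuotientMap.surjective
  have hπ : ∀ z, (Quotient.mk (A'.orbitSetoid fun _ => 1) (Function.surjInv hs (qZ z)).2)
      = Quotient.mk _ z.2 := fun z => by
    obtain ⟨g, hg⟩ := (hZ.eq_iff _ _).1 (Function.surjInv_eq hs (qZ z))
    refine Quotient.sound ⟨-q * g.1.2, ?_⟩
    rw [← rot_eq_act_smul]
    exact congrArg Prod.snd hg
  exact ⟨fun z => Quotient.mk _ (Function.surjInv hs z).2, fun x y => hπ (x, y),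
    isOrbibundle_of_isOrbitMap hpq hc hw hv hv' hq he he' he'' hZ hπ⟩

end Orbibundle

end TorusAction

/-! ## Quotients of the join -/

/-- For the second subcone the flowing factor must be put first. An inclusion is enough, since
applying it in both directions gives equality of the two sets of charts. -/
theorem quotientCharts_swap_subset {d d' e : ℕ} {M B X : Type*} [TopologicalSpace M]
    [ChartedSpace (EuclideanSpace ℝ (Fin d)) M] [TopologicalSpace B]
    [ChartedSpace (EuclideanSpace ℝ (Fin d')) B] [TopologicalSpace X] {q : M × B → X}
    {q' : B × M → X} (hq : ∀ x y, q (x, y) = q' (y, x))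
    {𝒱 : M × B → Submodule ℝ (EuclideanSpace ℝ (Fin d) × EuclideanSpace ℝ (Fin d'))}
    {𝒱' : B × M → Submodule ℝ (EuclideanSpace ℝ (Fin d') × EuclideanSpace ℝ (Fin d))}
    (h𝒱 : ∀ x y a b, (a, b) ∈ 𝒱 (x, y) ↔ (b, a) ∈ 𝒱' (y, x)) :
    quotientCharts ((𝓡 d).prod (𝓡 d')) q 𝒱 e ⊆ quotientCharts ((𝓡 d').prod (𝓡 d)) q' 𝒱' e := by
  intro c hc u
  obtain ⟨O, s, hO, hu, hs, hqs, hi, hcompl⟩ := hc u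
  have hs₁ : ContMDiffOn (𝓡 e) (𝓡 d) ∞ (fun u => (s u).1) O := contMDiff_fst.comp_contMDiffOn hs
  have hs₂ : ContMDiffOn (𝓡 e) (𝓡 d') ∞ (fun u => (s u).2) O := contMDiff_snd.comp_contMDiffOn hs
  have hd₁ := (hs₁.contMDiffAt (hO.mem_nhds hu)).mdifferentiableAt (by simp)
  have hd₂ := (hs₂.contMDiffAt (hO.mem_nhds hu)).mdifferentiableAt (by simp)
  let L := LinearEquiv.prodComm ℝ (EuclideanSpace ℝ (Fin d)) (EuclideanSpace ℝ (Fin d'))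
  have hL : ∀ v, modelDeriv (𝓡 e) ((𝓡 d').prod (𝓡 d)) (fun u => ((s u).2, (s u).1)) u v
      = L (modelDeriv (𝓡 e) ((𝓡 d).prod (𝓡 d')) s u v) := fun v => by
    rw [modelDeriv_prodMk hd₂ hd₁]
    exact congrArg L (modelDeriv_prodMk hd₁ hd₂ v).symm
  refine ⟨O, fun u => ((s u).2, (s u).1), hO, hu, hs₂.prodMk hs₁, fun w hw => ?_, ?_, ?_⟩
  · rw [← hqs w hw, ← hq]
  · intro v v' h
    exact hi (L.injective ((hL v).symm.trans (Eq.trans h (hL v'))))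
  · have h₁ : (modelDeriv (𝓡 e) ((𝓡 d').prod (𝓡 d)) (fun u => ((s u).2, (s u).1)) u).range
        = (modelDeriv (𝓡 e) ((𝓡 d).prod (𝓡 d')) s u).range.map L.toLinearMap := by
      ext z
      constructor
      · rintro ⟨v, rfl⟩
        exact ⟨_, ⟨v, rfl⟩, (hL v).symm⟩
      · rintro ⟨_, ⟨v, rfl⟩, rfl⟩
        exact ⟨v, hL v⟩
    have h₂ : 𝒱' ((s u).2, (s u).1) = (𝒱 (s u)).map L.toLinearMap := by
      ext z
      obtain ⟨b, a⟩ := z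
      rw [← h𝒱]
      constructor
      · exact fun h => ⟨(a, b), h, rfl⟩
      · rintro ⟨z, hz, h⟩
        obtain ⟨rfl, rfl⟩ := Prod.mk.inj h
        exact hz
    have h₃ := IsCompl.map (Submodule.orderIsoMapComap L) hcompl
    change IsCompl (modelDeriv (𝓡 e) ((𝓡 d').prod (𝓡 d)) (fun u => ((s u).2, (s u).1)) u).range
      (𝒱' ((s u).2, (s u).1))
    rw [h₁, h₂]
    exact h₃

namespace TorusAction

/-! ### Periodicity on the factor from periodicity on the join. -/

section Periodicity

variable {k d d' : ℕ} {M B : Type*} [TopologicalSpace M]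
  [ChartedSpace (EuclideanSpace ℝ (Fin d)) M] [TopologicalSpace B]
  [ChartedSpace (EuclideanSpace ℝ (Fin d')) B] {T : TorusAction k d M} {A : TorusAction 1 d M}
  {A' : TorusAction 1 d' B}

/-- N is the order of the finite stabilizer of `y`: the N-th power of a rotation in it is the
identity everywhere, so N t is an integer by effectiveness. -/
theorem exists_natCast_mul_eq_intCast [T2Space B] [IsManifold (𝓡 d') ∞ B]
    (hv : ∀ y, A'.velocity (fun _ => 1) y ≠ 0) (y : B) :
    ∃ N : ℕ, 0 < N ∧ ∀ t, A'.rot t y = y → ∃ n : ℤ, N * t = n := by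
  have := (A'.circleAction hv).finite_stab y
  refine ⟨Nat.card ((A'.circleAction hv).stab y), Nat.card_pos, fun t ht => ?_⟩
  refine A'.exists_eq_intCast_of_rot_eq fun x => ?_
  let f := (A'.circleAction hv).toStab (g := (t, 0)) ((A'.circleAction_act hv _ y).trans ht)
  have hf : ∀ x, (f : Equiv.Perm B) x = A'.rot t x := A'.circleAction_act hv (t, 0)
  have hn : ∀ n : ℕ, ((f : Equiv.Perm B) ^ n) x = A'.rot (n * t) x := fun n => by
    induction n with
    | zero => rw [Nat.cast_zero, zero_mul, rot_zero, pow_zero]; rfl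
    | succ n ih =>
      rw [pow_succ', Equiv.Perm.mul_apply, ih, hf, rot_rot]
      congr 1
      push_cast
      ring
  rw [← hn, ← Subgroup.coe_pow, pow_card_eq_one']
  rfl

theorem act_natCast_mul_smul {v : Fin k → ℝ} {P s : ℝ} {x : M}
    (hc : ∀ v θ x, T.act v (A.rot θ x) = A.rot θ (T.act v x))
    (h : T.act (P • v) x = A.rot s x) (n : ℕ) :
    T.act ((n * P) • v) x = A.rot (n * s) x := by
  induction n with
  | zero => rw [Nat.cast_zero, zero_mul, zero_mul, zero_smul, T.act_zero, rot_zero]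
  | succ n ih =>
    rw [Nat.cast_succ, add_mul, add_mul, one_mul, one_mul, add_smul, T.act_add, h, hc, ih, rot_rot,
      add_comm]

/-- The angle depends on `x`, but for one fixed `y` a single N makes N q θ an integer for all of
them; then N q steps of length P rotate each x by p times an integer. -/
theorem isPeriodic_of_forall_exists [T2Space B] [IsManifold (𝓡 d') ∞ B] [Nonempty B]
    (hc : ∀ v θ x, T.act v (A.rot θ x) = A.rot θ (T.act v x))
    (hv : ∀ y, A'.velocity (fun _ => 1) y ≠ 0) {w : Fin k → ℝ} {P : ℝ} (hP : 0 < P) {p q : ℕ}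
    (hq : 0 < q)
    (h : ∀ x y, ∃ θ, T.act (P • w) x = A.rot (p * θ) x ∧ A'.rot (q * θ) y = y) :
    T.IsPeriodic w := by
  obtain ⟨y⟩ := ‹Nonempty B›
  obtain ⟨N, hN, hNy⟩ := exists_natCast_mul_eq_intCast hv y
  refine ⟨(N * q : ℕ) * P, mul_pos (Nat.cast_pos.2 (Nat.mul_pos hN hq)) hP, fun x => ?_⟩
  obtain ⟨θ, h₁, h₂⟩ := h x y
  obtain ⟨n, hn⟩ := hNy _ h₂
  rw [act_natCast_mul_smul hc h₁]
  have : ((N * q : ℕ) : ℝ) * (p * θ) = ((p * n : ℤ) : ℝ) := by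
    push_cast
    rw [← hn]
    ring
  rw [this, rot_intCast]

end Periodicity

end TorusAction

section Join

variable {k₁ k₂ d₁ d₂ : ℕ} {M₁ M₂ : Type*} [TopologicalSpace M₁]
  [ChartedSpace (EuclideanSpace ℝ (Fin d₁)) M₁] [TopologicalSpace M₂]
  [ChartedSpace (EuclideanSpace ℝ (Fin d₂)) M₂] {A₁ : TorusAction 1 d₁ M₁}
  {A₂ : TorusAction 1 d₂ M₂} {T₁ : TorusAction k₁ d₁ M₁} {T₂ : TorusAction k₂ d₂ M₂} {l₁ l₂ : ℕ}
  {v₁ : Fin k₁ → ℝ} {v₂ : Fin k₂ → ℝ}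

theorem Join.mk_eq_iff {x x' : M₁} {y y' : M₂} :
    Join.mk A₁ A₂ l₁ l₂ x y = Join.mk A₁ A₂ l₁ l₂ x' y' ↔
      ∃ θ : ℝ, A₁.rot (l₂ * θ) x = x' ∧ A₂.rot (-(l₁ * θ)) y = y' :=
  Quotient.eq

/-- The projection of `M₁ × M₂` to the quotient of the join by a flow. -/
def joinFlowMk (A₁ : TorusAction 1 d₁ M₁) (A₂ : TorusAction 1 d₂ M₂) (l₁ l₂ : ℕ)
    (T₁ : TorusAction k₁ d₁ M₁) (T₂ : TorusAction k₂ d₂ M₂) (v₁ : Fin k₁ → ℝ) (v₂ : Fin k₂ → ℝ)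
    (z : M₁ × M₂) : JoinFlowQuotient A₁ A₂ l₁ l₂ T₁ T₂ v₁ v₂ :=
  Quot.mk _ (Join.mk A₁ A₂ l₁ l₂ z.1 z.2)

theorem isQuotientMap_joinFlowMk : IsQuotientMap (joinFlowMk A₁ A₂ l₁ l₂ T₁ T₂ v₁ v₂) :=
  isQuotientMap_quot_mk.comp isQuotientMap_quotient_mk'

theorem joinFlowMk_eq_iff (hc₁ : ∀ v θ x, T₁.act v (A₁.rot θ x) = A₁.rot θ (T₁.act v x))
    (hc₂ : ∀ v θ x, T₂.act v (A₂.rot θ x) = A₂.rot θ (T₂.act v x)) (z z' : M₁ × M₂) :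
    joinFlowMk A₁ A₂ l₁ l₂ T₁ T₂ v₁ v₂ z = joinFlowMk A₁ A₂ l₁ l₂ T₁ T₂ v₁ v₂ z' ↔
      ∃ t θ : ℝ, T₁.act (t • v₁) (A₁.rot (l₂ * θ) z.1) = z'.1 ∧
        T₂.act (t • v₂) (A₂.rot (-(l₁ * θ)) z.2) = z'.2 := by
  have hmk : ∀ a, ∃ x y, a = Join.mk A₁ A₂ l₁ l₂ x y := fun a => by
    obtain ⟨⟨x, y⟩, rfl⟩ := Quotient.exists_rep a
    exact ⟨x, y, rfl⟩
  have he : Equivalence (joinFlowRel A₁ A₂ l₁ l₂ T₁ T₂ v₁ v₂) := by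
    refine ⟨fun a => ?_, ?_, ?_⟩
    · obtain ⟨x, y, rfl⟩ := hmk a
      exact ⟨0, x, y, rfl, by rw [zero_smul, zero_smul, T₁.act_zero, T₂.act_zero]⟩
    · rintro _ _ ⟨t, x, y, rfl, rfl⟩
      exact ⟨-t, _, _, rfl, by rw [neg_smul, neg_smul, T₁.act_neg_act, T₂.act_neg_act]⟩
    · rintro _ _ _ ⟨t, x, y, rfl, rfl⟩ ⟨t', x', y', h, rfl⟩
      obtain ⟨θ, rfl, rfl⟩ := Join.mk_eq_iff.1 h
      refine ⟨t' + t, x, y, rfl, ?_⟩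
      rw [eq_comm, Join.mk_eq_iff]
      exact ⟨θ, by rw [hc₁, add_smul, T₁.act_add], by rw [hc₂, add_smul, T₂.act_add]⟩
  refine (he.quot_mk_eq_iff _ _).trans ⟨?_, ?_⟩
  · rintro ⟨t, x, y, h, h'⟩
    obtain ⟨θ, rfl, rfl⟩ := Join.mk_eq_iff.1 h
    obtain ⟨θ', h₁, h₂⟩ := Join.mk_eq_iff.1 h'.symm
    refine ⟨t, θ' + θ, ?_, ?_⟩
    · rw [← h₁, hc₁, hc₁, A₁.rot_rot, mul_add]
    · rw [← h₂, hc₂, hc₂, A₂.rot_rot, mul_add, neg_add]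
  · rintro ⟨t, θ, h₁, h₂⟩
    refine ⟨t, z.1, z.2, rfl, ?_⟩
    rw [eq_comm, Join.mk_eq_iff]
    exact ⟨θ, by rw [← hc₁, h₁], by rw [← hc₂, h₂]⟩

end Join

/-! ### Replacing the flow on the join by the flow on one factor. -/

section SubconeQuotients

variable {k₁ k₂ d₁ d₂ : ℕ} {M₁ M₂ : Type*} [TopologicalSpace M₁]
  [ChartedSpace (EuclideanSpace ℝ (Fin d₁)) M₁] [TopologicalSpace M₂]
  [ChartedSpace (EuclideanSpace ℝ (Fin d₂)) M₂] {A₁ : TorusAction 1 d₁ M₁}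
  {A₂ : TorusAction 1 d₂ M₂} {T₁ : TorusAction k₁ d₁ M₁} {T₂ : TorusAction k₂ d₂ M₂} {l₁ l₂ : ℕ}
  {v₁ : Fin k₁ → ℝ} {v₂ : Fin k₂ → ℝ} {κ : ℝ}

open TorusAction

theorem velocity_const {d : ℕ} {M : Type*} [TopologicalSpace M]
    [ChartedSpace (EuclideanSpace ℝ (Fin d)) M] (A : TorusAction 1 d M) (l : ℝ) (x : M) :
    A.velocity (fun _ => l) x = l • A.velocity (fun _ => 1) x := by
  rw [← velocity_smul]
  congr 1
  exact funext fun _ => (mul_one l).symm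

/-- The tangent spaces of the orbits in `M₁ × M₂`. -/
def joinVert (A₁ : TorusAction 1 d₁ M₁) (A₂ : TorusAction 1 d₂ M₂) (l₁ l₂ : ℕ)
    (T₁ : TorusAction k₁ d₁ M₁) (T₂ : TorusAction k₂ d₂ M₂) (v₁ : Fin k₁ → ℝ) (v₂ : Fin k₂ → ℝ)
    (z : M₁ × M₂) : Submodule ℝ (EuclideanSpace ℝ (Fin d₁) × EuclideanSpace ℝ (Fin d₂)) :=
  Submodule.span ℝ {(T₁.velocity v₁ z.1, T₂.velocity v₂ z.2),
    (A₁.velocity (fun _ => l₂) z.1, A₂.velocity (fun _ => -l₁) z.2)}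

theorem mem_joinVert_iff {z : M₁ × M₂} {a : EuclideanSpace ℝ (Fin d₁)}
    {b : EuclideanSpace ℝ (Fin d₂)} :
    (a, b) ∈ joinVert A₁ A₂ l₁ l₂ T₁ T₂ v₁ v₂ z ↔ ∃ r s : ℝ,
      r • T₁.velocity v₁ z.1 + (s * l₂) • A₁.velocity (fun _ => 1) z.1 = a ∧
        r • T₂.velocity v₂ z.2 + (-(s * l₁)) • A₂.velocity (fun _ => 1) z.2 = b := by
  rw [joinVert, Submodule.mem_span_pair]
  refine exists_congr fun r => exists_congr fun s => Prod.mk.injEq _ _ _ _ |>.to_iff.trans ?_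
  rw [velocity_const A₁, velocity_const A₂]
  simp only [Prod.smul_mk, smul_smul, mul_neg]

/-- For time t the flow of (v₁, v₂) is the flow of (w, 0) for time t/l₁ combined with the join
circle at angle tκ, so (t, θ) ↦ (t/l₁, tκ + θ) is an invertible change of parameters between the two
groups. -/
theorem isOrbitMap_joinFlowMk_left
    (hc₁ : ∀ v θ x, T₁.act v (A₁.rot θ x) = A₁.rot θ (T₁.act v x))
    (hc₂ : ∀ v θ x, T₂.act v (A₂.rot θ x) = A₂.rot θ (T₂.act v x)) {w : Fin k₁ → ℝ}
    (hw : T₁.IsPeriodic w) (hv : ∀ x, T₁.velocity w x ≠ 0)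
    (hv' : ∀ y, A₂.velocity (fun _ => 1) y ≠ 0) (hl₁ : 0 < l₁)
    (h₁ : ∀ (t : ℝ) x, T₁.act (t • v₁) x = T₁.act ((t / l₁) • w) (A₁.rot (l₂ * (t * κ)) x))
    (h₂ : ∀ (t : ℝ) y, T₂.act (t • v₂) y = A₂.rot (-(l₁ * (t * κ))) y) :
    (joinAction T₁ A₁ A₂ w l₂ l₁ hc₁ hw hv hv' hl₁).IsOrbitMap
      (joinFlowMk A₁ A₂ l₁ l₂ T₁ T₂ v₁ v₂) := by
  have hl : (l₁ : ℝ) ≠ 0 := Nat.cast_ne_zero.2 hl₁.ne'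
  refine .of_isQuotientMap _ isQuotientMap_joinFlowMk fun z z' => ?_
  rw [joinFlowMk_eq_iff hc₁ hc₂]
  simp only [h₁, h₂, rot_rot]
  constructor
  · rintro ⟨t, θ, h, h'⟩
    refine ⟨((t / l₁, t * κ + θ), 0), Prod.ext (Eq.trans ?_ h) (Eq.trans ?_ h')⟩
    · change T₁.act _ (A₁.rot (l₂ * (t * κ + θ)) z.1) = _
      congr 2
      ring
    · exact congrArg (fun s => A₂.rot s z.2) (by ring)
  · rintro ⟨⟨⟨r, θ⟩, i⟩, rfl⟩
    refine ⟨l₁ * r, θ - l₁ * r * κ, ?_, ?_⟩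
    · rw [mul_div_cancel_left₀ _ hl]
      change _ = T₁.act (r • w) (A₁.rot (l₂ * θ) z.1)
      congr 2
      ring
    · exact congrArg (fun s => A₂.rot s z.2) (by ring)

theorem isOrbitMap_joinFlowMk_right
    (hc₁ : ∀ v θ x, T₁.act v (A₁.rot θ x) = A₁.rot θ (T₁.act v x))
    (hc₂ : ∀ v θ x, T₂.act v (A₂.rot θ x) = A₂.rot θ (T₂.act v x)) {w : Fin k₂ → ℝ}
    (hw : T₂.IsPeriodic w) (hv : ∀ x, T₂.velocity w x ≠ 0)
    (hv' : ∀ y, A₁.velocity (fun _ => 1) y ≠ 0) (hl₂ : 0 < l₂)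
    (h₁ : ∀ (t : ℝ) x, T₁.act (t • v₁) x = A₁.rot (l₂ * (t * κ)) x)
    (h₂ : ∀ (t : ℝ) y, T₂.act (t • v₂) y = T₂.act ((t / l₂) • w) (A₂.rot (-(l₁ * (t * κ))) y)) :
    (joinAction T₂ A₂ A₁ w l₁ l₂ hc₂ hw hv hv' hl₂).IsOrbitMap
      (fun z => joinFlowMk A₁ A₂ l₁ l₂ T₁ T₂ v₁ v₂ (z.2, z.1)) := by
  have hl : (l₂ : ℝ) ≠ 0 := Nat.cast_ne_zero.2 hl₂.ne'
  refine .of_isQuotientMap _ (isQuotientMap_joinFlowMk.comp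
    (Homeomorph.prodComm M₂ M₁).isQuotientMap) fun z z' => ?_
  rw [joinFlowMk_eq_iff hc₁ hc₂]
  simp only [h₁, h₂, rot_rot]
  constructor
  · rintro ⟨t, θ, h, h'⟩
    -- The sign changes because `joinAction` rotates its first factor positively, while the join
    -- circle rotates M₂ negatively.
    refine ⟨((t / l₂, -(t * κ + θ)), 0), Prod.ext (Eq.trans ?_ h') (Eq.trans ?_ h)⟩
    · change T₂.act _ (A₂.rot (l₁ * -(t * κ + θ)) z.1) = _
      congr 2
      ring
    · exact congrArg (fun s => A₁.rot s z.2) (by ring)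
  · rintro ⟨⟨⟨r, θ⟩, i⟩, rfl⟩
    refine ⟨l₂ * r, -θ - l₂ * r * κ, ?_, ?_⟩
    · exact congrArg (fun s => A₁.rot s z.2) (by ring)
    · rw [mul_div_cancel_left₀ _ hl]
      change _ = T₂.act (r • w) (A₂.rot (l₁ * θ) z.1)
      congr 2
      ring

theorem mem_vert_joinAction_iff {d d' k p q : ℕ} {M B : Type*} [TopologicalSpace M]
    [ChartedSpace (EuclideanSpace ℝ (Fin d)) M] [TopologicalSpace B]
    [ChartedSpace (EuclideanSpace ℝ (Fin d')) B]
    {T : TorusAction k d M} {A : TorusAction 1 d M} {A' : TorusAction 1 d' B} {w : Fin k → ℝ}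
    (hc : ∀ v θ x, T.act v (A.rot θ x) = A.rot θ (T.act v x)) (hw : T.IsPeriodic w)
    (hv : ∀ x, T.velocity w x ≠ 0) (hv' : ∀ y, A'.velocity (fun _ => 1) y ≠ 0) (hq : 0 < q)
    {z : M × B} {a : EuclideanSpace ℝ (Fin d)} {b : EuclideanSpace ℝ (Fin d')} :
    (a, b) ∈ (joinAction T A A' w p q hc hw hv hv' hq).vert z ↔ ∃ r s : ℝ,
      r • T.velocity w z.1 + (p * s) • A.velocity (fun _ => 1) z.1 = a ∧
        (-q * s) • A'.velocity (fun _ => 1) z.2 = b := by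
  refine Iff.trans ⟨fun ⟨r, hr⟩ => ⟨r.1, r.2, Eq.trans ?_ hr⟩, fun ⟨r, s, hr⟩ =>
    ⟨(r, s), Eq.trans ?_ hr⟩⟩ (exists_congr fun r => exists_congr fun s =>
      (Prod.mk.injEq _ _ _ _).to_iff)
  · exact (joinAction_orbitDeriv hc hw hv hv' hq z r).symm
  · exact joinAction_orbitDeriv hc hw hv hv' hq z (r, s)

/-- The same change of parameters, infinitesimally; it makes the orbifold charts of the two
descriptions agree. -/
theorem joinVert_eq_left (hc₁ : ∀ v θ x, T₁.act v (A₁.rot θ x) = A₁.rot θ (T₁.act v x))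
    {w : Fin k₁ → ℝ} (hw : T₁.IsPeriodic w) (hv : ∀ x, T₁.velocity w x ≠ 0)
    (hv' : ∀ y, A₂.velocity (fun _ => 1) y ≠ 0) (hl₁ : 0 < l₁)
    (h₁ : ∀ x, T₁.velocity v₁ x
      = (1 / l₁ : ℝ) • T₁.velocity w x + (l₂ * κ) • A₁.velocity (fun _ => 1) x)
    (h₂ : ∀ y, T₂.velocity v₂ y = (-(l₁ * κ)) • A₂.velocity (fun _ => 1) y) :
    joinVert A₁ A₂ l₁ l₂ T₁ T₂ v₁ v₂ = (joinAction T₁ A₁ A₂ w l₂ l₁ hc₁ hw hv hv' hl₁).vert := by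
  have hl : (l₁ : ℝ) ≠ 0 := Nat.cast_ne_zero.2 hl₁.ne'
  funext z
  ext ⟨a, b⟩
  rw [mem_joinVert_iff, mem_vert_joinAction_iff, h₁, h₂]
  constructor
  · rintro ⟨r, s, rfl, rfl⟩
    exact ⟨r / l₁, r * κ + s, by module, by module⟩
  · rintro ⟨r, s, rfl, rfl⟩
    refine ⟨l₁ * r, s - l₁ * r * κ, ?_, by module⟩
    match_scalars <;> field_simp
    ring

theorem mem_joinVert_iff_right (hc₂ : ∀ v θ x, T₂.act v (A₂.rot θ x) = A₂.rot θ (T₂.act v x))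
    {w : Fin k₂ → ℝ} (hw : T₂.IsPeriodic w) (hv : ∀ x, T₂.velocity w x ≠ 0)
    (hv' : ∀ y, A₁.velocity (fun _ => 1) y ≠ 0) (hl₂ : 0 < l₂)
    (h₁ : ∀ x, T₁.velocity v₁ x = (l₂ * κ) • A₁.velocity (fun _ => 1) x)
    (h₂ : ∀ y, T₂.velocity v₂ y
      = (1 / l₂ : ℝ) • T₂.velocity w y + (-(l₁ * κ)) • A₂.velocity (fun _ => 1) y)
    (x : M₁) (y : M₂) (a : EuclideanSpace ℝ (Fin d₁)) (b : EuclideanSpace ℝ (Fin d₂)) :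
    (a, b) ∈ joinVert A₁ A₂ l₁ l₂ T₁ T₂ v₁ v₂ (x, y) ↔
      (b, a) ∈ (joinAction T₂ A₂ A₁ w l₁ l₂ hc₂ hw hv hv' hl₂).vert (y, x) := by
  have hl : (l₂ : ℝ) ≠ 0 := Nat.cast_ne_zero.2 hl₂.ne'
  rw [mem_joinVert_iff, mem_vert_joinAction_iff, h₁, h₂]
  constructor
  · rintro ⟨r, s, rfl, rfl⟩
    exact ⟨r / l₂, -(r * κ + s), by module, by module⟩
  · rintro ⟨r, s, rfl, rfl⟩
    refine ⟨l₂ * r, -s - l₂ * r * κ, by module, ?_⟩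
    match_scalars <;> field_simp
    ring

end SubconeQuotients

namespace TorusAction

variable {k n : ℕ} {M : Type*} [TopologicalSpace M] [T2Space M]
  [ChartedSpace (EuclideanSpace ℝ (Fin (2 * n + 1))) M] [IsManifold (𝓡 (2 * n + 1)) ∞ M]
  {S : SasakianStructure n M} {A : TorusAction 1 (2 * n + 1) M} {τ : ℝ}
  {T : TorusAction k (2 * n + 1) M}

/-- The element v - b w of the Lie algebra generates a multiple of the Reeb field, so its flow is a
rotation; the torus is abelian. -/
theorem act_smul_eq_act_smul_rot (hA : A.IsReebCircle S τ) {v w : Fin k → ℝ} {a b : ℝ}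
    (h : ∀ x, T.velocity v x = b • T.velocity w x + a • S.reeb x) (t : ℝ) (x : M) :
    T.act (t • v) x = T.act ((t * b) • w) (A.rot (t * (a / τ)) x) := by
  have hu : ∀ x, T.velocity (v + (-b) • w) x = a • S.reeb x := fun x => by
    rw [velocity_add, velocity_smul, h]
    module
  rw [← act_smul_eq_rot hA hu, ← T.act_add]
  congr 1
  module

end TorusAction

end

/-! ### The two subcones. -/

theorem mainTheorem8 {n₁ n₂ k₁ k₂ : ℕ} {M₁ : Type*} {M₂ : Type*}
    [TopologicalSpace M₁] [T2Space M₁] [CompactSpace M₁] [ConnectedSpace M₁]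
    [ChartedSpace (EuclideanSpace ℝ (Fin (2 * n₁ + 1))) M₁] [IsManifold (𝓡 (2 * n₁ + 1)) ∞ M₁]
    [TopologicalSpace M₂] [T2Space M₂] [CompactSpace M₂] [ConnectedSpace M₂]
    [ChartedSpace (EuclideanSpace ℝ (Fin (2 * n₂ + 1))) M₂] [IsManifold (𝓡 (2 * n₂ + 1)) ∞ M₂]
    (S₁ : SasakianStructure n₁ M₁) (S₂ : SasakianStructure n₂ M₂)
    (A₁ : TorusAction 1 (2 * n₁ + 1) M₁) (A₂ : TorusAction 1 (2 * n₂ + 1) M₂) (τ : ℝ)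
    (hA₁ : A₁.IsReebCircle S₁ τ) (hA₂ : A₂.IsReebCircle S₂ τ)
    (T₁ : TorusAction k₁ (2 * n₁ + 1) M₁) (T₂ : TorusAction k₂ (2 * n₂ + 1) M₂)
    (hT₁ : T₁.IsMaximalTorus S₁) (hT₂ : T₂.IsMaximalTorus S₂)
    (l₁ l₂ : ℕ) (hl₁ : 0 < l₁) (hl₂ : 0 < l₂) (hl : Nat.Coprime l₁ l₂)
    (v₁ : Fin k₁ → ℝ) (v₂ : Fin k₂ → ℝ)
    (hv : IsJoinPeriodic A₁ A₂ l₁ l₂ T₁ T₂ v₁ v₂) :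
    (∀ w, IsLeftSubconeImage S₁ S₂ T₁ T₂ l₁ l₂ w (v₁, v₂) →
      T₁.IsPeriodic w ∧ ∃ m : ℕ, 0 < m ∧
        ∃ p : JoinFlowQuotient A₁ A₂ l₁ l₂ T₁ T₂ v₁ v₂ → A₂.CircleQuotient,
          (∀ x y, p (Quot.mk _ (Join.mk A₁ A₂ l₁ l₂ x y)) = Quotient.mk _ y) ∧
          IsOrbibundle
            (joinFlowQuotientCharts A₁ A₂ l₁ l₂ T₁ T₂ v₁ v₂ (2 * (n₁ + n₂)))
            (flowQuotientCharts A₂ (fun _ => 1) (2 * n₂))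
            (cyclicQuotientCharts A₁ T₁ w m (2 * n₁)) p) ∧
    (∀ w, IsRightSubconeImage S₁ S₂ T₁ T₂ l₁ l₂ w (v₁, v₂) →
      T₂.IsPeriodic w ∧ ∃ m : ℕ, 0 < m ∧
        ∃ p : JoinFlowQuotient A₁ A₂ l₁ l₂ T₁ T₂ v₁ v₂ → A₁.CircleQuotient,
          (∀ x y, p (Quot.mk _ (Join.mk A₁ A₂ l₁ l₂ x y)) = Quotient.mk _ x) ∧
          IsOrbibundle
            (joinFlowQuotientCharts A₁ A₂ l₁ l₂ T₁ T₂ v₁ v₂ (2 * (n₁ + n₂)))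
            (flowQuotientCharts A₁ (fun _ => 1) (2 * n₁))
            (cyclicQuotientCharts A₂ T₂ w m (2 * n₂)) p) := by
  obtain ⟨P, hP, hPv⟩ := hv
  have hc₁ := TorusAction.act_rot_comm hA₁ hT₁.1
  have hc₂ := TorusAction.act_rot_comm hA₂ hT₂.1
  have hτ := hA₁.1.ne'
  have hl₁' : (l₁ : ℝ) ≠ 0 := Nat.cast_ne_zero.2 hl₁.ne'
  have hl₂' : (l₂ : ℝ) ≠ 0 := Nat.cast_ne_zero.2 hl₂.ne'
  constructor
  · rintro w ⟨hw, -, c, e₁, e₂⟩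
    -- The speed of the join circle contained in (v₁, v₂): its generator is τ(l₂ξ₁, -l₁ξ₂) = 2 l₁ l₂
    -- τ L, so c L is κ times this generator.
    let κ : ℝ := c / (2 * l₁ * l₂ * τ)
    have e₁' : ∀ x, T₁.velocity v₁ x
        = (1 / l₁ : ℝ) • T₁.velocity w x + (c / (2 * l₁)) • S₁.reeb x := e₁
    have e₂' : ∀ y, T₂.velocity v₂ y = (-(c / (2 * l₂))) • S₂.reeb y := e₂
    have h₁ : ∀ (t : ℝ) x, T₁.act (t • v₁) x
        = T₁.act ((t / l₁) • w) (A₁.rot (l₂ * (t * κ)) x) := fun t x => by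
      rw [TorusAction.act_smul_eq_act_smul_rot hA₁ e₁', mul_one_div]
      congr 2
      simp only [κ]
      field_simp
    have h₂ : ∀ (t : ℝ) y, T₂.act (t • v₂) y = A₂.rot (-(l₁ * (t * κ))) y := fun t y => by
      rw [TorusAction.act_smul_eq_rot hA₂ e₂']
      congr 1
      simp only [κ]
      field_simp
    have hwP : T₁.IsPeriodic w := by
      refine TorusAction.isPeriodic_of_forall_exists (p := l₂) hc₁ hA₂.velocity_ne_zero
        (div_pos hP (Nat.cast_pos.2 hl₁)) hl₁ fun x y => ?_
      obtain ⟨θ, hx, hy⟩ := Join.mk_eq_iff.1 (hPv x y)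
      rw [h₁, ← hc₁, A₁.rot_rot] at hx
      rw [h₂, A₂.rot_rot] at hy
      -- The angle θ comes from equality in the join and Pκ from the rotational part of the flow;
      -- moving the rotation to the other side changes the sign.
      refine ⟨-(θ + P * κ), ?_, ?_⟩
      · conv_rhs => rw [← hx]
        rw [← hc₁, A₁.rot_rot, ← mul_add, ← mul_add, neg_add_cancel, mul_zero, A₁.rot_zero]
      · conv_rhs => rw [← hy]
        congr 1
        ring
    obtain ⟨π, hπ, hπb⟩ := TorusAction.exists_isOrbibundle_of_isOrbitMap hl.symm hc₁ hwP
      (TorusAction.velocity_ne_zero_of_mem_sasakiCone hw) hA₂.velocity_ne_zero hl₁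
      (add_comm (2 * n₁) 1) (add_comm (2 * n₂) 1) (mul_add 2 n₁ n₂)
      (isOrbitMap_joinFlowMk_left hc₁ hc₂ hwP
        (TorusAction.velocity_ne_zero_of_mem_sasakiCone hw) hA₂.velocity_ne_zero hl₁ h₁ h₂)
    -- The order m is the weight l₁ by which the join circle rotates the base factor.
    refine ⟨hwP, l₁, hl₁, π, hπ, ?_⟩
    have hvert := joinVert_eq_left (l₂ := l₂) (κ := κ) hc₁ hwP
      (TorusAction.velocity_ne_zero_of_mem_sasakiCone hw) hA₂.velocity_ne_zero hl₁
      (fun x => by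
        rw [e₁', hA₁.velocity, smul_smul]
        congr 2
        simp only [κ]
        field_simp)
      (fun y => by
        rw [e₂', hA₂.velocity, smul_smul]
        congr 1
        simp only [κ]
        field_simp)
    have hch : joinFlowQuotientCharts A₁ A₂ l₁ l₂ T₁ T₂ v₁ v₂ (2 * (n₁ + n₂)) =
      quotientCharts ((𝓡 (2 * n₁ + 1)).prod (𝓡 (2 * n₂ + 1)))
        (joinFlowMk A₁ A₂ l₁ l₂ T₁ T₂ v₁ v₂) (joinVert A₁ A₂ l₁ l₂ T₁ T₂ v₁ v₂) _ := rfl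
    rw [hch, hvert]
    exact hπb
  · rintro w ⟨hw, -, c, e₁, e₂⟩
    let κ : ℝ := c / (2 * l₁ * l₂ * τ)
    have e₁' : ∀ x, T₁.velocity v₁ x = (c / (2 * l₁)) • S₁.reeb x := e₁
    have e₂' : ∀ y, T₂.velocity v₂ y
        = (1 / l₂ : ℝ) • T₂.velocity w y + (-(c / (2 * l₂))) • S₂.reeb y := fun y => by
      have := e₂ y
      rw [sub_eq_add_neg, ← neg_smul] at this
      exact this
    have h₁ : ∀ (t : ℝ) x, T₁.act (t • v₁) x = A₁.rot (l₂ * (t * κ)) x := fun t x => by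
      rw [TorusAction.act_smul_eq_rot hA₁ e₁']
      congr 1
      simp only [κ]
      field_simp
    have h₂ : ∀ (t : ℝ) y, T₂.act (t • v₂) y
        = T₂.act ((t / l₂) • w) (A₂.rot (-(l₁ * (t * κ))) y) := fun t y => by
      rw [TorusAction.act_smul_eq_act_smul_rot hA₂ e₂', mul_one_div]
      congr 2
      simp only [κ]
      field_simp
    have hwP : T₂.IsPeriodic w := by
      refine TorusAction.isPeriodic_of_forall_exists (p := l₁) hc₂ hA₁.velocity_ne_zero
        (div_pos hP (Nat.cast_pos.2 hl₂)) hl₂ fun y x => ?_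
      obtain ⟨θ, hx, hy⟩ := Join.mk_eq_iff.1 (hPv x y)
      rw [h₁, A₁.rot_rot] at hx
      rw [h₂, ← hc₂, A₂.rot_rot] at hy
      -- No sign here: the join circle already rotates M₂ by a negative multiple of the angle.
      refine ⟨θ + P * κ, ?_, ?_⟩
      · conv_rhs => rw [← hy]
        rw [← hc₂, A₂.rot_rot, ← neg_add, ← mul_add, add_neg_cancel, A₂.rot_zero]
      · conv_rhs => rw [← hx]
        rw [mul_add]
    obtain ⟨π, hπ, hπb⟩ := TorusAction.exists_isOrbibundle_of_isOrbitMap hl hc₂ hwP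
      (TorusAction.velocity_ne_zero_of_mem_sasakiCone hw) hA₁.velocity_ne_zero hl₂
      (add_comm (2 * n₂) 1) (add_comm (2 * n₁) 1)
      ((mul_add 2 n₁ n₂).trans (add_comm _ _))
      (isOrbitMap_joinFlowMk_right hc₁ hc₂ hwP
        (TorusAction.velocity_ne_zero_of_mem_sasakiCone hw) hA₁.velocity_ne_zero hl₂ h₁ h₂)
    refine ⟨hwP, l₂, hl₂, π, fun x y => hπ y x, ?_⟩
    have hvert := mem_joinVert_iff_right (l₁ := l₁) (κ := κ) hc₂ hwP
      (TorusAction.velocity_ne_zero_of_mem_sasakiCone hw) hA₁.velocity_ne_zero hl₂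
      (fun x => by
        rw [e₁', hA₁.velocity, smul_smul]
        congr 1
        simp only [κ]
        field_simp)
      (fun y => by
        rw [e₂', hA₂.velocity, smul_smul]
        congr 2
        simp only [κ]
        field_simp)
    have hch : joinFlowQuotientCharts A₁ A₂ l₁ l₂ T₁ T₂ v₁ v₂ (2 * (n₁ + n₂)) = _ :=
      Subset.antisymm
        (quotientCharts_swap_subset
          (q' := fun z => joinFlowMk A₁ A₂ l₁ l₂ T₁ T₂ v₁ v₂ (z.2, z.1)) (fun x y => rfl) hvert)
        (quotientCharts_swap_subset (q := fun z => joinFlowMk A₁ A₂ l₁ l₂ T₁ T₂ v₁ v₂ (z.2, z.1))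
          (fun x y => rfl) fun y x b a => (hvert x y a b).symm)
    rw [hch]
    exact hπb
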